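/- **Conventions.** All spaces are nonempty. A *name* of a real $x$ is a (coded) sequence of rationals $(q_n)$ with $|q_n-x|\le 2^{-n}$ for all $n$. An *effective presentation* of a metric space $(X,d)$ is an enumeration $(r_i)_{i\in\mathbb N}$ of a dense subset such that names of the reals $d(r_i,r_j)$ are computable uniformly in $(i,j)$; a name of $x\in X$ is then a sequence $\beta\in\mathbb N^{\mathbb N}$ with $d(r_{\beta(n)},x)\le 2^{-n}$ for all $n$. An *effective Banach space* is a real Banach space with an effective presentation in which addition and scalar multiplication are computable, i.e. names of $r_i+r_j$ and of $q\,r_i$ ($q\in\mathbb Q$) are computable uniformly in $i,j,q$. A metric space $X$ is *finitely saturated* if, for all finite metric spaces $K\subseteq L$, every isometric map $K\to X$ extends to an isometric map $L\to X$; the *Urysohn space* $U$ is the complete, separable, finitely saturated metric space (unique up to isometry). *Types* are the formal expressions built from variables $V_1,\dots,V_k$ by $\sigma,\tau\mapsto(\sigma\to\tau)$. For metric spaces $X_1,\dots,X_k$, the space $\sigma(X_1,\dots,X_k)$ is defined by interpreting $V_i$ as $X_i$ and $(\sigma\to\tau)$ as the set of continuous functions from the interpretation of $\sigma$ to that of $\tau$,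 with the finest topology in which $f_n\to f$ whenever $f_n(x_n)\to f(x)$ for all convergent sequences $x_n\to x$. If the $X_i$ have effective presentations, a name of $f\in(\sigma\to\tau)(X_1,\dots,X_k)$ is an associate $\alpha\in\mathbb N^{\mathbb N}$ (in the sense of Kleene) that takes every name of every $x$ to a name of $f(x)$. For a finite enumerated set $A$, $PD(A)$ is the space of probability distributions on $A$ (the standard simplex); a name of $m\in PD(A)$ consists of names of the reals $m(a)$, $a\in A$. **Theorem.** The Urysohn space $U$ has an effective presentation. Moreover, let each of $X_1,\dots,X_k$ be either an effective Banach space or the Urysohn space $U$ with an effective presentation, let $\sigma$ be a type in $V_1,\dots,V_k$, and let $X=\sigma(X_1,\dots,X_k)$. Then there are finite sets $A_n=\{0,\dots,N_n-1\}$, maps $\nu_n:A_n\to X$ and continuous maps $\mu_n:X\to PD(A_n)$ ($n\in\mathbb N$) such that 1. the sequence is effective: $n\mapsto N_n$ is computable, a name of $\nu_n(a)$ is computable uniformly in $n$ and $a\in A_n$, and, uniformly in $n$, one can compute an associate that takes every name of every $x\in X$ to a name of $\mu_n(x)\in PD(A_n)$; 2. $\{\langle A_n,\nu_n,\mu_n\rangle\}_{n\in\mathbb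 N}$ is a probabilistic selection on $X$: for every $x\in X$ one has $x=\lim_{n\to\infty}\nu_n[A_n]\ \mathrm{mod}\ \mu_n(x)$, i.e. whenever $a_n\in A_n$ satisfies $\mu_n(x)(a_n)>0$ for every $n$, then $x=\lim_{n\to\infty}\nu_n(a_n)$ in $X$. -/

import Mathlib

open Filter Topology

universe u

noncomputable section

/-! ### Types, and the spaces interpreting them -/

/-- Formal types in the variables `V_0, …, V_{k-1}`, closed under `σ, τ ↦ (σ → τ)`. -/
inductive Ty (k : ℕ) : Type
  | var (i : Fin k) : Ty k
  | arrow (σ τ : Ty k) : Ty k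

/-- The set of continuous functions `X → Y` (to be topologised by `SeqFun.topology`; this is
deliberately not the compact-open topology). -/
def SeqFun (X Y : Type u) [TopologicalSpace X] [TopologicalSpace Y] : Type u :=
  {f : X → Y // Continuous f}

/-- The limit structure on `X → Y`: `f = lim F n` iff `f x = lim F n (x n)` whenever
`x = lim x n`. -/
def SeqFun.ConvergesTo {X Y : Type u} [TopologicalSpace X] [TopologicalSpace Y]
    (F : ℕ → SeqFun X Y) (f : SeqFun X Y) : Prop :=
  ∀ (ξ : ℕ → X) (x : X), Tendsto ξ atTop (𝓝 x) →
    Tendsto (fun n => (F n).1 (ξ n)) atTop (𝓝 (f.1 x))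

/-- The finest topology on the set of continuous functions `X → Y` in which all sequences that
converge in the sense of `SeqFun.ConvergesTo` do converge. -/
instance SeqFun.topology (X Y : Type u) [TopologicalSpace X] [TopologicalSpace Y] :
    TopologicalSpace (SeqFun X Y) where
  IsOpen O := ∀ f ∈ O, ∀ F : ℕ → SeqFun X Y, SeqFun.ConvergesTo F f → ∀ᶠ n in atTop, F n ∈ O
  isOpen_univ := fun _ _ _ _ => Filter.Eventually.of_forall fun _ => trivial
  isOpen_inter := fun _ _ hs ht f hf F hF => (hs f hf.1 F hF).and (ht f hf.2 F hF)
  isOpen_sUnion := fun _ hS f ⟨s, hs, hf⟩ F hF =>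
    (hS s hs f hf F hF).mono fun _ h => ⟨s, hs, h⟩

/-! ### Computability on Baire space -/

/-- An explicit surjective numbering of the rationals, `⟨a, ⟨b, c⟩⟩ ↦ (a - b) / (c + 1)`. -/
def ratNum (m : ℕ) : ℚ :=
  ((m.unpair.1 : ℚ) - (m.unpair.2.unpair.1 : ℚ)) / ((m.unpair.2.unpair.2 : ℚ) + 1)

/-- `γ` codes a fast converging sequence of rationals with limit `x`. -/
def NamesReal (γ : ℕ → ℕ) (x : ℝ) : Prop :=
  ∀ n, |((ratNum (γ n) : ℚ) : ℝ) - x| ≤ (2⁻¹ : ℝ) ^ n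

/-- Kleene application `α | β = γ` on Baire space: `α` is an associate which on the argument `β`
yields the sequence `γ`. For each `n`, the associate `α` is asked about `n` together with longer
and longer initial segments of `β`; it answers `0` ("need more input") until it answers
`γ n + 1`. The partial functions on Baire space computed by oracle machines are those with a
computable associate. -/
def Applies (α β γ : ℕ → ℕ) : Prop :=
  ∀ n, ∃ m, α (Encodable.encode (n :: (List.range m).map β)) = γ n + 1 ∧
    ∀ l < m, α (Encodable.encode (n :: (List.range l).map β)) = 0

/-! ### Effective metric spaces, effective Banach spaces, the Urysohn space -/

/-- An enumeration of a dense subset of `X` such that the map `(i, j) ↦ d (r_i, r_j)` is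
computable. A metric space with such an enumeration is an effective metric space. -/
structure EffectivePresentation (X : Type u) [MetricSpace X] where
  point : ℕ → X
  dense : DenseRange point
  computable_dist : ∃ g : ℕ × ℕ → ℕ → ℕ, Computable₂ g ∧
    ∀ i j, NamesReal (g (i, j)) (dist (point i) (point j))

/-- `β` codes a sequence from the enumerated dense set that converges fast to `x`. -/
def EffectivePresentation.Names {X : Type u} [MetricSpace X] (P : EffectivePresentation X)
    (β : ℕ → ℕ) (x : X) : Prop :=
  ∀ n, dist (P.point (β n)) x ≤ (2⁻¹ : ℝ) ^ n

/-- A family of points of `X`, indexed by pairs of numbers, is computable. -/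
def EffectivePresentation.IsComputableFamily {X : Type u} [MetricSpace X]
    (P : EffectivePresentation X) (f : ℕ → ℕ → X) : Prop :=
  ∃ g : ℕ × ℕ → ℕ → ℕ, Computable₂ g ∧ ∀ i j, P.Names (g (i, j)) (f i j)

/-- `X` with the presentation `P` is an effective (real) Banach space: it is complete, its metric
comes from a norm, and addition and multiplication by scalars are computable. (It is enough to say
this on the dense set and for rational scalars; computability of the norm then follows from that
of the metric, since `0 = 0 • r_i`.) -/
def IsEffectiveBanach {X : Type u} [M : MetricSpace X] (P : EffectivePresentation X) : Prop :=
  CompleteSpace X ∧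
  ∃ (V : NormedAddCommGroup X) (_ : NormedSpace ℝ X), V.toMetricSpace = M ∧
    P.IsComputableFamily (fun i j => P.point i + P.point j) ∧
    P.IsComputableFamily (fun q i => ((ratNum q : ℚ) : ℝ) • P.point i)

/-- `X` is finitely saturated: whenever `K ⊆ L` are finite metric spaces, every metric-preserving
map `K → X` extends to a metric-preserving map `L → X`. -/
def FinitelySaturated (X : Type u) [MetricSpace X] : Prop :=
  ∀ (L : Type) [MetricSpace L] [Finite L] (K : Set L) (φ : K → X), Isometry φ →
    ∃ ψ : L → X, Isometry ψ ∧ ∀ a : K, ψ a = φ a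

/-- `X` is (a copy of) the Urysohn space: complete, separable and finitely saturated. These
properties determine it up to isometry. -/
def IsUrysohn (X : Type u) [MetricSpace X] : Prop :=
  CompleteSpace X ∧ TopologicalSpace.SeparableSpace X ∧ FinitelySaturated X

/-! ### Represented spaces and the interpretation `σ(X_1, …, X_k)` -/

/-- A topological space together with a naming of its points by elements of Baire space. -/
structure RepSpace : Type (u + 1) where
  carrier : Type u
  topology : TopologicalSpace carrier
  Names : (ℕ → ℕ) → carrier → Prop

attribute [instance] RepSpace.topology

/-- A metric space with an effective presentation; the names are the fast converging sequences
from the dense set. -/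
def RepSpace.ofMetric (X : Type u) [MetricSpace X] (P : EffectivePresentation X) :
    RepSpace.{u} where
  carrier := X
  topology := inferInstance
  Names := P.Names

/-- The space of continuous functions; `α` names `f` if it is an associate for `f`, i.e. if it
takes every name of every `x` to a name of `f x`. -/
def RepSpace.arrow (X Y : RepSpace.{u}) : RepSpace.{u} where
  carrier := SeqFun X.carrier Y.carrier
  topology := inferInstance
  Names α f := ∀ β x, X.Names β x → ∃ γ, Applies α β γ ∧ Y.Names γ (f.1 x)

/-- The interpretation `σ(X_1, …, X_k)` of the type `σ`. -/
def Ty.interp {k : ℕ} (X : Fin k → Type u) [∀ i, MetricSpace (X i)]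
    (P : ∀ i, EffectivePresentation (X i)) : Ty k → RepSpace.{u}
  | .var i => RepSpace.ofMetric (X i) (P i)
  | .arrow σ τ => RepSpace.arrow (Ty.interp X P σ) (Ty.interp X P τ)

/-! ### Probabilistic selections -/

/-- The space of probability distributions on a finite set with `N` enumerated elements. -/
abbrev PD (N : ℕ) : Type := stdSimplex ℝ (Fin N)

/-- `δ` names the distribution `m` if it codes, for each `a`, a fast converging sequence of
rationals with limit `m a`. -/
def PD.Names {N : ℕ} (δ : ℕ → ℕ) (m : PD N) : Prop :=
  ∀ a : Fin N, NamesReal (fun j => δ (Nat.pair a j)) (m.1 a)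

/-- `x = lim ν_n[A_n] mod m_n`, where `A_n = {0, …, N n - 1}`. -/
def LimMod {X : Type u} [TopologicalSpace X] {N : ℕ → ℕ} (ν : ∀ n, Fin (N n) → X)
    (m : ∀ n, PD (N n)) (x : X) : Prop :=
  ∀ a : ∀ n, Fin (N n), (∀ n, 0 < (m n).1 (a n)) →
    Tendsto (fun n => ν n (a n)) atTop (𝓝 x)

/-- `⟨A_n, ν_n, μ_n⟩` is a probabilistic selection on `X`. -/
def IsProbabilisticSelection (X : Type u) [TopologicalSpace X] (N : ℕ → ℕ)
    (ν : ∀ n, Fin (N n) → X) (μ : ∀ n, X → PD (N n)) : Prop :=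
  (∀ n, Continuous (μ n)) ∧ ∀ x, LimMod ν (fun n => μ n x) x

/-- The sequence of finite maps `ν_n : A_n → X` is effective: a name of `ν_n(a)` is computed
uniformly in `n` and `a`. -/
def IsEffectiveFiniteMaps (X : RepSpace.{u}) {N : ℕ → ℕ} (ν : ∀ n, Fin (N n) → X.carrier) :
    Prop :=
  ∃ g : ℕ × ℕ → ℕ → ℕ, Computable₂ g ∧ ∀ n (a : Fin (N n)), X.Names (g (n, a)) (ν n a)

/-- The sequence of maps `μ_n : X → PD(A_n)` is effective: associates for the `μ_n` are computed
uniformly in `n`. -/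
def IsEffectiveMapsToPD (X : RepSpace.{u}) {N : ℕ → ℕ} (μ : ∀ n, X.carrier → PD (N n)) :
    Prop :=
  ∃ α : ℕ → ℕ → ℕ, Computable₂ α ∧
    ∀ n β x, X.Names β x → ∃ δ, Applies (α n) β δ ∧ PD.Names δ (μ n x)

end

/-!
The selections on `σ(X_1, …, X_k)` are found by induction on the type `σ`. A probabilistic selection
alone is too weak an induction hypothesis, since it provides no continuous way back from
distributions to points. The notion that is inherited by function spaces is `Selector`. Besides the
maps `mu n : X → PD (N n)`, it has continuous maps `hull n : PD (N n) → X` in the opposite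
direction, and a relation `rel a x` between sequences `a n` in the finite sets and points `x`, which
plays the part of a logical relation. If `ξ n` converges to `x`, then the sequences with positive
probability under `mu n (ξ n)` are related to `x`; and if only sequences related to `x` have
positive probability under `m n`, then `hull n (m n)` converges to `x`. Since the Dirac
distributions are among the `m n`, the maps `ν n a = hull n (PD.dirac a)` and `mu n` form a
probabilistic selection (`Selector.exists_effective_selection`).

For `X → Y`, the finite set is that of the maps `c` from the finite set of `X` to that of `Y`, and
`c` is related to `f` if it maps sequences related to `x` to sequences related to `f x`. The
distribution of `c` for a given `f` is the product of the distributions `mu n (f (ν n a))`; the hull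
of a distribution of `c` maps `x` to the hull of the distribution of `c a`, where `c` and `a` are
independent and `a` is distributed according to `mu n x` (`Selector.arrow`). That this gives the
right topology rests on `SeqFun.tendsto_iff`: a sequence in the function space converges if and only
if it converges continuously.

On a metric space with dense points `r_0, r_1, …`, the finite sets are `{0, …, n}`, the distribution
`mu n x` is supported by those `i ≤ n` for which `r_i` is almost as near to `x` as possible, and
`rel a x` says that `r_{a n}` converges to `x`. What is needed is a point `hull n m` that depends
effectively on `m` and is near to all points that are near to the `r_i` with positive probability
(`nonempty_selector_of_hull`). In a Banach space it is the convex combination `∑ m_i r_i`. In the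
Urysohn space, the metric on `{r_0, …, r_n}` extends to a pseudometric on the simplex `PD (n + 1)`,
which is the sup distance of the vectors of mean distances to the `r_i`; a computable search through
the presentation yields points that imitate a sequence of weight vectors approximating the whole
simplex, with smaller and smaller errors (`exists_computable_isGrid`). The errors are biased in such
a way that the distances prescribed for the next point satisfy all triangle inequalities, so that
finite saturation makes the search succeed. The hull is the map to the limits of these points
(`exists_hull`).

An effectively presented Urysohn space is the completion of a pseudometric on `ℕ` constructed by
recursion. The distances of `j` to the smaller numbers are multiples of `2 ^ (-j)`, and they are
chosen as an extension of the Katětov function coded by `j`, if there is one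
(`exists_computable_rows`). In a complete space, approximate solutions of one-point extension
problems can be improved to exact ones (`exists_dist_eq_of_approx`), and finite saturation follows
by adding the points one by one.
-/

/-! ### Computable functions -/

-- From here on, `fun_prop` proves the computability of functions given by explicit terms.
attribute [fun_prop] Computable
attribute [fun_prop] Computable.id Computable.const Computable.comp

namespace Computable

variable {α β γ : Type*} [Primcodable α] [Primcodable β] [Primcodable γ]

@[fun_prop]
theorem prodMk' {f : α → β} {g : α → γ} (hf : Computable f) (hg : Computable g) :
    Computable fun a => (f a, g a) := hf.pair hg

@[fun_prop]
theorem fst' {f : α → β × γ} (hf : Computable f) : Computable fun a => (f a).1 :=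
  Computable.fst.comp hf

@[fun_prop]
theorem snd' {f : α → β × γ} (hf : Computable f) : Computable fun a => (f a).2 :=
  Computable.snd.comp hf

@[fun_prop]
theorem natAdd {f g : α → ℕ} (hf : Computable f) (hg : Computable g) :
    Computable fun a => f a + g a := Primrec.nat_add.to_comp.comp hf hg

@[fun_prop]
theorem natSub {f g : α → ℕ} (hf : Computable f) (hg : Computable g) :
    Computable fun a => f a - g a := Primrec.nat_sub.to_comp.comp hf hg

@[fun_prop]
theorem natMul {f g : α → ℕ} (hf : Computable f) (hg : Computable g) :
    Computable fun a => f a * g a := Primrec.nat_mul.to_comp.comp hf hg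

@[fun_prop]
theorem natDiv {f g : α → ℕ} (hf : Computable f) (hg : Computable g) :
    Computable fun a => f a / g a := Primrec.nat_div.to_comp.comp hf hg

@[fun_prop]
theorem natMod {f g : α → ℕ} (hf : Computable f) (hg : Computable g) :
    Computable fun a => f a % g a := Primrec.nat_mod.to_comp.comp hf hg

@[fun_prop]
theorem natPow {f g : α → ℕ} (hf : Computable f) (hg : Computable g) :
    Computable fun a => f a ^ g a :=
  ((Primrec₂.unpaired'.1 Nat.Primrec.pow).to_comp).comp hf hg

@[fun_prop]
theorem natMax {f g : α → ℕ} (hf : Computable f) (hg : Computable g) :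
    Computable fun a => max (f a) (g a) := Primrec.nat_max.to_comp.comp hf hg

@[fun_prop]
theorem natMin {f g : α → ℕ} (hf : Computable f) (hg : Computable g) :
    Computable fun a => min (f a) (g a) := Primrec.nat_min.to_comp.comp hf hg

@[fun_prop]
theorem natPair {f g : α → ℕ} (hf : Computable f) (hg : Computable g) :
    Computable fun a => Nat.pair (f a) (g a) := Primrec₂.natPair.to_comp.comp hf hg

@[fun_prop]
theorem natUnpair {f : α → ℕ} (hf : Computable f) : Computable fun a => Nat.unpair (f a) :=
  Computable.unpair.comp hf

@[fun_prop]
theorem listLength {f : α → List β} (hf : Computable f) : Computable fun a => (f a).length :=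
  Computable.list_length.comp hf

@[fun_prop]
theorem listGetD {f : α → List β} {g : α → ℕ} (d : β) (hf : Computable f) (hg : Computable g) :
    Computable fun a => (f a).getD (g a) d :=
  (Primrec.list_getD d).to_comp.comp hf hg

@[fun_prop]
theorem listTail {f : α → List β} (hf : Computable f) : Computable fun a => (f a).tail :=
  Primrec.list_tail.to_comp.comp hf

@[fun_prop]
theorem listCons {f : α → β} {g : α → List β} (hf : Computable f) (hg : Computable g) :
    Computable fun a => f a :: g a := Computable.list_cons.comp hf hg

@[fun_prop]
theorem listConcat {f : α → List β} {g : α → β} (hf : Computable f) (hg : Computable g) :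
    Computable fun a => f a ++ [g a] := Computable.list_concat.comp hf hg

@[fun_prop]
theorem encode' {f : α → β} (hf : Computable f) : Computable fun a => Encodable.encode (f a) :=
  Computable.encode.comp hf

theorem ite_of_decide {c : α → Prop} [DecidablePred c] {f g : α → β}
    (hc : Computable fun a => decide (c a)) (hf : Computable f) (hg : Computable g) :
    Computable fun a => if c a then f a else g a :=
  (hc.cond hf hg).of_eq fun a => by by_cases h : c a <;> simp [h]

@[fun_prop]
theorem ite_eq {u v : α → ℕ} {f g : α → β} (hu : Computable u) (hv : Computable v)
    (hf : Computable f) (hg : Computable g) :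
    Computable fun a => if u a = v a then f a else g a :=
  ite_of_decide ((Primrec.eq (α := ℕ)).decide.to_comp.comp hu hv) hf hg

theorem ite_lt {u v : α → ℕ} {f g : α → β} (hu : Computable u) (hv : Computable v)
    (hf : Computable f) (hg : Computable g) :
    Computable fun a => if u a < v a then f a else g a :=
  ite_of_decide (Primrec.nat_lt.decide.to_comp.comp hu hv) hf hg

@[fun_prop]
theorem natRec {g : α → β} {h : α → ℕ → β → β} {f : α → ℕ} (hg : Computable g)
    (hh : Computable fun p : α × ℕ × β => h p.1 p.2.1 p.2.2) (hf : Computable f) :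
    Computable fun a => (Nat.rec (g a) (h a) (f a) : β) :=
  Computable.nat_rec (h := fun a p => h a p.1 p.2) hf hg hh

@[fun_prop]
theorem sum_range {f : α → ℕ → ℕ} {b : α → ℕ} (hf : Computable fun p : α × ℕ => f p.1 p.2)
    (hb : Computable b) : Computable fun a => ∑ i ∈ Finset.range (b a), f a i := by
  have : Computable fun a => (Nat.rec 0 (fun i y => y + f a i) (b a) : ℕ) := by fun_prop
  refine this.of_eq fun a => ?_
  induction b a with
  | zero => rfl
  | succ n ih => rw [Finset.sum_range_succ, ← ih]

@[fun_prop]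
theorem prod_range {f : α → ℕ → ℕ} {b : α → ℕ} (hf : Computable fun p : α × ℕ => f p.1 p.2)
    (hb : Computable b) : Computable fun a => ∏ i ∈ Finset.range (b a), f a i := by
  have : Computable fun a => (Nat.rec 1 (fun i y => y * f a i) (b a) : ℕ) := by fun_prop
  refine this.of_eq fun a => ?_
  induction b a with
  | zero => rfl
  | succ n ih => rw [Finset.prod_range_succ, ← ih]

@[fun_prop]
theorem sup_range {f : α → ℕ → ℕ} {b : α → ℕ} (hf : Computable fun p : α × ℕ => f p.1 p.2)
    (hb : Computable b) : Computable fun a => (Finset.range (b a)).sup (f a) := by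
  have : Computable fun a => (Nat.rec 0 (fun i y => max (f a i) y) (b a) : ℕ) := by fun_prop
  refine this.of_eq fun a => ?_
  induction b a with
  | zero => rfl
  | succ n ih => rw [Finset.range_add_one, Finset.sup_insert, ← ih]

end Computable

/-- The initial segment `β 0, …, β (m - 1)` of the sequence `β`. -/
def initSeg {σ : Type*} (β : ℕ → σ) (m : ℕ) : List σ := (List.range m).map β

section initSeg
variable {σ : Type*} (β : ℕ → σ)

theorem initSeg_succ (m : ℕ) : initSeg β (m + 1) = initSeg β m ++ [β m] := by
  simp [initSeg, List.range_succ]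

@[simp] theorem length_initSeg (m : ℕ) : (initSeg β m).length = m := by simp [initSeg]

theorem getD_initSeg {i m : ℕ} (h : i < m) (d : σ) : (initSeg β m).getD i d = β i := by
  simp [initSeg, h, List.getD]

theorem initSeg_congr {β γ : ℕ → σ} {m : ℕ} (h : ∀ i < m, β i = γ i) :
    initSeg β m = initSeg γ m :=
  List.map_congr_left fun i hi => h i (List.mem_range.1 hi)

theorem initSeg_getD_initSeg {m k : ℕ} (h : k ≤ m) (d : σ) :
    initSeg (fun i => (initSeg β m).getD i d) k = initSeg β k :=
  initSeg_congr fun _ hi => getD_initSeg β (hi.trans_le h) d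

end initSeg

@[fun_prop]
theorem Computable.initSeg {α σ : Type*} [Primcodable α] [Primcodable σ] {f : α → ℕ → σ}
    {b : α → ℕ} (hf : Computable fun p : α × ℕ => f p.1 p.2) (hb : Computable b) :
    Computable fun a => initSeg (f a) (b a) := by
  have : Computable fun a => (Nat.rec [] (fun i y => y ++ [f a i]) (b a) : List σ) := by fun_prop
  refine this.of_eq fun a => ?_
  induction b a with
  | zero => rfl
  | succ n ih => rw [initSeg_succ, ← ih]

/-- The list of numbers with code `k`. -/
def listOfCode (k : ℕ) : List ℕ := (Encodable.decode k : Option (List ℕ)).getD []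

@[simp] theorem listOfCode_encode (l : List ℕ) : listOfCode (Encodable.encode l) = l := by
  simp [listOfCode]

@[fun_prop]
theorem Computable.listOfCode {α : Type*} [Primcodable α] {f : α → ℕ} (hf : Computable f) :
    Computable fun a => listOfCode (f a) := 
  Computable.option_getD (Computable.decode.comp hf) (Computable.const _)

theorem Computable.natFind {α : Type*} [Primcodable α] {c : α → ℕ → ℕ}
    (hc : Computable fun p : α × ℕ => c p.1 p.2) (h : ∀ a, ∃ m, c a m ≠ 0) :
    Computable fun a => Nat.find (h a) := by
  have hp : Partrec₂ fun (a : α) (n : ℕ) => ((!decide (c a n = 0) : Bool) : Part Bool) := by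
    have : Computable fun p : α × ℕ => (if c p.1 p.2 = 0 then false else true) := by fun_prop
    refine Computable.partrec (this.of_eq fun p => ?_)
    by_cases h : c p.1 p.2 = 0 <;> simp [h]
  refine (Partrec.rfind hp).of_eq_tot fun a => ?_
  refine Nat.mem_rfind.2 ⟨?_, ?_⟩
  · simpa using Nat.find_spec (h a)
  · intro m hm
    simpa using Nat.find_min (h a) hm

/-- Unbounded search along a history: if every good list of previous choices admits a next choice
that passes the test `c`, and passing the test keeps the list good, then an infinite
sequence of choices is computable. -/
theorem exists_computable_search {α : Type*} [Primcodable α] (c : α → List ℕ → ℕ → ℕ)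
    (hc : Computable fun p : α × List ℕ × ℕ => c p.1 p.2.1 p.2.2) (G : α → List ℕ → Prop)
    (h0 : ∀ a, G a []) (hex : ∀ a l, G a l → ∃ v, c a l v ≠ 0)
    (hstep : ∀ a l v, G a l → c a l v ≠ 0 → G a (l ++ [v])) :
    ∃ u : α → ℕ → ℕ, (Computable fun p : α × ℕ => u p.1 p.2) ∧
      ∀ a j, G a (initSeg (u a) j) ∧ c a (initSeg (u a) j) (u a j) ≠ 0 := by
  have hp : Partrec₂ fun (q : α × List ℕ) (n : ℕ) =>
      ((!decide (c q.1 q.2 n = 0) : Bool) : Part Bool) := by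
    have : Computable fun p : (α × List ℕ) × ℕ =>
        (if c p.1.1 p.1.2 p.2 = 0 then false else true) := by fun_prop
    refine Computable.partrec (this.of_eq fun p => ?_)
    by_cases h : c p.1.1 p.1.2 p.2 = 0 <;> simp [h]
  let s : α × List ℕ →. ℕ := fun q =>
    Nat.rfind fun n => ((!decide (c q.1 q.2 n = 0) : Bool) : Part Bool)
  have hs : Partrec s := Partrec.rfind hp
  have hstepP : Partrec₂ fun (a : α × ℕ) (p : ℕ × List ℕ) =>
      ((s (a.1, p.2)).map fun v => p.2 ++ [v] : Part (List ℕ)) := by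
    refine Partrec.map (f := fun q : (α × ℕ) × ℕ × List ℕ => s (q.1.1, q.2.2))
      (g := fun q v => q.2.2 ++ [v]) (hs.comp (by fun_prop)) ?_
    show Computable _
    fun_prop
  let R : α → ℕ → Part (List ℕ) := fun a j => Nat.rec (Part.some [])
    (fun y IH => IH.bind fun i => (s (a, i)).map fun v => i ++ [v]) j
  have hR : Partrec fun p : α × ℕ => R p.1 p.2 :=
    Partrec.nat_rec (f := fun p : α × ℕ => p.2) (g := fun _ => (Part.some [] : Part (List ℕ)))
      (by fun_prop) (Computable.const ([] : List ℕ)) hstepP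
  have hsome : ∀ a l, G a l → ∃ v, v ∈ s (a, l) := by
    intro a l hl
    obtain ⟨v, hv⟩ := hex a l hl
    obtain ⟨n, hn, _⟩ := Nat.rfind_min' (p := fun n => !decide (c a l n = 0)) (m := v)
      (by simpa using hv)
    exact ⟨n, hn⟩
  have hspec : ∀ a l v, v ∈ s (a, l) → c a l v ≠ 0 := by
    intro a l v hv
    have := Nat.rfind_spec hv
    simpa using this
  have hdef : ∀ a j, ∃ l, l ∈ R a j ∧ G a l ∧ l.length = j := by
    intro a j
    induction j with
    | zero => exact ⟨[], Part.mem_some _, h0 a, rfl⟩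
    | succ j ih =>
      obtain ⟨l, hl, hG, hlen⟩ := ih
      obtain ⟨v, hv⟩ := hsome a l hG
      refine ⟨l ++ [v], ?_, hstep a l v hG (hspec a l v hv), by simp [hlen]⟩
      exact Part.mem_bind hl (Part.mem_map _ hv)
  choose l hl hG hlen using hdef
  have hl_comp : Computable fun p : α × ℕ => l p.1 p.2 := hR.of_eq_tot fun p => hl p.1 p.2
  have hl_succ : ∀ a j, ∃ v, c a (l a j) v ≠ 0 ∧ l a (j + 1) = l a j ++ [v] := by
    intro a j
    have h1 : l a (j + 1) ∈ (R a j).bind fun i => (s (a, i)).map fun v => i ++ [v] := hl a (j + 1)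
    obtain ⟨i, hi, h2⟩ := Part.mem_bind_iff.1 h1
    rw [Part.mem_unique hi (hl a j)] at h2
    obtain ⟨v, hv, h3⟩ := (Part.mem_map_iff _).1 h2
    exact ⟨v, hspec _ _ _ hv, h3.symm⟩
  choose v hv hlv using hl_succ
  have hu : ∀ a j, (l a (j + 1)).getD j 0 = v a j := by
    intro a j
    rw [hlv]
    simp [List.getD, hlen]
  have hlu : ∀ a j, l a j = initSeg (v a) j := by
    intro a j
    induction j with
    | zero => exact List.length_eq_zero_iff.1 (hlen a 0)
    | succ j ih => rw [hlv, ih, initSeg_succ]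
  refine ⟨v, ?_, fun a j => ?_⟩
  · have : Computable fun p : α × ℕ => (l p.1 (p.2 + 1)).getD p.2 0 := by fun_prop
    exact this.of_eq fun p => hu p.1 p.2
  · rw [← hlu]
    exact ⟨hG a j, hv a j⟩

/-! ### Approximating sequences by finite lists, and Kleene application -/

/-- The lists `L 0, L 1, …` are initial segments of the sequence `γ`, of lengths tending to
infinity. -/
def Approx (L : ℕ → List ℕ) (γ : ℕ → ℕ) : Prop :=
  ∃ s : ℕ → ℕ, Tendsto s atTop atTop ∧ ∀ m, L m = initSeg γ (s m)

/-- The values of `g` on `0, 1, …, b - 1` up to the first argument where `g` is undefined. The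
value of `g` at `i` is coded as `0` if undefined and as `v + 1` if equal to `v`. -/
def collect (g : ℕ → ℕ) (b : ℕ) : List ℕ :=
  Nat.rec [] (fun i L => if L.length = i then (if g i = 0 then L else L ++ [g i - 1]) else L) b

/-- The entry of `L` at `i`, coded as `0` if there is none and as `v + 1` if it is `v`. -/
def entryCode (L : List ℕ) (i : ℕ) : ℕ := if i < L.length then L.getD i 0 + 1 else 0

/-- The search for the first nonzero answer of an associate with initial segment `s`, asked about
`n` and the initial segments of the argument, of which `l` is one. The state `1` means that the
first `j` answers are `0`, the state `0` that the associate is not known far enough, and the state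
`v + 2` that the first nonzero answer is `v + 1`. -/
def appLoop (s l : List ℕ) (n j : ℕ) : ℕ :=
  Nat.rec 1 (fun m r => if r = 1 then
    entryCode s (Encodable.encode (n :: initSeg (fun i => l.getD i 0) m)) else r) j

theorem appLoop_succ (s l : List ℕ) (n j : ℕ) :
    appLoop s l n (j + 1) = if appLoop s l n j = 1 then
      entryCode s (Encodable.encode (n :: initSeg (fun i => l.getD i 0) j))
      else appLoop s l n j := rfl

/-- The value at `n` of the Kleene application of an associate to an argument, as far as it is
determined by the initial segments `s` of the associate and `l` of the argument; it is coded as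
`0` if undetermined, and as `v + 1` if equal to `v`. -/
def appCode (s l : List ℕ) (n : ℕ) : ℕ := appLoop s l n (l.length + 1) - 1

/-- Kleene application on initial segments. -/
def listApp (s l : List ℕ) : List ℕ := collect (appCode s l) l.length

/-- The values `F i δ` for `i < b`, computed from initial segments `L a` of the sequences `δ a`,
`a < K`, up to the first `i` for which one of these segments has fewer than `w i` entries. -/
def readOff (K : ℕ) (w : ℕ → ℕ) (F : ℕ → (ℕ → ℕ → ℕ) → ℕ) (L : ℕ → List ℕ) (b : ℕ) : List ℕ :=
  collect (fun i => if ∏ a ∈ Finset.range K, ((L a).length + 1 - w i) = 0 then 0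
    else F i (fun a j => (L a).getD j 0) + 1) b

namespace Computable
variable {α : Type*} [Primcodable α]

@[fun_prop]
theorem collect {g : α → ℕ → ℕ} {b : α → ℕ} (hg : Computable fun p : α × ℕ => g p.1 p.2)
    (hb : Computable b) : Computable fun a => collect (g a) (b a) := by
  unfold _root_.collect
  fun_prop

@[fun_prop]
theorem entryCode {L : α → List ℕ} {i : α → ℕ} (hL : Computable L) (hi : Computable i) :
    Computable fun a => entryCode (L a) (i a) := by
  unfold _root_.entryCode
  exact ite_lt (by fun_prop) (by fun_prop) (by fun_prop) (by fun_prop)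

@[fun_prop]
theorem listApp {s l : α → List ℕ} (hs : Computable s) (hl : Computable l) :
    Computable fun a => listApp (s a) (l a) := by
  unfold _root_.listApp appCode appLoop
  fun_prop

theorem readOff {K : α → ℕ} {w : α → ℕ → ℕ} {F : α → ℕ → (ℕ → ℕ → ℕ) → ℕ}
    {L : α → ℕ → List ℕ} {b : α → ℕ} (hK : Computable K)
    (hw : Computable fun p : α × ℕ => w p.1 p.2)
    (hL : Computable fun p : α × ℕ => L p.1 p.2)
    (hF : Computable fun p : α × ℕ => F p.1 p.2 fun a j => (L p.1 a).getD j 0)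
    (hb : Computable b) : Computable fun a => readOff (K a) (w a) (F a) (L a) (b a) := by
  let G : α → ℕ → ℕ := fun a i => F a i fun c j => (L a c).getD j 0
  have hG : Computable fun p : α × ℕ => G p.1 p.2 := hF
  show Computable fun a => _root_.collect (fun i =>
    if ∏ c ∈ Finset.range (K a), ((L a c).length + 1 - w a i) = 0 then 0 else G a i + 1) (b a)
  fun_prop

end Computable

theorem collect_spec (g : ℕ → ℕ) (b : ℕ) : ∃ t ≤ b, collect g b = initSeg (fun i => g i - 1) t ∧
    (∀ i < t, g i ≠ 0) ∧ (t < b → g t = 0) := by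
  induction b with
  | zero => exact ⟨0, le_rfl, rfl, by simp, by simp⟩
  | succ b ih =>
    obtain ⟨t, htb, h, hne, hz⟩ := ih
    have hrec : collect g (b + 1) = if (collect g b).length = b then
      (if g b = 0 then collect g b else collect g b ++ [g b - 1]) else collect g b := rfl
    rw [hrec, h, length_initSeg]
    rcases htb.lt_or_eq with hlt | rfl
    · rw [if_neg hlt.ne]
      exact ⟨t, htb.trans (Nat.le_succ _), rfl, hne, fun _ => hz hlt⟩
    · rw [if_pos rfl]
      by_cases h0 : g t = 0
      · rw [if_pos h0]
        exact ⟨t, Nat.le_succ _, rfl, hne, fun _ => h0⟩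
      · rw [if_neg h0]
        refine ⟨t + 1, le_rfl, (initSeg_succ _ _).symm, fun i hi => ?_,
          fun h => absurd h (lt_irrefl _)⟩
        rcases (Nat.lt_succ_iff.1 hi).lt_or_eq with hi | rfl
        exacts [hne i hi, h0]

theorem Approx.of_collect {g : ℕ → ℕ → ℕ} {b : ℕ → ℕ} {γ : ℕ → ℕ}
    (hg : ∀ m i, g m i = 0 ∨ g m i = γ i + 1) (hev : ∀ i, ∀ᶠ m in atTop, g m i ≠ 0)
    (hb : Tendsto b atTop atTop) : Approx (fun m => collect (g m) (b m)) γ := by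
  choose t htb ht hne hz using fun m => collect_spec (g m) (b m)
  refine ⟨t, tendsto_atTop.2 fun k => ?_, fun m => ?_⟩
  · have h1 : ∀ᶠ m in atTop, ∀ i ∈ Finset.range k, g m i ≠ 0 :=
      (Finset.eventually_all _).2 fun i _ => hev i
    filter_upwards [h1, hb.eventually_ge_atTop k] with m hm hbm
    by_contra! hlt
    exact hm (t m) (Finset.mem_range.2 hlt) (hz m (hlt.trans_le hbm))
  · refine (ht m).trans (initSeg_congr fun i hi => ?_)
    rcases hg m i with h | h
    · exact absurd h (hne m i hi)
    · simp [h]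

theorem Approx.comp {L : ℕ → List ℕ} {γ : ℕ → ℕ} (hL : Approx L γ) {s : ℕ → ℕ}
    (hs : Tendsto s atTop atTop) : Approx (fun m => L (s m)) γ := by
  obtain ⟨t, ht, h⟩ := hL
  exact ⟨_, ht.comp hs, fun m => h (s m)⟩

theorem Approx.tendsto_length {L : ℕ → List ℕ} {γ : ℕ → ℕ} (hL : Approx L γ) :
    Tendsto (fun m => (L m).length) atTop atTop := by
  obtain ⟨t, ht, h⟩ := hL
  simpa [h] using ht

theorem approx_initSeg (β : ℕ → ℕ) : Approx (initSeg β) β := ⟨id, tendsto_id, fun _ => rfl⟩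

theorem entryCode_initSeg (γ : ℕ → ℕ) (m i : ℕ) :
    entryCode (initSeg γ m) i = if i < m then γ i + 1 else 0 := by
  unfold entryCode
  rw [length_initSeg]
  split_ifs with h
  · rw [getD_initSeg _ h]
  · rfl

theorem Approx.entryCode_eq {L : ℕ → List ℕ} {γ : ℕ → ℕ} (hL : Approx L γ) (i : ℕ) :
    (∀ m, entryCode (L m) i = 0 ∨ entryCode (L m) i = γ i + 1) ∧
      ∀ᶠ m in atTop, entryCode (L m) i = γ i + 1 := by
  obtain ⟨t, ht, h⟩ := hL
  constructor
  · intro m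
    rw [h, entryCode_initSeg]
    split_ifs <;> simp
  · filter_upwards [ht.eventually_gt_atTop i] with m hm
    rw [h, entryCode_initSeg, if_pos hm]

/-- A sequence approximated by a computable sequence of lists is computable, uniformly. -/
theorem exists_computable_of_approx {α : Type*} [Primcodable α] {L : α → ℕ → List ℕ}
    (hL : Computable fun p : α × ℕ => L p.1 p.2) (h : ∀ a, ∃ γ, Approx (L a) γ) :
    ∃ g : α → ℕ → ℕ, Computable₂ g ∧ ∀ a γ, Approx (L a) γ → γ = g a := by
  have hex : ∀ p : α × ℕ, ∃ m, entryCode (L p.1 m) p.2 ≠ 0 := by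
    intro p
    obtain ⟨γ, hγ⟩ := h p.1
    obtain ⟨m, hm⟩ := (hγ.entryCode_eq p.2).2.exists
    exact ⟨m, by simp [hm]⟩
  have hfind := Computable.natFind (α := α × ℕ) (c := fun p m => entryCode (L p.1 m) p.2)
    (by fun_prop) hex
  refine ⟨fun a i => entryCode (L a (Nat.find (hex (a, i)))) i - 1, ?_, fun a γ hγ => ?_⟩
  · have : Computable fun p : α × ℕ => entryCode (L p.1 (Nat.find (hex p))) p.2 - 1 := by fun_prop
    exact this
  · funext i
    have h1 := Nat.find_spec (hex (a, i))
    rcases (hγ.entryCode_eq i).1 (Nat.find (hex (a, i))) with h2 | h2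
    · exact absurd h2 h1
    · simp [h2]

theorem Approx.listApp {S L : ℕ → List ℕ} {α β γ : ℕ → ℕ} (hS : Approx S α) (hL : Approx L β)
    (h : Applies α β γ) : Approx (fun m => listApp (S m) (L m)) γ := by
  have h : ∀ n, ∃ M, α (Encodable.encode (n :: initSeg β M)) = γ n + 1 ∧
    ∀ l < M, α (Encodable.encode (n :: initSeg β l)) = 0 := h
  obtain ⟨s, hs, hS⟩ := hS
  have hlen := hL.tendsto_length
  obtain ⟨t, ht, hL⟩ := hL
  let r : ℕ → ℕ → ℕ → ℕ → ℕ := fun a b n j => appLoop (initSeg α a) (initSeg β b) n j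
  have hr : ∀ m n, appCode (S m) (L m) n = r (s m) (t m) n (t m + 1) - 1 := by
    intro m n
    simp only [appCode, hS, hL, length_initSeg, r]
  have hstep : ∀ a b n j : ℕ, j ≤ b → r a b n (j + 1) = if r a b n j = 1 then
      (if Encodable.encode (n :: initSeg β j) < a then
        α (Encodable.encode (n :: initSeg β j)) + 1 else 0) else r a b n j := by
    intro a b n j hj
    simp only [r]
    rw [appLoop_succ, initSeg_getD_initSeg _ hj, entryCode_initSeg]
  have hinv : ∀ n M, α (Encodable.encode (n :: initSeg β M)) = γ n + 1 →
      (∀ l < M, α (Encodable.encode (n :: initSeg β l)) = 0) →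
      ∀ a b j, j ≤ b + 1 → (j ≤ M → r a b n j = 0 ∨ r a b n j = 1) ∧
        (M < j → r a b n j = 0 ∨ r a b n j = γ n + 2) := by
    intro n M hM hz a b j
    induction j with
    | zero => intro _; exact ⟨fun _ => Or.inr rfl, fun h => absurd h (Nat.not_lt_zero _)⟩
    | succ j ih =>
      intro hj
      obtain ⟨h1, h2⟩ := ih (by omega)
      rw [hstep a b n j (by omega)]
      constructor
      · intro hjM
        rcases h1 (by omega) with h | h
        · simp [h]
        · rw [if_pos h, hz j (by omega)]
          split_ifs <;> simp
      · intro hjM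
        rcases (Nat.lt_succ_iff.1 hjM).lt_or_eq with h | rfl
        · rcases h2 h with h | h <;> simp [h]
        · rcases h1 le_rfl with h | h
          · simp [h]
          · rw [if_pos h, hM]
            split_ifs <;> simp
  refine Approx.of_collect (fun m n => ?_) (fun n => ?_) hlen
  · obtain ⟨M, hM, hz⟩ := h n
    obtain ⟨h1, h2⟩ := hinv n M hM hz (s m) (t m) (t m + 1) le_rfl
    rw [hr]
    rcases le_or_gt (t m + 1) M with h | h
    · rcases h1 h with h | h <;> simp [h]
    · rcases h2 h with h | h <;> simp [h]
  · obtain ⟨M, hM, hz⟩ := h n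
    have hev : ∀ᶠ m in atTop, ∀ l ∈ Finset.range (M + 1),
        Encodable.encode (n :: initSeg β l) < s m :=
      (Finset.eventually_all _).2 fun l _ => hs.eventually_gt_atTop _
    filter_upwards [hev, ht.eventually_ge_atTop M] with m hm htm
    have hone : ∀ j, j ≤ M → r (s m) (t m) n j = 1 := by
      intro j
      induction j with
      | zero => intro _; rfl
      | succ j ih =>
        intro hj
        rw [hstep _ _ _ _ (by omega), if_pos (ih (by omega)),
          if_pos (hm j (Finset.mem_range.2 (by omega))), hz j (by omega)]
    have htwo : ∀ j, M < j → j ≤ t m + 1 → r (s m) (t m) n j = γ n + 2 := by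
      intro j
      induction j with
      | zero => intro h; exact absurd h (Nat.not_lt_zero _)
      | succ j ih =>
        intro hMj hj
        rw [hstep _ _ _ _ (by omega)]
        rcases (Nat.lt_succ_iff.1 hMj).lt_or_eq with h | rfl
        · rw [ih h (by omega), if_neg (by omega)]
        · rw [if_pos (hone _ le_rfl), if_pos (hm _ (Finset.mem_range.2 (by omega))), hM]
    rw [hr, htwo _ (by omega) le_rfl]
    omega

theorem Approx.readOff {K : ℕ} {L : ℕ → ℕ → List ℕ} {δ : ℕ → ℕ → ℕ}
    (hL : ∀ a < K, Approx (fun m => L m a) (δ a)) {w : ℕ → ℕ} {F : ℕ → (ℕ → ℕ → ℕ) → ℕ}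
    (hF : ∀ i X Y, (∀ a < K, ∀ j < w i, X a j = Y a j) → F i X = F i Y) {b : ℕ → ℕ}
    (hb : Tendsto b atTop atTop) :
    Approx (fun m => readOff K w F (L m) (b m)) fun i => F i δ := by
  refine Approx.of_collect (fun m i => ?_) (fun i => ?_) hb
  · split_ifs with h
    · exact Or.inl rfl
    · refine Or.inr (congrArg (· + 1) (hF _ _ _ fun a ha j hj => ?_))
      obtain ⟨s, hs, hLs⟩ := hL a ha
      have := Finset.prod_ne_zero_iff.1 h a (Finset.mem_range.2 ha)
      simp only [hLs, length_initSeg] at this ⊢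
      exact getD_initSeg _ (by omega) _
  · have : ∀ᶠ m in atTop, ∀ a ∈ Finset.range K, w i ≤ (L m a).length :=
      (Finset.eventually_all _).2 fun a ha =>
        (hL a (Finset.mem_range.1 ha)).tendsto_length.eventually_ge_atTop _
    filter_upwards [this] with m hm
    rw [if_neg]
    · simp
    · refine Finset.prod_ne_zero_iff.2 fun a ha => ?_
      have := hm a ha
      omega

/-- An associate may answer as soon as its lists of approximations determine the value. -/
theorem applies_of_approx {Θ : ℕ → List ℕ} {α β γ : ℕ → ℕ} (h : Approx Θ γ)
    (hα : ∀ n m, α (Encodable.encode (n :: initSeg β m)) = entryCode (Θ m) n) :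
    Applies α β γ := by
  intro n
  obtain ⟨h1, h2⟩ := h.entryCode_eq n
  have hex : ∃ m, entryCode (Θ m) n ≠ 0 := by
    obtain ⟨m, hm⟩ := h2.exists
    exact ⟨m, by simp [hm]⟩
  refine ⟨Nat.find hex, ?_, fun l hl => ?_⟩
  · refine (hα n _).trans ((h1 _).resolve_left (Nat.find_spec hex))
  · exact (hα n l).trans (not_not.1 (Nat.find_min hex hl))

/-- The associate of the function `l ↦ Θ l` on initial segments. -/
def assocOf (Θ : List ℕ → List ℕ) (k : ℕ) : ℕ :=
  entryCode (Θ (listOfCode k).tail) ((listOfCode k).getD 0 0)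

theorem applies_assocOf {Θ : List ℕ → List ℕ} {β γ : ℕ → ℕ}
    (h : Approx (fun m => Θ (initSeg β m)) γ) : Applies (assocOf Θ) β γ :=
  applies_of_approx h fun n m => by
    simp only [assocOf, listOfCode_encode, List.tail_cons, List.getD_cons_zero]

/-- Currying: from initial segments `M` of a sequence `δ`, the associate of `l ↦ Ψ δ l` is
computed, where `Ψ` inspects no more of `δ` than the length of `l`. -/
def curryList (Ψ : List ℕ → List ℕ → List ℕ) (M : List ℕ) : List ℕ :=
  readOff 1 (fun k => (listOfCode k).tail.length)
    (fun k X => assocOf (fun l => Ψ (initSeg (X 0) l.length) l) k) (fun _ => M) M.length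

@[fun_prop]
theorem Computable.curryList {α : Type*} [Primcodable α] {Ψ : α → List ℕ → List ℕ → List ℕ}
    {M : α → List ℕ} (hΨ : Computable fun p : α × List ℕ × List ℕ => Ψ p.1 p.2.1 p.2.2)
    (hM : Computable M) : Computable fun a => curryList (Ψ a) (M a) := by
  refine Computable.readOff (by fun_prop) (by fun_prop) (by fun_prop) ?_ (by fun_prop)
  unfold assocOf
  fun_prop

theorem Approx.curryList {M : ℕ → List ℕ} {δ : ℕ → ℕ} (hM : Approx M δ)
    (Ψ : List ℕ → List ℕ → List ℕ) :
    Approx (fun m => curryList Ψ (M m)) (assocOf fun l => Ψ (initSeg δ l.length) l) := by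
  refine Approx.readOff (K := 1) (δ := fun _ => δ) (fun _ _ => hM) (fun k X Y h => ?_)
    hM.tendsto_length
  simp only [assocOf]
  rw [initSeg_congr fun i hi => h 0 Nat.one_pos i hi]

theorem applies_curry {δ β γ : ℕ → ℕ} {Ψ : List ℕ → List ℕ → List ℕ}
    (h : Approx (fun m => Ψ (initSeg δ m) (initSeg β m)) γ) :
    Applies (assocOf fun l => Ψ (initSeg δ l.length) l) β γ :=
  applies_assocOf (by simpa using h)

attribute [irreducible] readOff

/-! ### Finite probability distributions -/

/-- The distribution concentrated in `a`. -/
def PD.dirac {N : ℕ} (a : Fin N) : PD N := ⟨Pi.single a 1, single_mem_stdSimplex ℝ a⟩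

/-- The function from `Fin K` to `Fin M` with code `c`. -/
abbrev funOfCode {M K : ℕ} (c : Fin (M ^ K)) : Fin K → Fin M := finFunctionFinEquiv.symm c

/-- The distribution of a function `Fin K → Fin M` whose values are independent, with value at `a`
distributed according to `p a`. -/
def PD.pi {K M : ℕ} (p : Fin K → PD M) : PD (M ^ K) :=
  ⟨fun c => ∏ a, (p a).1 (funOfCode c a),
    fun _ => Finset.prod_nonneg fun a _ => (p a).2.1 _, by
      rw [Equiv.sum_comp finFunctionFinEquiv.symm fun f : Fin K → Fin M => ∏ a, (p a).1 (f a),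
        ← Fintype.prod_sum fun a b => (p a).1 b]
      exact Finset.prod_eq_one fun a _ => (p a).2.2⟩

/-- The distribution of `c a`, where the function `c` is distributed according to `q` and
its argument `a` independently according to `p`. -/
def PD.eval {K M : ℕ} (q : PD (M ^ K)) (p : PD K) : PD M :=
  ⟨fun b => ∑ c, ∑ a, if funOfCode c a = b then q.1 c * p.1 a else 0,
    fun b => Finset.sum_nonneg fun c _ => Finset.sum_nonneg fun a _ => by
      split_ifs
      exacts [mul_nonneg (q.2.1 c) (p.2.1 a), le_rfl], by
      rw [Finset.sum_comm]
      have : ∀ c, ∑ b, ∑ a, (if funOfCode c a = b then q.1 c * p.1 a else 0) = q.1 c := by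
        intro c
        rw [Finset.sum_comm]
        simp only [Finset.sum_ite_eq, Finset.mem_univ, if_true]
        rw [← Finset.mul_sum, p.2.2, mul_one]
      simp only [this]
      exact q.2.2⟩

theorem PD.le_one {N : ℕ} (m : PD N) (a : Fin N) : m.1 a ≤ 1 := by
  rw [← m.2.2]
  exact Finset.single_le_sum (fun b _ => m.2.1 b) (Finset.mem_univ a)

theorem PD.dirac_pos_iff {N : ℕ} {a b : Fin N} : 0 < (PD.dirac a).1 b ↔ b = a := by
  simp only [PD.dirac, Pi.single_apply]
  split_ifs with h <;> simp [h]

theorem PD.pi_pos {K M : ℕ} {p : Fin K → PD M} {c : Fin (M ^ K)} (h : 0 < (PD.pi p).1 c)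
    (a : Fin K) : 0 < (p a).1 (funOfCode c a) :=
  lt_of_le_of_ne ((p a).2.1 _) fun h0 =>
    h.ne' (Finset.prod_eq_zero (Finset.mem_univ a) h0.symm)

theorem PD.exists_of_eval_pos {K M : ℕ} {q : PD (M ^ K)} {p : PD K} {b : Fin M}
    (h : 0 < (PD.eval q p).1 b) : ∃ c a, 0 < q.1 c ∧ 0 < p.1 a ∧ funOfCode c a = b := by
  have h' : ∑ c, ∑ a, (if funOfCode c a = b then q.1 c * p.1 a else 0) ≠ 0 := h.ne'
  obtain ⟨c, -, hc⟩ := Finset.exists_ne_zero_of_sum_ne_zero h'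
  obtain ⟨a, -, ha⟩ := Finset.exists_ne_zero_of_sum_ne_zero hc
  rw [ite_ne_right_iff] at ha
  exact ⟨c, a, lt_of_le_of_ne (q.2.1 c) (left_ne_zero_of_mul ha.2).symm,
    lt_of_le_of_ne (p.2.1 a) (right_ne_zero_of_mul ha.2).symm, ha.1⟩

theorem PD.continuous_apply {N : ℕ} (a : Fin N) : Continuous fun m : PD N => m.1 a :=
  (_root_.continuous_apply a).comp continuous_subtype_val

theorem PD.continuous_iff {X : Type*} [TopologicalSpace X] {N : ℕ} {f : X → PD N} :
    Continuous f ↔ ∀ a, Continuous fun x => (f x).1 a := by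
  rw [continuous_induced_rng, continuous_pi_iff]
  rfl

theorem PD.continuous_pi {K M : ℕ} {X : Type*} [TopologicalSpace X] {f : X → Fin K → PD M}
    (h : ∀ a, Continuous fun x => f x a) : Continuous fun x => PD.pi (f x) :=
  PD.continuous_iff.2 fun c => by
    show Continuous fun x => ∏ a, (f x a).1 (funOfCode c a)
    exact continuous_finsetProd _ fun a _ => (PD.continuous_apply _).comp (h a)

theorem PD.continuous_eval {K M : ℕ} :
    Continuous fun z : PD (M ^ K) × PD K => PD.eval z.1 z.2 := by
  refine PD.continuous_iff.2 fun b => ?_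
  show Continuous fun z : PD (M ^ K) × PD K =>
    ∑ c, ∑ a, if funOfCode c a = b then z.1.1 c * z.2.1 a else 0
  refine continuous_finsetSum _ fun c _ => continuous_finsetSum _ fun a _ => ?_
  split_ifs
  · exact ((PD.continuous_apply c).comp continuous_fst).mul
      ((PD.continuous_apply a).comp continuous_snd)
  · exact continuous_const

/-! ### Binary names of distributions -/

/-- `δ` codes, for each `a` and `k`, a multiple of `2 ^ (-k)` at distance at most `2 ^ (-k)`
from `m a`. -/
def PD.BinNames {N : ℕ} (δ : ℕ → ℕ) (m : PD N) : Prop :=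
  ∀ (a : Fin N) k, |(δ (Nat.pair a k) : ℝ) - 2 ^ k * m.1 a| ≤ 1

/-- The quotient `a / b`, rounded to a nearest integer. -/
def roundDiv (a b : ℕ) : ℕ := (2 * a + b) / (2 * b)

@[fun_prop]
theorem Computable.roundDiv {α : Type*} [Primcodable α] {f g : α → ℕ} (hf : Computable f)
    (hg : Computable g) : Computable fun a => roundDiv (f a) (g a) := by
  unfold _root_.roundDiv
  fun_prop

theorem abs_roundDiv_sub_le (a b : ℕ) (hb : 0 < b) :
    |(roundDiv a b : ℝ) - a / b| ≤ 1 / 2 := by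
  unfold roundDiv
  have h1 := Nat.div_mul_le_self (2 * a + b) (2 * b)
  have h2 := Nat.lt_div_mul_add (a := 2 * a + b) (b := 2 * b) (by omega)
  have h1' : (((2 * a + b) / (2 * b) : ℕ) : ℝ) * (2 * b) ≤ 2 * a + b := by exact_mod_cast h1
  have h2' : (2 * a + b : ℝ) < (((2 * a + b) / (2 * b) : ℕ) : ℝ) * (2 * b) + 2 * b := by
    exact_mod_cast h2
  have hb' : (0 : ℝ) < b := by exact_mod_cast hb
  set q : ℝ := (((2 * a + b) / (2 * b) : ℕ) : ℝ)
  have h3 : (a : ℝ) / b * b = a := div_mul_cancel₀ _ hb'.ne'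
  rw [abs_le]
  constructor
  · by_contra! h
    nlinarith
  · by_contra! h
    nlinarith

theorem abs_roundDiv_mul_two_pow_sub_le {A B k : ℕ} {x : ℝ} (hB : 0 < B)
    (h : 2 ^ k * |(A : ℝ) / B - x| ≤ 1 / 2) :
    |(roundDiv (A * 2 ^ k) B : ℝ) - 2 ^ k * x| ≤ 1 := by
  have h1 := abs_roundDiv_sub_le (A * 2 ^ k) B hB
  have h2 : |((A * 2 ^ k : ℕ) : ℝ) / B - 2 ^ k * x| ≤ 1 / 2 := by
    have : ((A * 2 ^ k : ℕ) : ℝ) / B - 2 ^ k * x = 2 ^ k * ((A : ℝ) / B - x) := by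
      push_cast
      ring
    rw [this, abs_mul, abs_of_pos (by positivity : (0 : ℝ) < 2 ^ k)]
    exact h
  calc _ ≤ _ + _ := abs_sub_le _ (((A * 2 ^ k : ℕ) : ℝ) / B) _
    _ ≤ 1 := by linarith

theorem abs_prod_sub_prod_le {ι : Type*} (s : Finset ι) (x y : ι → ℝ)
    (hx : ∀ i ∈ s, 0 ≤ x i ∧ x i ≤ 1) (hy : ∀ i ∈ s, 0 ≤ y i ∧ y i ≤ 1) :
    |∏ i ∈ s, x i - ∏ i ∈ s, y i| ≤ ∑ i ∈ s, |x i - y i| := by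
  classical
  induction s using Finset.induction_on with
  | empty => simp
  | insert a s ha ih =>
    rw [Finset.prod_insert ha, Finset.prod_insert ha, Finset.sum_insert ha]
    have hxs : ∀ i ∈ s, 0 ≤ x i ∧ x i ≤ 1 := fun i hi => hx i (Finset.mem_insert_of_mem hi)
    have hys : ∀ i ∈ s, 0 ≤ y i ∧ y i ≤ 1 := fun i hi => hy i (Finset.mem_insert_of_mem hi)
    have h1 := ih hxs hys
    have h2 := hx a (Finset.mem_insert_self _ _)
    have h3 : |∏ i ∈ s, y i| ≤ 1 := by
      rw [abs_of_nonneg (Finset.prod_nonneg fun i hi => (hys i hi).1)]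
      exact Finset.prod_le_one (fun i hi => (hys i hi).1) fun i hi => (hys i hi).2
    have : x a * ∏ i ∈ s, x i - y a * ∏ i ∈ s, y i =
        x a * (∏ i ∈ s, x i - ∏ i ∈ s, y i) + (x a - y a) * ∏ i ∈ s, y i := by ring
    rw [this]
    refine (abs_add_le _ _).trans ?_
    rw [abs_mul, abs_mul, abs_of_nonneg h2.1, add_comm]
    exact add_le_add (mul_le_of_le_one_right (abs_nonneg _) h3)
      ((mul_le_of_le_one_left (abs_nonneg _) h2.2).trans h1)

theorem abs_div_two_pow_sub_le {z x : ℝ} {k : ℕ} (h : |z - 2 ^ k * x| ≤ 1) :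
    |z / 2 ^ k - x| ≤ 2⁻¹ ^ k := by
  have hp : (0 : ℝ) < 2 ^ k := by positivity
  rw [show z / 2 ^ k - x = (z - 2 ^ k * x) / 2 ^ k by field_simp, abs_div, abs_of_pos hp, inv_pow,
    div_le_iff₀ hp, inv_mul_cancel₀ hp.ne']
  exact h

/-- The approximation of a probability at precision `k` that is read off a binary name, cut off
at `1`; in units of `2 ^ (-k)`. -/
def readProb (X : ℕ → ℕ) (a k : ℕ) : ℕ := min (X (Nat.pair a k)) (2 ^ k)

theorem PD.BinNames.readProb {N : ℕ} {δ : ℕ → ℕ} {m : PD N} (h : PD.BinNames δ m) (a : Fin N)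
    (k : ℕ) : |(readProb δ a k : ℝ) / 2 ^ k - m.1 a| ≤ (2⁻¹ : ℝ) ^ k := by
  have h1 := abs_le.1 (h a k)
  have hp : (0 : ℝ) < 2 ^ k := by positivity
  have hm := m.le_one a
  have : |(_root_.readProb δ a k : ℝ) - 2 ^ k * m.1 a| ≤ 1 := by
    unfold _root_.readProb
    rw [Nat.cast_min, abs_le]
    push_cast
    constructor
    · have : (2 : ℝ) ^ k * m.1 a - 1 ≤ min (δ (Nat.pair a k) : ℝ) (2 ^ k) :=
        le_min (by linarith) (by nlinarith)
      linarith
    · exact (sub_le_sub_right (min_le_left _ _) _).trans h1.2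
  exact abs_div_two_pow_sub_le this

theorem readProb_mem (X : ℕ → ℕ) (a k : ℕ) :
    0 ≤ (readProb X a k : ℝ) / 2 ^ k ∧ (readProb X a k : ℝ) / 2 ^ k ≤ 1 := by
  have hp : (0 : ℝ) < 2 ^ k := by positivity
  refine ⟨by positivity, (div_le_one hp).2 ?_⟩
  exact_mod_cast (min_le_right _ _ : readProb X a k ≤ 2 ^ k)

theorem readProb_congr {X Y : ℕ → ℕ} {a k b : ℕ} (ha : a ≤ b)
    (h : ∀ j < (b + k + 1) ^ 2, X j = Y j) : readProb X a k = readProb Y a k := by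
  unfold readProb
  rw [h]
  refine (Nat.pair_lt_max_add_one_sq _ _).trans_le (Nat.pow_le_pow_left ?_ 2)
  have : max a k ≤ a + k := max_le (Nat.le_add_right _ _) (Nat.le_add_left _ _)
  omega

theorem two_pow_mul_inv_two_pow_add (k t : ℕ) : (2 : ℝ) ^ k * (2⁻¹) ^ (k + t) = (2⁻¹) ^ t := by
  rw [pow_add, ← mul_assoc, ← mul_pow]
  norm_num

theorem natCast_mul_inv_two_pow_succ_le (n : ℕ) : (n : ℝ) * (2⁻¹) ^ (n + 1) ≤ 1 / 2 := by
  have h : (n : ℝ) ≤ 2 ^ n := by exact_mod_cast Nat.lt_two_pow_self.le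
  rw [pow_succ, inv_pow, ← mul_assoc]
  have : (n : ℝ) * (2 ^ n)⁻¹ ≤ 1 := by
    rw [← div_eq_mul_inv]
    exact (div_le_one (by positivity)).2 h
  linarith

theorem val_funOfCode {M K : ℕ} (c : Fin (M ^ K)) (a : Fin K) :
    (funOfCode c a : ℕ) = c / M ^ (a : ℕ) % M := finFunctionFinEquiv_symm_apply_val c a

/-- A code of the rational number `Z / 2 ^ k`. -/
def dyadicCode (Z k : ℕ) : ℕ := Nat.pair Z (Nat.pair 0 (2 ^ k - 1))

@[fun_prop]
theorem Computable.dyadicCode {α : Type*} [Primcodable α] {f g : α → ℕ} (hf : Computable f)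
    (hg : Computable g) : Computable fun a => dyadicCode (f a) (g a) := by
  unfold _root_.dyadicCode
  fun_prop

theorem ratNum_dyadicCode (Z k : ℕ) : ((ratNum (dyadicCode Z k) : ℚ) : ℝ) = (Z : ℝ) / 2 ^ k := by
  simp only [dyadicCode, ratNum, Nat.unpair_pair]
  push_cast [Nat.one_le_two_pow]
  simp

/-- The binary name of `PD.dirac a`. -/
def diracName (a i : ℕ) : ℕ := if i.unpair.1 = a then 2 ^ i.unpair.2 else 0

theorem binNames_diracName {N : ℕ} (a : Fin N) : PD.BinNames (diracName a) (PD.dirac a) := by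
  intro b k
  simp only [diracName, Nat.unpair_pair, PD.dirac, Pi.single_apply, Fin.val_inj]
  split_ifs <;> simp

/-- The entry at `i` of the binary name of `PD.pi p`, computed from binary names `X a`
of the distributions `p a`. -/
def piEntry (K M i : ℕ) (X : ℕ → ℕ → ℕ) : ℕ :=
  roundDiv ((∏ a ∈ Finset.range K, readProb (X a) (i.unpair.1 / M ^ a % M) (i.unpair.2 + (K + 1))) *
    2 ^ i.unpair.2) (2 ^ ((i.unpair.2 + (K + 1)) * K))

/-- The number of entries that `piEntry` reads. -/
def piWindow (K M i : ℕ) : ℕ := (M + (i.unpair.2 + (K + 1)) + 1) ^ 2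

theorem Computable.piEntry {α : Type*} [Primcodable α] {K M i : α → ℕ}
    {X : α → ℕ → ℕ → ℕ} (hK : Computable K) (hM : Computable M) (hi : Computable i)
    (hX : Computable fun p : α × ℕ × ℕ => X p.1 p.2.1 p.2.2) :
    Computable fun a => piEntry (K a) (M a) (i a) (X a) := by
  unfold _root_.piEntry readProb
  fun_prop

@[fun_prop]
theorem Computable.piWindow {α : Type*} [Primcodable α] {K M i : α → ℕ} (hK : Computable K)
    (hM : Computable M) (hi : Computable i) :
    Computable fun a => piWindow (K a) (M a) (i a) := by
  unfold _root_.piWindow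
  fun_prop

theorem piEntry_congr {K M i : ℕ} (hM : 0 < M) {X Y : ℕ → ℕ → ℕ}
    (h : ∀ a < K, ∀ j < piWindow K M i, X a j = Y a j) : piEntry K M i X = piEntry K M i Y := by
  unfold piEntry
  congr 2
  exact Finset.prod_congr rfl fun a ha =>
    readProb_congr (Nat.mod_lt _ hM).le (h a (Finset.mem_range.1 ha))

theorem binNames_pi {K M : ℕ} {p : Fin K → PD M} {δ : ℕ → ℕ → ℕ}
    (h : ∀ a : Fin K, PD.BinNames (δ a) (p a)) :
    PD.BinNames (fun i => piEntry K M i δ) (PD.pi p) := by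
  intro c k
  simp only [piEntry, Nat.unpair_pair]
  refine abs_roundDiv_mul_two_pow_sub_le (by positivity) ?_
  have h1 : ((∏ a ∈ Finset.range K, readProb (δ a) ((c : ℕ) / M ^ a % M) (k + (K + 1)) : ℕ) : ℝ) /
      ((2 ^ ((k + (K + 1)) * K) : ℕ) : ℝ) =
      ∏ a : Fin K, (readProb (δ a) (funOfCode c a) (k + (K + 1)) : ℝ) / 2 ^ (k + (K + 1)) := by
    rw [Finset.prod_div_distrib, Finset.prod_const, Finset.card_univ, Fintype.card_fin, ← pow_mul]
    push_cast
    rw [Finset.prod_range]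
    simp only [val_funOfCode]
  rw [h1]
  have h2 := abs_prod_sub_prod_le Finset.univ
    (fun a : Fin K => (readProb (δ a) (funOfCode c a) (k + (K + 1)) : ℝ) / 2 ^ (k + (K + 1)))
    (fun a => (p a).1 (funOfCode c a)) (fun a _ => readProb_mem _ _ _)
    fun a _ => ⟨(p a).2.1 _, (p a).le_one _⟩
  have h3 : ∑ a : Fin K, |(readProb (δ a) (funOfCode c a) (k + (K + 1)) : ℝ) / 2 ^ (k + (K + 1)) -
      (p a).1 (funOfCode c a)| ≤ K * (2⁻¹ : ℝ) ^ (k + (K + 1)) := by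
    refine (Finset.sum_le_sum fun a _ => (h a).readProb (funOfCode c a) _).trans ?_
    simp
  calc (2 : ℝ) ^ k * _ ≤ 2 ^ k * (K * (2⁻¹ : ℝ) ^ (k + (K + 1))) :=
        mul_le_mul_of_nonneg_left (h2.trans h3) (by positivity)
    _ = K * (2 ^ k * (2⁻¹ : ℝ) ^ (k + (K + 1))) := by ring
    _ ≤ 1 / 2 := by
        rw [two_pow_mul_inv_two_pow_add]
        exact natCast_mul_inv_two_pow_succ_le K

/-- The entry at `i` of the binary name of `PD.eval q p`, computed from binary names `X 0` of
`q` and `X 1` of `p`. -/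
def evalEntry (K M i : ℕ) (X : ℕ → ℕ → ℕ) : ℕ :=
  roundDiv ((∑ c ∈ Finset.range (M ^ K), ∑ a ∈ Finset.range K,
    if c / M ^ a % M = i.unpair.1 then
      readProb (X 0) c (i.unpair.2 + (2 * (M ^ K * K) + 1)) *
        readProb (X 1) a (i.unpair.2 + (2 * (M ^ K * K) + 1)) else 0) * 2 ^ i.unpair.2)
    (2 ^ (2 * (i.unpair.2 + (2 * (M ^ K * K) + 1))))

/-- The number of entries that `evalEntry` reads. -/
def evalWindow (K M i : ℕ) : ℕ := (M ^ K + K + (i.unpair.2 + (2 * (M ^ K * K) + 1)) + 1) ^ 2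

theorem Computable.evalEntry {α : Type*} [Primcodable α] {K M i : α → ℕ}
    {X : α → ℕ → ℕ → ℕ} (hK : Computable K) (hM : Computable M) (hi : Computable i)
    (hX : Computable fun p : α × ℕ × ℕ => X p.1 p.2.1 p.2.2) :
    Computable fun a => evalEntry (K a) (M a) (i a) (X a) := by
  unfold _root_.evalEntry readProb
  fun_prop

@[fun_prop]
theorem Computable.evalWindow {α : Type*} [Primcodable α] {K M i : α → ℕ} (hK : Computable K)
    (hM : Computable M) (hi : Computable i) :
    Computable fun a => evalWindow (K a) (M a) (i a) := by
  unfold _root_.evalWindow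
  fun_prop

theorem evalEntry_congr {K M i : ℕ} {X Y : ℕ → ℕ → ℕ}
    (h : ∀ a < 2, ∀ j < evalWindow K M i, X a j = Y a j) :
    evalEntry K M i X = evalEntry K M i Y := by
  unfold evalEntry
  congr 2
  refine Finset.sum_congr rfl fun c hc => Finset.sum_congr rfl fun a ha => ?_
  have hc := Finset.mem_range.1 hc
  have ha := Finset.mem_range.1 ha
  rw [readProb_congr (b := M ^ K + K) (by omega) (h 0 (by omega)),
    readProb_congr (b := M ^ K + K) (by omega) (h 1 (by omega))]

theorem binNames_eval {K M : ℕ} {q : PD (M ^ K)} {p : PD K} {δ : ℕ → ℕ → ℕ}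
    (hq : PD.BinNames (δ 0) q) (hp : PD.BinNames (δ 1) p) :
    PD.BinNames (fun i => evalEntry K M i δ) (PD.eval q p) := by
  intro b k
  simp only [evalEntry, Nat.unpair_pair]
  refine abs_roundDiv_mul_two_pow_sub_le (by positivity) ?_
  set k' := k + (2 * (M ^ K * K) + 1) with hk'
  have h1 : ((∑ c ∈ Finset.range (M ^ K), ∑ a ∈ Finset.range K,
      if c / M ^ a % M = (b : ℕ) then readProb (δ 0) c k' * readProb (δ 1) a k' else 0 : ℕ) : ℝ) /
      ((2 ^ (2 * k') : ℕ) : ℝ) = ∑ c : Fin (M ^ K), ∑ a : Fin K, if funOfCode c a = b then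
        ((readProb (δ 0) c k' : ℝ) / 2 ^ k') * ((readProb (δ 1) a k' : ℝ) / 2 ^ k') else 0 := by
    push_cast
    rw [Finset.sum_range, Finset.sum_div]
    refine Finset.sum_congr rfl fun c _ => ?_
    rw [Finset.sum_range, Finset.sum_div]
    refine Finset.sum_congr rfl fun a _ => ?_
    rw [← val_funOfCode]
    simp only [Fin.val_inj]
    split_ifs
    · rw [two_mul, pow_add]
      field_simp
    · simp
  rw [h1]
  have h2 : ∀ (c : Fin (M ^ K)) (a : Fin K),
      |(if funOfCode c a = b then
        ((readProb (δ 0) c k' : ℝ) / 2 ^ k') * ((readProb (δ 1) a k' : ℝ) / 2 ^ k') else 0) -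
      (if funOfCode c a = b then q.1 c * p.1 a else 0)| ≤ 2 * (2⁻¹ : ℝ) ^ k' := by
    intro c a
    split_ifs
    · have e1 := hq.readProb c k'
      have e2 := hp.readProb a k'
      have r := readProb_mem (δ 0) c k'
      have s := p.le_one a
      have s0 := p.2.1 a
      set x := (readProb (δ 0) c k' : ℝ) / 2 ^ k'
      set y := (readProb (δ 1) a k' : ℝ) / 2 ^ k'
      have : x * y - q.1 c * p.1 a = x * (y - p.1 a) + (x - q.1 c) * p.1 a := by ring
      rw [this]
      refine (abs_add_le _ _).trans ?_
      rw [abs_mul, abs_mul, abs_of_nonneg r.1, abs_of_nonneg s0, two_mul]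
      exact add_le_add ((mul_le_of_le_one_left (abs_nonneg _) r.2).trans e2)
        ((mul_le_of_le_one_right (abs_nonneg _) s).trans e1)
    · simp
  have h3 : |(∑ c : Fin (M ^ K), ∑ a : Fin K, if funOfCode c a = b then
        ((readProb (δ 0) c k' : ℝ) / 2 ^ k') * ((readProb (δ 1) a k' : ℝ) / 2 ^ k') else 0) -
      (PD.eval q p).1 b| ≤ (2 * (M ^ K * K) : ℕ) * (2⁻¹ : ℝ) ^ k' := by
    simp only [PD.eval]
    rw [← Finset.sum_sub_distrib]
    refine (Finset.abs_sum_le_sum_abs _ _).trans ?_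
    have : ∀ c : Fin (M ^ K), |(∑ a : Fin K, if funOfCode c a = b then
        ((readProb (δ 0) c k' : ℝ) / 2 ^ k') * ((readProb (δ 1) a k' : ℝ) / 2 ^ k') else 0) -
        ∑ a : Fin K, (if funOfCode c a = b then q.1 c * p.1 a else 0)| ≤
        K * (2 * (2⁻¹ : ℝ) ^ k') := by
      intro c
      rw [← Finset.sum_sub_distrib]
      refine (Finset.abs_sum_le_sum_abs _ _).trans ((Finset.sum_le_sum fun a _ => h2 c a).trans ?_)
      simp
    refine (Finset.sum_le_sum fun c _ => this c).trans (le_of_eq ?_)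
    simp
    ring
  calc (2 : ℝ) ^ k * _ ≤ 2 ^ k * ((2 * (M ^ K * K) : ℕ) * (2⁻¹ : ℝ) ^ k') :=
        mul_le_mul_of_nonneg_left h3 (by positivity)
    _ = (2 * (M ^ K * K) : ℕ) * (2 ^ k * (2⁻¹ : ℝ) ^ k') := by ring
    _ ≤ 1 / 2 := by
        rw [hk', two_pow_mul_inv_two_pow_add]
        exact natCast_mul_inv_two_pow_succ_le _

attribute [irreducible] piEntry piWindow evalEntry evalWindow

/-! ### The topology of the function spaces -/

namespace SeqFun

variable {X Y : Type u} [TopologicalSpace X] [TopologicalSpace Y]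

/-- The functions mapping a convergent sequence and its limit into a given open set form an
open set. -/
theorem isOpen_setOf_forall_mem {ξ : ℕ → X} {x : X} (hξ : Tendsto ξ atTop (𝓝 x)) {O : Set Y}
    (hO : IsOpen O) : IsOpen {g : SeqFun X Y | (∀ n, g.1 (ξ n) ∈ O) ∧ g.1 x ∈ O} := by
  classical
  intro g hg G hG
  -- a sequence of arguments which is bad for `G n` whenever there is a bad argument
  let κ : ℕ → ℕ := fun n => if h : ∃ k, (G n).1 (ξ k) ∉ O then h.choose else n
  have hκ : Tendsto κ atTop atTop := by
    refine tendsto_atTop.2 fun B => ?_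
    have hev : ∀ᶠ n in atTop, ∀ k ∈ Finset.range B, (G n).1 (ξ k) ∈ O :=
      (Finset.eventually_all _).2 fun k _ =>
        (hG (fun _ => ξ k) (ξ k) tendsto_const_nhds).eventually (hO.mem_nhds (hg.1 k))
    filter_upwards [hev, eventually_ge_atTop B] with n hn hnB
    by_contra! hlt
    by_cases h : ∃ k, (G n).1 (ξ k) ∉ O
    · have hk : κ n = h.choose := dif_pos h
      exact h.choose_spec (hn _ (Finset.mem_range.2 (hk ▸ hlt)))
    · have hk : κ n = n := dif_neg h
      omega
  filter_upwards [(hG _ x (hξ.comp hκ)).eventually (hO.mem_nhds hg.2),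
    (hG (fun _ => x) x tendsto_const_nhds).eventually (hO.mem_nhds hg.2)] with n hn hx
  refine ⟨?_, hx⟩
  by_contra! h
  have hk : κ n = h.choose := dif_pos h
  exact h.choose_spec (hk ▸ hn)

/-- The topology of `SeqFun X Y` has no more convergent sequences than the limit structure that
generates it. -/
theorem tendsto_iff {F : ℕ → SeqFun X Y} {f : SeqFun X Y} :
    Tendsto F atTop (𝓝 f) ↔ ConvergesTo F f := by
  constructor
  · intro h ξ x hξ
    rw [tendsto_nhds]
    intro O hO hfx
    obtain ⟨m, hm⟩ := eventually_atTop.1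
      (((f.2.tendsto x).comp hξ).eventually (hO.mem_nhds hfx))
    have hW := isOpen_setOf_forall_mem (Y := Y) ((tendsto_add_atTop_iff_nat m).2 hξ) hO
    filter_upwards [h.eventually (hW.mem_nhds ⟨fun n => hm _ (Nat.le_add_left m n), hfx⟩),
      eventually_ge_atTop m] with n hn hmn
    have := hn.1 (n - m)
    rwa [Nat.sub_add_cancel hmn] at this
  · intro h
    rw [tendsto_nhds]
    intro O hO hf
    exact hO f hf F h

theorem continuous_eval (x : X) : Continuous fun f : SeqFun X Y => f.1 x := by
  refine continuous_def.2 fun O hO f hf F hF => ?_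
  exact (hF (fun _ => x) x tendsto_const_nhds).eventually (hO.mem_nhds hf)

/-- A function of two variables which is continuous in both of them may be curried. -/
theorem continuous_curry {Z : Type*} [TopologicalSpace Z] [SequentialSpace Z]
    (F : Z → SeqFun X Y) (hF : Continuous fun p : Z × X => (F p.1).1 p.2) : Continuous F :=
  SeqContinuous.continuous fun _ w hz => tendsto_iff.2 fun _ x hξ =>
    (hF.tendsto (w, x)).comp (hz.prodMk_nhds hξ)

end SeqFun

/-! ### Selectors -/

/-- A represented space with an effective probabilistic selection and with effective
maps `hull n : PD (N n) → X` that turn a distribution on the finite set `A_n = {0, …, N n - 1}`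
into a single point of the space. The relation `rel a x` says of a sequence of elements `a n` of
`A_n` that it represents `x`. Whatever has positive probability under `mu n (ξ n)`, where `ξ`
converges to `x`, represents `x`; and if only sequences representing `x` have positive
probability under `m n`, then the points `hull n (m n)` converge to `x`. -/
structure Selector (X : RepSpace.{u}) where
  N : ℕ → ℕ
  pos : ∀ n, 0 < N n
  computable_N : Computable N
  mu : ∀ n, X.carrier → PD (N n)
  continuous_mu : ∀ n, Continuous (mu n)
  hull : ∀ n, PD (N n) → X.carrier
  continuous_hull : ∀ n, Continuous (hull n)
  rel : (∀ n, Fin (N n)) → X.carrier → Prop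
  rel_of_pos : ∀ (ξ : ℕ → X.carrier) (x : X.carrier), Tendsto ξ atTop (𝓝 x) →
    ∀ a : ∀ n, Fin (N n), (∀ n, 0 < (mu n (ξ n)).1 (a n)) → rel a x
  tendsto_hull : ∀ (m : ∀ n, PD (N n)) (x : X.carrier),
    (∀ a : ∀ n, Fin (N n), (∀ n, 0 < (m n).1 (a n)) → rel a x) →
      Tendsto (fun n => hull n (m n)) atTop (𝓝 x)
  muOp : ℕ → List ℕ → List ℕ
  computable_muOp : Computable fun p : ℕ × List ℕ => muOp p.1 p.2
  muOp_spec : ∀ n β x L, X.Names β x → Approx L β →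
    ∃ δ, Approx (fun m => muOp n (L m)) δ ∧ PD.BinNames δ (mu n x)
  hullOp : ℕ → List ℕ → List ℕ
  computable_hullOp : Computable fun p : ℕ × List ℕ => hullOp p.1 p.2
  hullOp_spec : ∀ n δ m L, PD.BinNames δ m → Approx L δ →
    ∃ β, Approx (fun k => hullOp n (L k)) β ∧ X.Names β (hull n m)

namespace Selector

variable {X Y : RepSpace.{u}}

/-- The point given by an element of the finite set `A_n`. -/
def point (S : Selector X) (n : ℕ) (a : Fin (S.N n)) : X.carrier := S.hull n (PD.dirac a)

theorem tendsto_point (S : Selector X) {a : ∀ n, Fin (S.N n)} {x : X.carrier} (h : S.rel a x) :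
    Tendsto (fun n => S.point n (a n)) atTop (𝓝 x) := by
  refine S.tendsto_hull _ _ fun b hb => ?_
  have : b = a := funext fun n => PD.dirac_pos_iff.1 (hb n)
  rwa [this]

/-- Initial segments of a name of `S.point n a`, computed from initial segments of length `k` of
the name of the Dirac distribution. -/
def pointList (S : Selector X) (n a k : ℕ) : List ℕ := S.hullOp n (initSeg (diracName a) k)

theorem computable_pointList (S : Selector X) {α : Type*} [Primcodable α] {f g h : α → ℕ}
    (hf : Computable f) (hg : Computable g) (hh : Computable h) :
    Computable fun x => S.pointList (f x) (g x) (h x) := by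
  have h1 := S.computable_hullOp
  have h2 : Computable fun x => initSeg (diracName (g x)) (h x) := by
    unfold diracName
    fun_prop
  exact h1.comp (hf.pair h2)

theorem pointList_spec (S : Selector X) (n : ℕ) (a : Fin (S.N n)) :
    ∃ β, (∀ s : ℕ → ℕ, Tendsto s atTop atTop → Approx (fun k => S.pointList n a (s k)) β) ∧
      X.Names β (S.point n a) := by
  obtain ⟨β, hβ, h⟩ := S.hullOp_spec n _ _ _ (binNames_diracName a) (approx_initSeg _)
  exact ⟨β, fun s hs => hβ.comp hs, h⟩

/-- The names of the functions `f a` for `a < K`, as far as they are determined, applied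
to the points given by `a` in `S`, and then mapped by `T.muOp n`. -/
def arrowMuOp (S : Selector X) (T : Selector Y) (n : ℕ) (s : List ℕ) : List ℕ :=
  readOff (S.N n) (piWindow (S.N n) (T.N n)) (piEntry (S.N n) (T.N n))
    (fun a => T.muOp n (listApp s (S.pointList n a s.length))) s.length

/-- The binary name of the distribution of `c a`, computed from initial segments of a binary name
of a distribution of functions `c` and of a name of a point `x`; here `a` is distributed according
to `S.mu n x`. -/
def evalList (S : Selector X) (T : Selector Y) (n : ℕ) (M l : List ℕ) : List ℕ :=
  readOff 2 (evalWindow (S.N n) (T.N n)) (evalEntry (S.N n) (T.N n))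
    (fun a => if a = 0 then M else S.muOp n l) l.length

/-- Initial segments of a name of a function, computed from those of a binary name of a
distribution of codes of functions. -/
def arrowHullOp (S : Selector X) (T : Selector Y) (n : ℕ) (M : List ℕ) : List ℕ :=
  curryList (fun M l => T.hullOp n (evalList S T n M l)) M

theorem computable_arrowMuOp (S : Selector X) (T : Selector Y) :
    Computable fun p : ℕ × List ℕ => arrowMuOp S T p.1 p.2 := by
  have hS := S.computable_N
  have hT := T.computable_N
  refine Computable.readOff (by fun_prop) ?_ ?_ ?_ (by fun_prop)
  · fun_prop
  · have h := T.computable_muOp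
    have h1 : Computable fun p : (ℕ × List ℕ) × ℕ => S.pointList p.1.1 p.2 p.1.2.length :=
      S.computable_pointList (by fun_prop) (by fun_prop) (by fun_prop)
    fun_prop
  · have h := T.computable_muOp
    refine Computable.piEntry (by fun_prop) (by fun_prop) (by fun_prop) ?_
    have h2 : Computable fun p : ((ℕ × List ℕ) × ℕ) × ℕ × ℕ =>
        S.pointList p.1.1.1 p.2.1 p.1.1.2.length :=
      S.computable_pointList (by fun_prop) (by fun_prop) (by fun_prop)
    fun_prop

theorem computable_arrowHullOp (S : Selector X) (T : Selector Y) :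
    Computable fun p : ℕ × List ℕ => arrowHullOp S T p.1 p.2 := by
  have hS := S.computable_N
  have hT := T.computable_N
  have h1 := S.computable_muOp
  have h2 := T.computable_hullOp
  have h3 : Computable fun p : (ℕ × List ℕ) × List ℕ × List ℕ =>
      evalList S T p.1.1 p.2.1 p.2.2 := by
    refine Computable.readOff (α := (ℕ × List ℕ) × List ℕ × List ℕ) (K := fun _ => 2)
      (w := fun p => evalWindow (S.N p.1.1) (T.N p.1.1))
      (F := fun p => evalEntry (S.N p.1.1) (T.N p.1.1))
      (L := fun p a => if a = 0 then p.2.1 else S.muOp p.1.1 p.2.2) (b := fun p => p.2.2.length)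
      (Computable.const 2) ?_ ?_ ?_ ?_
    · fun_prop
    · fun_prop
    · exact Computable.evalEntry (by fun_prop) (by fun_prop) (by fun_prop) (by fun_prop)
    · fun_prop
  exact Computable.curryList (Ψ := fun (p : ℕ × List ℕ) M l =>
    T.hullOp p.1 (evalList S T p.1 M l)) (by fun_prop) (by fun_prop)

/-- The function with hull parameter `q`: it maps `x` to the hull of the values `c a`, with
`c` distributed according to `q` and `a` according to `S.mu n x`. -/
def arrowHull (S : Selector X) (T : Selector Y) (n : ℕ) (q : PD (T.N n ^ S.N n)) :
    SeqFun X.carrier Y.carrier :=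
  ⟨fun x => T.hull n (PD.eval q (S.mu n x)), (T.continuous_hull n).comp
    (PD.continuous_eval.comp (continuous_const.prodMk (S.continuous_mu n)))⟩

/-- The distribution of functions `Fin (S.N n) → Fin (T.N n)` that approximate `f`; the value at
`a` is chosen at random according to the value of `f` at the point given by `a`. -/
def arrowMu (S : Selector X) (T : Selector Y) (n : ℕ) (f : SeqFun X.carrier Y.carrier) :
    PD (T.N n ^ S.N n) :=
  PD.pi fun a => T.mu n (f.1 (S.point n a))

theorem evalList_spec (S : Selector X) (T : Selector Y) {n : ℕ} {δ β : ℕ → ℕ}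
    {q : PD (T.N n ^ S.N n)} {x : X.carrier} (hq : PD.BinNames δ q) (hx : X.Names β x) :
    ∃ γ, Approx (fun m => T.hullOp n (evalList S T n (initSeg δ m) (initSeg β m))) γ ∧
      Y.Names γ ((arrowHull S T n q).1 x) := by
  obtain ⟨ε, hε, hε'⟩ := S.muOp_spec n β x _ hx (approx_initSeg β)
  obtain ⟨D, h0, h1⟩ : ∃ D : ℕ → ℕ → ℕ, D 0 = δ ∧ D 1 = ε :=
    ⟨fun a => if a = 0 then δ else ε, rfl, rfl⟩
  have hB : PD.BinNames (fun i => evalEntry (S.N n) (T.N n) i D) (PD.eval q (S.mu n x)) :=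
    binNames_eval (by rwa [h0]) (by rwa [h1])
  have hA : Approx (fun m => evalList S T n (initSeg δ m) (initSeg β m))
      fun i => evalEntry (S.N n) (T.N n) i D := by
    refine Approx.readOff (w := evalWindow (S.N n) (T.N n))
      (F := evalEntry (S.N n) (T.N n))
      (L := fun m a => if a = 0 then initSeg δ m else S.muOp n (initSeg β m))
      (fun a ha => ?_) (fun i X Y h => evalEntry_congr (X := X) (Y := Y) h) ?_
    · obtain rfl | rfl : a = 0 ∨ a = 1 := by omega
      · simpa only [h0, if_true] using approx_initSeg δ
      · simpa only [h1, one_ne_zero, if_false] using hε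
    · simp only [length_initSeg]
      exact tendsto_id
  exact T.hullOp_spec n _ _ _ hB hA

theorem arrowMuOp_spec (S : Selector X) (T : Selector Y) (n : ℕ) (φ : ℕ → ℕ)
    (f : SeqFun X.carrier Y.carrier) (L : ℕ → List ℕ) (hφ : (X.arrow Y).Names φ f)
    (hL : Approx L φ) :
    ∃ δ, Approx (fun m => arrowMuOp S T n (L m)) δ ∧ PD.BinNames δ (arrowMu S T n f) := by
  have h : ∀ a : Fin (S.N n), ∃ δ,
      Approx (fun m => T.muOp n (listApp (L m) (S.pointList n a (L m).length))) δ ∧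
        PD.BinNames δ (T.mu n (f.1 (S.point n a))) := by
    intro a
    obtain ⟨β, hβ, hβ'⟩ := S.pointList_spec n a
    obtain ⟨γ, hγ, hγ'⟩ := hφ β _ hβ'
    exact T.muOp_spec n γ _ _ hγ' (hL.listApp (hβ _ hL.tendsto_length) hγ)
  choose δ hδ hδ' using h
  let δ' : ℕ → ℕ → ℕ := fun a => if h : a < S.N n then δ ⟨a, h⟩ else 0
  have e : ∀ a (ha : a < S.N n), δ' a = δ ⟨a, ha⟩ := fun a ha => dif_pos ha
  refine ⟨fun i => piEntry (S.N n) (T.N n) i δ', Approx.readOff (w := piWindow (S.N n) (T.N n))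
    (F := piEntry (S.N n) (T.N n)) (fun a ha => ?_)
    (fun i X Y h => piEntry_congr (X := X) (Y := Y) (T.pos n) h) hL.tendsto_length,
    binNames_pi fun a => ?_⟩
  · rw [e a ha]
    exact hδ ⟨a, ha⟩
  · rw [e a a.2]
    exact hδ' a

/-- Selectors are inherited by function spaces. A sequence of functions `c n` represents `f` if it
maps all sequences representing some `x` to sequences representing `f x`. -/
def arrow (S : Selector X) (T : Selector Y) : Selector (X.arrow Y) where
  N n := T.N n ^ S.N n
  pos n := pow_pos (T.pos n) _
  computable_N := by
    have hS := S.computable_N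
    have hT := T.computable_N
    fun_prop
  mu := arrowMu S T
  continuous_mu n := PD.continuous_pi fun a =>
    (T.continuous_mu n).comp (SeqFun.continuous_eval (S.point n a))
  hull := arrowHull S T
  continuous_hull n := SeqFun.continuous_curry _ ((T.continuous_hull n).comp
    (PD.continuous_eval.comp (continuous_fst.prodMk ((S.continuous_mu n).comp continuous_snd))))
  rel c f := ∀ a x, S.rel a x → T.rel (fun n => funOfCode (c n) (a n)) (f.1 x)
  rel_of_pos F f hF c hc a x hax :=
    T.rel_of_pos _ _ (SeqFun.tendsto_iff.1 hF _ _ (S.tendsto_point hax)) _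
      fun n => PD.pi_pos (hc n) (a n)
  tendsto_hull q f hq := by
    refine SeqFun.tendsto_iff.2 fun ξ x hξ => T.tendsto_hull _ _ fun b hb => ?_
    choose c a hc ha hb using fun n => PD.exists_of_eval_pos (hb n)
    obtain rfl : (fun n => funOfCode (c n) (a n)) = b := funext hb
    exact hq c hc a x (S.rel_of_pos ξ x hξ a ha)
  muOp := arrowMuOp S T
  computable_muOp := computable_arrowMuOp S T
  muOp_spec n φ f L hφ hL := arrowMuOp_spec S T n φ f L hφ hL
  hullOp := arrowHullOp S T
  computable_hullOp := computable_arrowHullOp S T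
  hullOp_spec n δ q L hδ hL := ⟨_, hL.curryList _, fun β x hx => by
    obtain ⟨γ, hγ, h⟩ := evalList_spec S T hδ hx
    exact ⟨γ, applies_curry (Ψ := fun M l => T.hullOp n (evalList S T n M l)) hγ, h⟩⟩

/-- A selector provides an effective probabilistic selection. -/
theorem exists_effective_selection (S : Selector X) :
    ∃ (N : ℕ → ℕ) (ν : ∀ n, Fin (N n) → X.carrier) (μ : ∀ n, X.carrier → PD (N n)),
      Computable N ∧ IsEffectiveFiniteMaps X ν ∧ IsEffectiveMapsToPD X μ ∧
        IsProbabilisticSelection X.carrier N ν μ := by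
  refine ⟨S.N, S.point, S.mu, S.computable_N, ?_, ?_, S.continuous_mu, fun x a ha =>
    S.tendsto_point (S.rel_of_pos (fun _ => x) x tendsto_const_nhds a ha)⟩
  · -- the computation is made total by reducing `a` modulo `N n`
    have hN := S.computable_N
    have h1 : Computable fun p : (ℕ × ℕ) × ℕ => S.pointList p.1.1 (p.1.2 % S.N p.1.1) p.2 :=
      S.computable_pointList (by fun_prop) (by fun_prop) (by fun_prop)
    obtain ⟨g, hg, hg'⟩ := exists_computable_of_approx (α := ℕ × ℕ)
      (L := fun p k => S.pointList p.1 (p.2 % S.N p.1) k) h1 fun p => by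
        obtain ⟨β, hβ, -⟩ := S.pointList_spec p.1 ⟨p.2 % S.N p.1, Nat.mod_lt _ (S.pos _)⟩
        exact ⟨β, hβ id tendsto_id⟩
    refine ⟨g, hg, fun n a => ?_⟩
    obtain ⟨β, hβ, hβ'⟩ := S.pointList_spec n a
    have : β = g (n, a) := hg' (n, (a : ℕ)) β (by
      simpa only [Nat.mod_eq_of_lt a.2] using hβ (fun k => k) tendsto_id)
    exact this ▸ hβ'
  · have h1 := S.computable_muOp
    -- the entry `Z` at `⟨a, k⟩` of a binary name is turned into a code of `Z / 2 ^ k`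
    let conv : ℕ → (ℕ → ℕ → ℕ) → ℕ := fun i X =>
      dyadicCode (X 0 i) i.unpair.2
    let Θ : ℕ → List ℕ → List ℕ := fun n l =>
      readOff 1 (fun i => i + 1) conv (fun _ => S.muOp n l) l.length
    have hΘ : Computable fun p : ℕ × List ℕ => Θ p.1 p.2 :=
      Computable.readOff (by fun_prop) (by fun_prop) (by fun_prop)
        (by simp only [conv]; fun_prop) (by fun_prop)
    refine ⟨fun n => assocOf (Θ n), ?_, fun n β x hx => ?_⟩
    · unfold assocOf
      show Computable _
      fun_prop
    · obtain ⟨δ, hδ, hδ'⟩ := S.muOp_spec n β x _ hx (approx_initSeg β)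
      refine ⟨fun i => conv i fun _ => δ, applies_assocOf ?_, fun a k => ?_⟩
      · refine Approx.readOff (L := fun m _ => S.muOp n (initSeg β m)) (δ := fun _ => δ)
          (fun a ha => hδ) (fun i X Y h => ?_) ?_
        · simp only [conv]
          rw [h 0 Nat.one_pos i (Nat.lt_succ_self i)]
        · simp only [length_initSeg]
          exact tendsto_id
      · show |((ratNum (dyadicCode (δ (Nat.pair a k)) (Nat.pair a k).unpair.2) : ℚ) : ℝ) - _| ≤ _
        rw [Nat.unpair_pair, ratNum_dyadicCode]
        exact abs_div_two_pow_sub_le (hδ' a k)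

end Selector

/-! ### Selectors on effective metric spaces -/

theorem natCast_tsub (a b : ℕ) : ((a - b : ℕ) : ℝ) = max 0 ((a : ℝ) - b) := by
  rcases le_total b a with h | h
  · rw [Nat.cast_sub h, max_eq_right (sub_nonneg.2 (by exact_mod_cast h))]
  · rw [Nat.sub_eq_zero_of_le h, max_eq_left (sub_nonpos.2 (by exact_mod_cast h)), Nat.cast_zero]

theorem abs_posPart_sub_posPart_le (x y : ℝ) : |max 0 x - max 0 y| ≤ |x - y| := by
  simpa using abs_max_sub_max_le_max 0 x 0 y

theorem inv_two_pow_pos (n : ℕ) : (0 : ℝ) < 2⁻¹ ^ n := by positivity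

theorem natCast_roundDiv_ratNum {q k : ℕ} {x : ℝ} (hx : 0 ≤ x)
    (h : |((ratNum q : ℚ) : ℝ) - x| ≤ (2⁻¹ : ℝ) ^ (k + 1)) :
    |(roundDiv ((q.unpair.1 - q.unpair.2.unpair.1) * 2 ^ k) (q.unpair.2.unpair.2 + 1) : ℝ) -
      2 ^ k * x| ≤ 1 := by
  refine abs_roundDiv_mul_two_pow_sub_le (Nat.succ_pos _) ?_
  have h1 : ((q.unpair.1 - q.unpair.2.unpair.1 : ℕ) : ℝ) / ((q.unpair.2.unpair.2 + 1 : ℕ) : ℝ) =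
      max 0 ((ratNum q : ℚ) : ℝ) := by
    rw [natCast_tsub]
    unfold ratNum
    push_cast
    rw [← max_div_div_right (by positivity), zero_div]
  have h2 : |max 0 ((ratNum q : ℚ) : ℝ) - x| ≤ (2⁻¹ : ℝ) ^ (k + 1) := by
    have := abs_posPart_sub_posPart_le ((ratNum q : ℚ) : ℝ) x
    rw [max_eq_right hx] at this
    exact this.trans h
  rw [h1]
  calc (2 : ℝ) ^ k * _ ≤ 2 ^ k * (2⁻¹ : ℝ) ^ (k + 1) :=
        mul_le_mul_of_nonneg_left h2 (by positivity)
    _ = 1 / 2 := by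
        rw [two_pow_mul_inv_two_pow_add]
        norm_num

/-- The distances of the points of an effective metric space are approximated by a computable
function with values in the natural numbers, in units of `2 ^ (-k)`. -/
theorem EffectivePresentation.exists_natDist {X : Type u} [MetricSpace X]
    (P : EffectivePresentation X) : ∃ D : ℕ → ℕ → ℕ → ℕ,
      (Computable fun p : ℕ × ℕ × ℕ => D p.1 p.2.1 p.2.2) ∧
      ∀ i j k, |(D i j k : ℝ) - 2 ^ k * dist (P.point i) (P.point j)| ≤ 1 := by
  obtain ⟨g, hg, h⟩ := P.computable_dist
  have hg : Computable fun p : (ℕ × ℕ) × ℕ => g p.1 p.2 := hg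
  refine ⟨fun i j k => roundDiv (((g (i, j) (k + 1)).unpair.1 -
    (g (i, j) (k + 1)).unpair.2.unpair.1) * 2 ^ k) ((g (i, j) (k + 1)).unpair.2.unpair.2 + 1),
    by fun_prop, fun i j k => natCast_roundDiv_ratNum dist_nonneg (h i j (k + 1))⟩

/-- A weight for the index `i` that is positive only if `v i < v j + t` for all `j ≤ n`. -/
noncomputable def nearWeight (n : ℕ) (t : ℝ) (v : ℕ → ℝ) (i : ℕ) : ℝ :=
  max 0 (t - ∑ j ∈ Finset.range (n + 1), max 0 (v i - v j))

theorem nearWeight_nonneg (n : ℕ) (t : ℝ) (v : ℕ → ℝ) (i : ℕ) : 0 ≤ nearWeight n t v i :=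
  le_max_left _ _

theorem lt_of_nearWeight_pos {n : ℕ} {t : ℝ} {v : ℕ → ℝ} {i : ℕ} (h : 0 < nearWeight n t v i)
    {j : ℕ} (hj : j ≤ n) : v i < v j + t := by
  have h1 : 0 < t - ∑ j ∈ Finset.range (n + 1), max 0 (v i - v j) := by
    simpa [nearWeight, lt_max_iff] using h
  have h2 := Finset.single_le_sum (f := fun j => max 0 (v i - v j))
    (fun j _ => le_max_left _ _) (Finset.mem_range.2 (Nat.lt_succ_of_le hj))
  have h3 := le_max_right 0 (v i - v j)
  have h2 : max 0 (v i - v j) ≤ _ := h2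
  linarith

/-- The index of a least value has weight `t`. -/
theorem le_sum_nearWeight (n : ℕ) (t : ℝ) (v : ℕ → ℝ) :
    t ≤ ∑ i ∈ Finset.range (n + 1), nearWeight n t v i := by
  obtain ⟨i, hi, hmin⟩ := Finset.exists_min_image (Finset.range (n + 1)) v ⟨0, by simp⟩
  have h0 : ∑ j ∈ Finset.range (n + 1), max 0 (v i - v j) = 0 :=
    Finset.sum_eq_zero fun j hj => max_eq_left (sub_nonpos.2 (hmin j hj))
  refine le_trans ?_ (Finset.single_le_sum (fun j _ => nearWeight_nonneg n t v j) hi)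
  rw [nearWeight, h0, sub_zero]
  exact le_max_right _ _

theorem abs_nearWeight_sub_le {n : ℕ} {t ε : ℝ} {v v' : ℕ → ℝ} (h : ∀ j ≤ n, |v j - v' j| ≤ ε)
    {i : ℕ} (hi : i ≤ n) :
    |nearWeight n t v i - nearWeight n t v' i| ≤ (n + 1) * (2 * ε) := by
  refine (abs_posPart_sub_posPart_le _ _).trans ?_
  rw [sub_sub_sub_cancel_left, ← Finset.sum_sub_distrib]
  refine (Finset.abs_sum_le_sum_abs _ _).trans ?_
  refine (Finset.sum_le_card_nsmul _ _ (2 * ε) fun j hj => ?_).trans (by simp)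
  refine (abs_posPart_sub_posPart_le _ _).trans ?_
  have h1 := h i hi
  have h2 := h j (Nat.lt_succ_iff.1 (Finset.mem_range.1 hj))
  have : v' i - v' j - (v i - v j) = -(v i - v' i) + (v j - v' j) := by ring
  rw [this]
  refine (abs_add_le _ _).trans ?_
  rw [abs_neg]
  linarith

/-- The distribution on the indices `i ≤ n` with probabilities proportional to the weights
`nearWeight n t v i`. -/
noncomputable def nearDistribution (n : ℕ) {t : ℝ} (ht : 0 < t) (v : ℕ → ℝ) : PD (n + 1) :=
  ⟨fun i => nearWeight n t v i / ∑ j ∈ Finset.range (n + 1), nearWeight n t v j,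
    fun i => div_nonneg (nearWeight_nonneg _ _ _ _)
      (Finset.sum_nonneg fun _ _ => nearWeight_nonneg _ _ _ _), by
    rw [← Finset.sum_div, Finset.sum_range]
    refine div_self ?_
    rw [← Finset.sum_range]
    exact (ht.trans_le (le_sum_nearWeight n t v)).ne'⟩

theorem continuous_nearDistribution {X : Type*} [TopologicalSpace X] (n : ℕ) {t : ℝ} (ht : 0 < t)
    {v : X → ℕ → ℝ} (hv : ∀ j, Continuous fun x => v x j) :
    Continuous fun x => nearDistribution n ht (v x) := by
  have hw : ∀ i, Continuous fun x => nearWeight n t (v x) i := fun i => by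
    unfold nearWeight
    fun_prop
  refine PD.continuous_iff.2 fun i => ?_
  exact (hw i).div (continuous_finsetSum _ fun j _ => hw j) fun x =>
    (ht.trans_le (le_sum_nearWeight n t (v x))).ne'

theorem abs_nearWeight_div_sub_le {n : ℕ} {t ε : ℝ} (ht : 0 < t) {v v' : ℕ → ℝ}
    (h : ∀ j ≤ n, |v' j - v j| ≤ ε) (i : Fin (n + 1)) :
    |nearWeight n t v' i / ∑ j ∈ Finset.range (n + 1), nearWeight n t v' j -
      (nearDistribution n ht v).1 i| ≤ (n + 2) * ((n + 1) * (2 * ε)) / t := by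
  have hS := le_sum_nearWeight n t v
  have hS' := le_sum_nearWeight n t v'
  have hd : ∀ j ≤ n, |nearWeight n t v' j - nearWeight n t v j| ≤ (n + 1) * (2 * ε) :=
    fun j hj => abs_nearWeight_sub_le h hj
  have hdS : |∑ j ∈ Finset.range (n + 1), nearWeight n t v j -
      ∑ j ∈ Finset.range (n + 1), nearWeight n t v' j| ≤ (n + 1) * ((n + 1) * (2 * ε)) := by
    rw [← Finset.sum_sub_distrib]
    refine (Finset.abs_sum_le_sum_abs _ _).trans ?_
    refine (Finset.sum_le_card_nsmul _ _ ((n + 1) * (2 * ε)) fun j hj => ?_).trans (by simp)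
    rw [abs_sub_comm]
    exact hd j (Nat.lt_succ_iff.1 (Finset.mem_range.1 hj))
  have hle : nearWeight n t v i ≤ ∑ j ∈ Finset.range (n + 1), nearWeight n t v j :=
    Finset.single_le_sum (fun j _ => nearWeight_nonneg n t v j) (Finset.mem_range.2 i.2)
  have hw := nearWeight_nonneg n t v i
  have hdi := hd i (Nat.lt_succ_iff.1 i.2)
  show |nearWeight n t v' i / ∑ j ∈ Finset.range (n + 1), nearWeight n t v' j -
    nearWeight n t v i / ∑ j ∈ Finset.range (n + 1), nearWeight n t v j| ≤ _
  set S := ∑ j ∈ Finset.range (n + 1), nearWeight n t v j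
  set S' := ∑ j ∈ Finset.range (n + 1), nearWeight n t v' j
  set w := nearWeight n t v i
  set w' := nearWeight n t v' i
  have hSp : 0 < S := ht.trans_le hS
  have hSp' : 0 < S' := ht.trans_le hS'
  have key : w' / S' - w / S = ((w' - w) + w / S * (S - S')) / S' := by
    field_simp
    ring
  rw [key, abs_div, abs_of_pos hSp']
  have h1 : |w / S| ≤ 1 := by
    rw [abs_of_nonneg (div_nonneg hw hSp.le)]
    exact (div_le_one hSp).2 hle
  have h2 : |(w' - w) + w / S * (S - S')| ≤ (n + 2) * ((n + 1) * (2 * ε)) := by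
    refine (abs_add_le _ _).trans ?_
    rw [abs_mul]
    have := mul_le_of_le_one_left (abs_nonneg (S - S')) h1
    nlinarith
  exact div_le_div₀ ((abs_nonneg _).trans h2) h2 ht hS'

/-- The precision at which distances are read in `nearEntry`. -/
def nearPrecision (n i : ℕ) : ℕ := n + (i.unpair.2 + (4 * ((n + 2) * (n + 1)) + 1))

/-- The weights of `nearDistribution`, in units of `2 ^ (-K)`. -/
def natWeight (n K : ℕ) (e : ℕ → ℕ) (i : ℕ) : ℕ :=
  2 ^ (K - n) - ∑ j ∈ Finset.range (n + 1), (e i - e j)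

/-- The entry at `i` of the binary name of a `nearDistribution` for a point with name `X`, where
`D` approximates the distances between points of the presentation. -/
def nearEntry (D : ℕ → ℕ → ℕ → ℕ) (n i : ℕ) (X : ℕ → ℕ) : ℕ :=
  roundDiv (natWeight n (nearPrecision n i)
      (fun j => D (X (nearPrecision n i)) j (nearPrecision n i)) i.unpair.1 * 2 ^ i.unpair.2)
    (∑ a ∈ Finset.range (n + 1), natWeight n (nearPrecision n i)
      (fun j => D (X (nearPrecision n i)) j (nearPrecision n i)) a)

theorem natCast_natWeight {n K : ℕ} (h : n ≤ K) (e : ℕ → ℕ) (i : ℕ) :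
    (natWeight n K e i : ℝ) / 2 ^ K = nearWeight n (2⁻¹ ^ n) (fun j => (e j : ℝ) / 2 ^ K) i := by
  have hp : (0 : ℝ) < 2 ^ K := by positivity
  have h1 : (2 : ℝ) ^ (K - n) / 2 ^ K = 2⁻¹ ^ n := by
    rw [inv_pow, div_eq_iff hp.ne', eq_comm, inv_mul_eq_iff_eq_mul₀ (by positivity), ← pow_add,
      Nat.add_sub_cancel' h]
  unfold natWeight nearWeight
  rw [natCast_tsub, ← max_div_div_right hp.le, zero_div, sub_div]
  push_cast
  rw [h1, Finset.sum_div]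
  congr 2
  refine Finset.sum_congr rfl fun j _ => ?_
  rw [natCast_tsub, ← max_div_div_right hp.le, zero_div, sub_div]

theorem binNames_nearEntry {X : Type u} [MetricSpace X] {P : EffectivePresentation X}
    {D : ℕ → ℕ → ℕ → ℕ} (hD : ∀ i j k, |(D i j k : ℝ) - 2 ^ k * dist (P.point i) (P.point j)| ≤ 1)
    {β : ℕ → ℕ} {x : X} (hβ : P.Names β x) (n : ℕ) :
    PD.BinNames (fun i => nearEntry D n i β)
      (nearDistribution n (inv_two_pow_pos n) fun j => dist x (P.point j)) := by
  intro a k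
  have hKn : n ≤ nearPrecision n (Nat.pair a k) := Nat.le_add_right _ _
  have hKe : nearPrecision n (Nat.pair a k) = n + (k + (4 * ((n + 2) * (n + 1)) + 1)) := by
    simp [nearPrecision]
  simp only [nearEntry]
  rw [Nat.unpair_pair]
  set K := nearPrecision n (Nat.pair a k)
  have hp : (0 : ℝ) < 2 ^ K := by positivity
  set e : ℕ → ℕ := fun j => D (β K) j K
  have he : ∀ j ≤ n, |(e j : ℝ) / 2 ^ K - dist x (P.point j)| ≤ 2 * 2⁻¹ ^ K := by
    intro j _
    have h1 : |(e j : ℝ) / 2 ^ K - dist (P.point (β K)) (P.point j)| ≤ 2⁻¹ ^ K :=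
      abs_div_two_pow_sub_le (hD _ _ _)
    have h2 := abs_dist_sub_le (P.point (β K)) x (P.point j)
    have h3 := hβ K
    calc _ ≤ _ + _ := abs_sub_le _ (dist (P.point (β K)) (P.point j)) _
      _ ≤ _ := by linarith
  have hcast : ∀ i, (natWeight n K e i : ℝ) = nearWeight n (2⁻¹ ^ n) (fun j => (e j : ℝ) / 2 ^ K) i
      * 2 ^ K := fun i => by
    rw [← natCast_natWeight hKn, div_mul_cancel₀ _ hp.ne']
  have hsum : ((∑ a ∈ Finset.range (n + 1), natWeight n K e a : ℕ) : ℝ) =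
      (∑ a ∈ Finset.range (n + 1), nearWeight n (2⁻¹ ^ n) (fun j => (e j : ℝ) / 2 ^ K) a)
        * 2 ^ K := by
    push_cast
    rw [Finset.sum_mul]
    exact Finset.sum_congr rfl fun i _ => hcast i
  have hpos := (inv_two_pow_pos n).trans_le
    (le_sum_nearWeight n (2⁻¹ ^ n) (fun j => (e j : ℝ) / 2 ^ K))
  refine abs_roundDiv_mul_two_pow_sub_le ?_ ?_
  · have : (0 : ℝ) < ((∑ a ∈ Finset.range (n + 1), natWeight n K e a : ℕ) : ℝ) := by
      rw [hsum]
      positivity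
    exact_mod_cast this
  · rw [hsum, hcast, mul_div_mul_right _ _ hp.ne']
    have h := abs_nearWeight_div_sub_le (inv_two_pow_pos n) he a
    refine (mul_le_mul_of_nonneg_left h (by positivity)).trans ?_
    have h2 : (2 : ℝ) ^ k * ((n + 2) * ((n + 1) * (2 * (2 * 2⁻¹ ^ K))) / 2⁻¹ ^ n) =
        ((4 * ((n + 2) * (n + 1)) : ℕ) : ℝ) * (2 ^ k * (2⁻¹ ^ K / 2⁻¹ ^ n)) := by
      push_cast
      ring
    have h3 : (2⁻¹ : ℝ) ^ K / 2⁻¹ ^ n = 2⁻¹ ^ (k + (4 * ((n + 2) * (n + 1)) + 1)) := by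
      rw [hKe, pow_add 2⁻¹ n, mul_div_cancel_left₀ _ (inv_two_pow_pos n).ne']
    rw [h2, h3, two_pow_mul_inv_two_pow_add]
    exact natCast_mul_inv_two_pow_succ_le _

attribute [irreducible] nearEntry nearPrecision

theorem tendsto_point_of_nearDistribution_pos {X : Type u} [MetricSpace X]
    (P : EffectivePresentation X) {ξ : ℕ → X} {x : X} (hξ : Tendsto ξ atTop (𝓝 x))
    {a : ∀ n, Fin (n + 1)} (ha : ∀ n, 0 < (nearDistribution n (inv_two_pow_pos n)
      fun j => dist (ξ n) (P.point j)).1 (a n)) :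
    Tendsto (fun n => P.point (a n)) atTop (𝓝 x) := by
  have hξ' : Tendsto (fun n => dist (ξ n) x) atTop (𝓝 0) := tendsto_iff_dist_tendsto_zero.1 hξ
  refine Metric.tendsto_atTop.2 fun ε hε => ?_
  obtain ⟨j, hj⟩ := P.dense.exists_dist_lt x (by positivity : 0 < ε / 4)
  have hpow : Tendsto (fun n => (2⁻¹ : ℝ) ^ n) atTop (𝓝 0) :=
    tendsto_pow_atTop_nhds_zero_of_lt_one (by norm_num) (by norm_num)
  refine eventually_atTop.1 ?_
  filter_upwards [eventually_ge_atTop j, hξ'.eventually_lt_const (by positivity : 0 < ε / 4),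
    hpow.eventually_lt_const (by positivity : 0 < ε / 4)] with n hn h1 h2
  have hw : 0 < nearWeight n (2⁻¹ ^ n) (fun j => dist (ξ n) (P.point j)) (a n) := by
    by_contra! h
    have h0 := h.antisymm (nearWeight_nonneg _ _ _ _)
    refine (ha n).ne' ?_
    simp only [nearDistribution]
    rw [h0, zero_div]
  have h3 : dist (ξ n) (P.point (a n)) < dist (ξ n) (P.point j) + 2⁻¹ ^ n :=
    lt_of_nearWeight_pos hw hn
  have h4 : dist (P.point (a n)) x ≤ dist (ξ n) (P.point (a n)) + dist (ξ n) x := by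
    rw [dist_comm (ξ n) (P.point (a n))]
    exact dist_triangle _ _ _
  have h5 : dist (ξ n) (P.point j) ≤ dist (ξ n) x + dist x (P.point j) :=
    dist_triangle _ _ _
  linarith

theorem tendsto_hull_of_dist_le {X : Type u} [MetricSpace X] (P : EffectivePresentation X)
    {hull : ∀ n, PD (n + 1) → X}
    (hdist : ∀ n (m : PD (n + 1)) y R, (∀ i, 0 < m.1 i → dist (P.point i) y ≤ R) →
      dist (hull n m) y ≤ 3 * R + 2⁻¹ ^ n) {m : ∀ n, PD (n + 1)} {x : X}
    (h : ∀ a : ∀ n, Fin (n + 1), (∀ n, 0 < (m n).1 (a n)) →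
      Tendsto (fun n => P.point (a n)) atTop (𝓝 x)) :
    Tendsto (fun n => hull n (m n)) atTop (𝓝 x) := by
  -- a point of positive probability which is as far from `x` as possible
  have hmax : ∀ n, ∃ i : Fin (n + 1), 0 < (m n).1 i ∧
      ∀ j, 0 < (m n).1 j → dist (P.point j) x ≤ dist (P.point i) x := by
    intro n
    have hne : (Finset.univ.filter fun i : Fin (n + 1) => 0 < (m n).1 i).Nonempty := by
      by_contra hcon
      rw [Finset.not_nonempty_iff_eq_empty, Finset.filter_eq_empty_iff] at hcon
      have h0 : ∑ i, (m n).1 i = 0 := Finset.sum_eq_zero fun i hi =>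
        le_antisymm (not_lt.1 (hcon hi)) ((m n).2.1 i)
      rw [(m n).2.2] at h0
      exact one_ne_zero h0
    obtain ⟨i, hi, hi'⟩ := Finset.exists_max_image _ (fun i : Fin (n + 1) => dist (P.point i) x)
      hne
    exact ⟨i, (Finset.mem_filter.1 hi).2, fun j hj =>
      hi' j (Finset.mem_filter.2 ⟨Finset.mem_univ _, hj⟩)⟩
  choose a ha hmax using hmax
  have h1 : Tendsto (fun n => dist (P.point (a n)) x) atTop (𝓝 0) :=
    tendsto_iff_dist_tendsto_zero.1 (h a ha)
  have hpow : Tendsto (fun n => (2⁻¹ : ℝ) ^ n) atTop (𝓝 0) :=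
    tendsto_pow_atTop_nhds_zero_of_lt_one (by norm_num) (by norm_num)
  have h2 : Tendsto (fun n => 3 * dist (P.point (a n)) x + 2⁻¹ ^ n) atTop (𝓝 0) := by
    simpa using (h1.const_mul 3).add hpow
  exact tendsto_iff_dist_tendsto_zero.2 (squeeze_zero (fun _ => dist_nonneg)
    (fun n => hdist n (m n) x _ (hmax n)) h2)

/-- On an effective metric space, probabilities of the first `n + 1` points of the
presentation are given by `nearDistribution`. What is left to provide is an effective map `hull n`
that turns a distribution into a point near those with positive probability. -/
theorem nonempty_selector_of_hull {X : Type u} [MetricSpace X] (P : EffectivePresentation X)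
    (hull : ∀ n, PD (n + 1) → X) (hcont : ∀ n, Continuous (hull n))
    (hdist : ∀ n (m : PD (n + 1)) y R, (∀ i, 0 < m.1 i → dist (P.point i) y ≤ R) →
      dist (hull n m) y ≤ 3 * R + 2⁻¹ ^ n)
    (hullOp : ℕ → List ℕ → List ℕ) (hcomp : Computable fun p : ℕ × List ℕ => hullOp p.1 p.2)
    (hspec : ∀ n δ m L, PD.BinNames δ m → Approx L δ →
      ∃ β, Approx (fun k => hullOp n (L k)) β ∧ P.Names β (hull n m)) :
    Nonempty (Selector (RepSpace.ofMetric X P)) := by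
  obtain ⟨D, hDc, hD⟩ := P.exists_natDist
  refine ⟨{
    N := fun n => n + 1
    pos := Nat.succ_pos
    computable_N := by fun_prop
    mu := fun n (x : X) => nearDistribution n (inv_two_pow_pos n) fun j => dist x (P.point j)
    continuous_mu := fun n => continuous_nearDistribution n _ fun j =>
      (continuous_id.dist continuous_const : Continuous fun x : X => dist x (P.point j))
    hull := hull
    continuous_hull := hcont
    rel := fun a x => Tendsto (fun n => P.point (a n)) atTop (𝓝 x)
    rel_of_pos := ?_
    tendsto_hull := ?_
    muOp := fun n l => readOff 1 (fun i => nearPrecision n i + 1)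
      (fun i X => nearEntry D n i (X 0)) (fun _ => l) l.length
    computable_muOp := ?_
    muOp_spec := ?_
    hullOp := hullOp
    computable_hullOp := hcomp
    hullOp_spec := hspec }⟩
  · exact fun ξ x hξ a ha => tendsto_point_of_nearDistribution_pos P hξ ha
  · exact fun m x h => tendsto_hull_of_dist_le P hdist h
  · refine Computable.readOff (α := ℕ × List ℕ) (K := fun _ => 1)
      (w := fun p i => nearPrecision p.1 i + 1) (F := fun p i X => nearEntry D p.1 i (X 0))
      (L := fun p _ => p.2) (b := fun p => p.2.length) (by fun_prop) ?_ (by fun_prop) ?_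
      (by fun_prop)
    · unfold nearPrecision
      fun_prop
    · unfold nearEntry natWeight nearPrecision
      fun_prop
  · intro n β x L hβ hL
    refine ⟨_, Approx.readOff (L := fun m _ => L m) (δ := fun _ => β)
      (w := fun i => nearPrecision n i + 1) (F := fun i X => nearEntry D n i (X 0))
      (fun _ _ => hL) (fun i X Y h => ?_) hL.tendsto_length, binNames_nearEntry hD hβ n⟩
    unfold nearEntry
    rw [h 0 Nat.one_pos _ (Nat.lt_succ_self _)]

/-! ### Convex combinations in effective Banach spaces -/

theorem natCast_mul_inv_two_pow_le (n : ℕ) : (n : ℝ) * (2⁻¹) ^ n ≤ 1 := by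
  have := natCast_mul_inv_two_pow_succ_le n
  rw [pow_succ] at this
  linarith

/-- The index of a point close to `∑ b ≤ j, (X ⟨b, K⟩ / 2 ^ K) • r b`, where the functions
`A` and `S` compute approximate sums and multiples of points of the presentation. -/
def sumIndex (A S : ℕ → ℕ → ℕ → ℕ) (K : ℕ) (X : ℕ → ℕ) (j : ℕ) : ℕ :=
  Nat.rec (S (dyadicCode (X (Nat.pair 0 K)) K) 0 K)
    (fun b y => A y (S (dyadicCode (X (Nat.pair (b + 1) K)) K) (b + 1) K) K) j

theorem sumIndex_congr {A S : ℕ → ℕ → ℕ → ℕ} {K n j : ℕ} {X Y : ℕ → ℕ} (hj : j ≤ n)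
    (h : ∀ i < (n + K + 1) ^ 2, X i = Y i) : sumIndex A S K X j = sumIndex A S K Y j := by
  have hb : ∀ b ≤ n, X (Nat.pair b K) = Y (Nat.pair b K) := fun b hb =>
    h _ ((Nat.pair_lt_max_add_one_sq _ _).trans_le (Nat.pow_le_pow_left (by
      have : max b K ≤ b + K := max_le (Nat.le_add_right _ _) (Nat.le_add_left _ _)
      omega) 2))
  unfold sumIndex
  induction j with
  | zero =>
    simp only [hb 0 (Nat.zero_le n)]
    rfl
  | succ j ih =>
    simp only [hb (j + 1) hj]
    rw [ih (by omega)]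

theorem Computable.sumIndex {α : Type*} [Primcodable α] {A S : ℕ → ℕ → ℕ → ℕ}
    (hA : Computable fun p : ℕ × ℕ × ℕ => A p.1 p.2.1 p.2.2)
    (hS : Computable fun p : ℕ × ℕ × ℕ => S p.1 p.2.1 p.2.2) {K j : α → ℕ} {X : α → ℕ → ℕ}
    (hK : Computable K) (hX : Computable fun p : α × ℕ => X p.1 p.2) (hj : Computable j) :
    Computable fun a => sumIndex A S (K a) (X a) (j a) := by
  unfold _root_.sumIndex
  fun_prop

section Banach

variable {X : Type u} [NormedAddCommGroup X] [NormedSpace ℝ X]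

/-- The barycenter of the first `n + 1` points of the presentation. -/
noncomputable def barycenter (P : EffectivePresentation X) (n : ℕ) (m : PD (n + 1)) : X :=
  ∑ i : Fin (n + 1), m.1 i • P.point i

theorem dist_barycenter_le (P : EffectivePresentation X) (n : ℕ) (m : PD (n + 1)) (y : X) (R : ℝ)
    (h : ∀ i, 0 < m.1 i → dist (P.point i) y ≤ R) : dist (barycenter P n m) y ≤ R := by
  have h1 : barycenter P n m - y = ∑ i : Fin (n + 1), m.1 i • (P.point i - y) := by
    simp only [smul_sub, Finset.sum_sub_distrib, barycenter]
    rw [← Finset.sum_smul, m.2.2, one_smul]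
  rw [dist_eq_norm, h1]
  calc _ ≤ ∑ i : Fin (n + 1), m.1 i * R := by
        refine norm_sum_le_of_le _ fun i _ => ?_
        rw [norm_smul, Real.norm_of_nonneg (m.2.1 i)]
        rcases (m.2.1 i).eq_or_lt with h0 | h0
        · simp [← h0]
        · exact mul_le_mul_of_nonneg_left (by simpa [dist_eq_norm] using h i h0) h0.le
    _ = R := by rw [← Finset.sum_mul, m.2.2, one_mul]

theorem nonempty_selector_of_normedSpace (P : EffectivePresentation X)
    (hadd : P.IsComputableFamily fun i j => P.point i + P.point j)
    (hsmul : P.IsComputableFamily fun q i => ((ratNum q : ℚ) : ℝ) • P.point i) :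
    Nonempty (Selector (RepSpace.ofMetric X P)) := by
  obtain ⟨g, hg, hA⟩ := hadd
  obtain ⟨g', hg', hS⟩ := hsmul
  obtain ⟨D, hDc, hD⟩ := P.exists_natDist
  have hg : Computable fun p : (ℕ × ℕ) × ℕ => g p.1 p.2 := hg
  have hg' : Computable fun p : (ℕ × ℕ) × ℕ => g' p.1 p.2 := hg'
  let A : ℕ → ℕ → ℕ → ℕ := fun i j k => g (i, j) k
  let S : ℕ → ℕ → ℕ → ℕ := fun i j k => g' (i, j) k
  have hAc : Computable fun p : ℕ × ℕ × ℕ => A p.1 p.2.1 p.2.2 := by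
    simp only [A]
    fun_prop
  have hSc : Computable fun p : ℕ × ℕ × ℕ => S p.1 p.2.1 p.2.2 := by
    simp only [S]
    fun_prop
  replace hA : ∀ i j k, dist (P.point (A i j k)) (P.point i + P.point j) ≤ 2⁻¹ ^ k :=
    fun i j k => hA i j k
  replace hS : ∀ q i k, dist (P.point (S q i k)) (((ratNum q : ℚ) : ℝ) • P.point i) ≤ 2⁻¹ ^ k :=
    fun q i k => hS q i k
  clear_value A S
  -- a bound for the norms of the points, obtained from a point of norm at most `1`
  have hB : ∀ b, ‖P.point b‖ ≤ (D b (S 0 0 0) 0 + 2 : ℕ) := by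
    intro b
    have h1 : dist (P.point (S 0 0 0)) 0 ≤ 1 := by
      have := hS 0 0 0
      simpa [ratNum] using this
    have h2 := abs_le.1 (hD b (S 0 0 0) 0)
    have h3 := dist_triangle (P.point b) (P.point (S 0 0 0)) 0
    rw [dist_zero_right] at h3
    push_cast
    linarith [h2.1]
  let C : ℕ → ℕ := fun n => ∑ b ∈ Finset.range (n + 1), (D b (S 0 0 0) 0 + 2) + (2 * n + 1)
  have hC : Computable C := by
    simp only [C]
    fun_prop
  have hsum : ∀ (δ : ℕ → ℕ) K j, dist (P.point (sumIndex A S K δ j))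
      (∑ b ∈ Finset.range (j + 1), ((δ (Nat.pair b K) : ℝ) / 2 ^ K) • P.point b) ≤
        (2 * j + 1) * 2⁻¹ ^ K := by
    intro δ K j
    induction j with
    | zero =>
      have := hS (dyadicCode (δ (Nat.pair 0 K)) K) 0 K
      rw [ratNum_dyadicCode] at this
      simpa [sumIndex] using this
    | succ j ih =>
      have h1 := hS (dyadicCode (δ (Nat.pair (j + 1) K)) K) (j + 1) K
      have h2 := hA (sumIndex A S K δ j) (S (dyadicCode (δ (Nat.pair (j + 1) K)) K) (j + 1) K) K
      rw [ratNum_dyadicCode] at h1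
      rw [Finset.sum_range_succ]
      refine (dist_triangle _ _ _).trans (add_le_add h2 ((dist_add_add_le _ _ _ _).trans
        (add_le_add ih h1)) |>.trans (le_of_eq ?_))
      push_cast
      ring
  have key : ∀ n i (δ : ℕ → ℕ) (m : PD (n + 1)), PD.BinNames δ m →
      dist (P.point (sumIndex A S (i + C n) δ n)) (barycenter P n m) ≤ 2⁻¹ ^ i := by
    intro n i δ m hδ
    have h1 := hsum δ (i + C n) n
    have h2 : dist (∑ b ∈ Finset.range (n + 1),
        ((δ (Nat.pair b (i + C n)) : ℝ) / 2 ^ (i + C n)) • P.point b) (barycenter P n m) ≤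
        (∑ b ∈ Finset.range (n + 1), (D b (S 0 0 0) 0 + 2) : ℕ) * 2⁻¹ ^ (i + C n) := by
      rw [Finset.sum_range, barycenter, dist_eq_norm, ← Finset.sum_sub_distrib]
      rw [Nat.cast_sum, Finset.sum_range, Finset.sum_mul]
      refine norm_sum_le_of_le _ fun b _ => ?_
      rw [← sub_smul, norm_smul, mul_comm]
      exact mul_le_mul (hB b) (abs_div_two_pow_sub_le (hδ b _)) (norm_nonneg _) (Nat.cast_nonneg _)
    calc _ ≤ _ := (dist_triangle _ _ _).trans (add_le_add h1 h2)
      _ = (C n : ℝ) * 2⁻¹ ^ (C n) * 2⁻¹ ^ i := by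
        rw [pow_add]
        simp only [C]
        push_cast
        ring
      _ ≤ 2⁻¹ ^ i := mul_le_of_le_one_left (inv_two_pow_pos i).le (natCast_mul_inv_two_pow_le _)
  refine nonempty_selector_of_hull P (barycenter P) (fun n => ?_) (fun n m y R h => ?_)
    (fun n l => readOff 1 (fun i => (n + (i + C n) + 1) ^ 2)
      (fun i X => sumIndex A S (i + C n) (X 0) n) (fun _ => l) l.length) ?_ ?_
  · exact continuous_finsetSum _ fun i _ => (PD.continuous_apply i).smul continuous_const
  · have h1 := dist_barycenter_le P n m y R h
    have h2 : 0 ≤ R := dist_nonneg.trans h1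
    have h3 := inv_two_pow_pos n
    linarith
  · refine Computable.readOff (α := ℕ × List ℕ) (K := fun _ => 1)
      (w := fun p i => (p.1 + (i + C p.1) + 1) ^ 2)
      (F := fun p i X => sumIndex A S (i + C p.1) (X 0) p.1)
      (L := fun p _ => p.2) (b := fun p => p.2.length) (by fun_prop) (by fun_prop) (by fun_prop) ?_
      (by fun_prop)
    exact Computable.sumIndex hAc hSc (by fun_prop) (by fun_prop) (by fun_prop)
  · intro n δ m L hδ hL
    exact ⟨_, Approx.readOff (L := fun m _ => L m) (δ := fun _ => δ)
      (w := fun i => (n + (i + C n) + 1) ^ 2) (F := fun i X => sumIndex A S (i + C n) (X 0) n)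
      (fun _ _ => hL) (fun i X Y h => sumIndex_congr le_rfl (h 0 Nat.one_pos)) hL.tendsto_length,
      fun i => key n i δ m hδ⟩

end Banach

theorem IsEffectiveBanach.nonempty_selector {X : Type u} [M : MetricSpace X]
    {P : EffectivePresentation X} (h : IsEffectiveBanach P) :
    Nonempty (Selector (RepSpace.ofMetric X P)) := by
  obtain ⟨-, V, _, rfl, hadd, hsmul⟩ := h
  exact nonempty_selector_of_normedSpace P hadd hsmul

/-! ### One-point extensions -/

/-- The metric space obtained from a finite set of points of `X` by adding one point, at
distance `F i` from the point `q i`. -/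
@[reducible]
noncomputable def optionMetric {X : Type u} [MetricSpace X] {s : ℕ} (q : Fin s → X)
    (hq : Function.Injective q) (F : Fin s → ℝ) (hpos : ∀ i, 0 < F i)
    (h1 : ∀ i j, F i ≤ F j + dist (q i) (q j)) (h2 : ∀ i j, dist (q i) (q j) ≤ F i + F j) :
    MetricSpace (Option (Fin s)) where
  dist
    | none, none => 0
    | some i, none => F i
    | none, some i => F i
    | some i, some j => dist (q i) (q j)
  dist_self := by rintro (_ | i) <;> simp
  dist_comm := by rintro (_ | i) (_ | j) <;> simp [dist_comm]
  dist_triangle := by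
    rintro (_ | i) (_ | j) (_ | k)
    · simp
    · simp
    · simpa using (add_pos (hpos j) (hpos j)).le
    · simpa [dist_comm] using h1 k j
    · simp
    · simpa using h2 i k
    · have := h1 i j
      simp only at this ⊢
      linarith
    · exact dist_triangle _ _ _
  eq_of_dist_eq_zero := by
    rintro (_ | i) (_ | j) h
    · rfl
    · exact absurd h (hpos j).ne'
    · exact absurd h (hpos i).ne'
    · exact congrArg some (hq (dist_eq_zero.1 h))

theorem FinitelySaturated.exists_dist_eq_of_injective {X : Type u} [MetricSpace X]
    (h : FinitelySaturated X) {s : ℕ} (q : Fin s → X) (hq : Function.Injective q) (F : Fin s → ℝ)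
    (hpos : ∀ i, 0 < F i) (h1 : ∀ i j, F i ≤ F j + dist (q i) (q j))
    (h2 : ∀ i j, dist (q i) (q j) ≤ F i + F j) : ∃ y, ∀ i, dist y (q i) = F i := by
  let _ := optionMetric q hq F hpos h1 h2
  obtain ⟨ψ, hψ, hψ'⟩ := h (Option (Fin s)) {z | z.isSome} (fun z => q (z.1.get z.2)) (by
    refine Isometry.of_dist_eq ?_
    rintro ⟨_ | i, hi⟩ ⟨_ | j, hj⟩
    · exact absurd hi (by simp)
    · exact absurd hi (by simp)
    · exact absurd hj (by simp)
    · rfl)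
  refine ⟨ψ none, fun i => ?_⟩
  have h3 : ψ (some i) = q i := hψ' ⟨some i, rfl⟩
  rw [← h3, hψ.dist_eq]
  rfl

theorem FinitelySaturated.exists_dist_eq {X : Type u} [MetricSpace X] (h : FinitelySaturated X)
    {ι : Type*} [Finite ι] (x : ι → X) (f : ι → ℝ) (hpos : ∀ i, 0 < f i)
    (h1 : ∀ i j, f i ≤ f j + dist (x i) (x j)) (h2 : ∀ i j, dist (x i) (x j) ≤ f i + f j) :
    ∃ y, ∀ i, dist y (x i) = f i := by
  obtain ⟨s, ⟨e⟩⟩ := Finite.exists_equiv_fin (Set.range x)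
  choose c hc using fun i : Fin s => (e.symm i).2
  obtain ⟨y, hy⟩ := h.exists_dist_eq_of_injective (fun i => (e.symm i : X))
    (Subtype.val_injective.comp e.symm.injective) (fun i => f (c i)) (fun i => hpos _)
    (fun i j => by rw [← hc i, ← hc j]; exact h1 _ _)
    (fun i j => by rw [← hc i, ← hc j]; exact h2 _ _)
  refine ⟨y, fun i => ?_⟩
  have h3 := hy (e ⟨x i, i, rfl⟩)
  have h4 := hc (e ⟨x i, i, rfl⟩)
  simp only [Equiv.symm_apply_apply] at h3 h4
  rw [h3]
  have h5 := h1 (c (e ⟨x i, i, rfl⟩)) i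
  have h6 := h1 i (c (e ⟨x i, i, rfl⟩))
  rw [h4, dist_self, add_zero] at h5 h6
  exact le_antisymm h5 h6

/-! ### Hulls in the Urysohn space -/

/-- The distance between two natural numbers. -/
def absDiff (a b : ℕ) : ℕ := (a - b) + (b - a)

theorem natCast_absDiff (a b : ℕ) : (absDiff a b : ℝ) = |(a : ℝ) - b| := by
  unfold absDiff
  rcases le_total a b with h | h
  · rw [Nat.sub_eq_zero_of_le h, zero_add, Nat.cast_sub h, abs_sub_comm,
      abs_of_nonneg (sub_nonneg.2 (by exact_mod_cast h))]
  · rw [Nat.sub_eq_zero_of_le h, add_zero, Nat.cast_sub h,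
      abs_of_nonneg (sub_nonneg.2 (by exact_mod_cast h))]

/-- The numerators of the weights `gridWeight n p`. -/
def gridNum (n p b : ℕ) : ℕ :=
  if p - n = 0 then (if b = p then 1 else 0) else (listOfCode p.unpair.2).getD b 0

/-- The weights `gridWeight n p` are multiples of `2 ^ (-gridExp n p)`. -/
def gridExp (n p : ℕ) : ℕ := if p - n = 0 then 0 else p.unpair.1

/-- A vector of weights of the points `0, …, n` of a presentation. For `p ≤ n`, this is the unit
vector with index `p`; the vectors with larger indices are dense. -/
noncomputable def gridWeight (n p b : ℕ) : ℝ := (gridNum n p b : ℝ) / 2 ^ gridExp n p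

/-- The index `p > n` with `gridWeight n p b = Z b / 2 ^ t` for `b ≤ n`. -/
def gridCode (n t : ℕ) (Z : ℕ → ℕ) : ℕ := Nat.pair t (Encodable.encode (initSeg Z (n + 1)))

/-- The tolerance at the index `p`. -/
noncomputable def tol (n p : ℕ) : ℝ := 2⁻¹ ^ max n p

theorem tol_pos (n p : ℕ) : 0 < tol n p := inv_two_pow_pos _

theorem tol_le_tol (n : ℕ) {p q : ℕ} (h : p ≤ q) : tol n q ≤ tol n p :=
  pow_le_pow_of_le_one (by norm_num) (by norm_num) (max_le_max le_rfl h)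

theorem le_gridCode (n t : ℕ) (Z : ℕ → ℕ) : t ≤ gridCode n t Z := Nat.left_le_pair _ _

theorem gridWeight_gridCode {n t : ℕ} (ht : n < t) (Z : ℕ → ℕ) {b : ℕ} (hb : b ≤ n) :
    gridWeight n (gridCode n t Z) b = (Z b : ℝ) / 2 ^ t := by
  have h : gridCode n t Z - n ≠ 0 := by
    have := le_gridCode n t Z
    omega
  unfold gridWeight gridNum gridExp
  rw [if_neg h, if_neg h, gridCode, Nat.unpair_pair]
  simp only [listOfCode_encode]
  rw [getD_initSeg _ (Nat.lt_succ_of_le hb)]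

section Urysohn

variable {X : Type u} [MetricSpace X] (P : EffectivePresentation X)

/-- The distances to the points `i ≤ n`, averaged with weights `w`. If `w` is a probability
distribution, this is a Katětov function on these points; the sup distance between
these vectors extends the metric of the points to all vectors of weights. -/
noncomputable def meanDist (n : ℕ) (w : ℕ → ℝ) (i : Fin (n + 1)) : ℝ :=
  ∑ b ∈ Finset.range (n + 1), w b * dist (P.point b) (P.point i)

/-- The pseudometric on vectors of weights given by the sup distance of the mean distances. -/
noncomputable def gridDist (n : ℕ) (w w' : ℕ → ℝ) : ℝ := dist (meanDist P n w) (meanDist P n w')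

theorem meanDist_gridWeight {n p : ℕ} (hp : p ≤ n) (i : Fin (n + 1)) :
    meanDist P n (gridWeight n p) i = dist (P.point p) (P.point i) := by
  unfold meanDist
  rw [Finset.sum_eq_single p]
  · simp [gridWeight, gridNum, gridExp, Nat.sub_eq_zero_of_le hp]
  · intro b _ hb
    simp [gridWeight, gridNum, Nat.sub_eq_zero_of_le hp, hb]
  · intro h
    exact absurd (Finset.mem_range.2 (Nat.lt_succ_of_le hp)) h

theorem gridDist_gridWeight {n p q : ℕ} (hp : p ≤ n) (hq : q ≤ n) :
    gridDist P n (gridWeight n p) (gridWeight n q) = dist (P.point p) (P.point q) := by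
  refine le_antisymm ((dist_pi_le_iff dist_nonneg).2 fun i => ?_) ?_
  · rw [meanDist_gridWeight P hp, meanDist_gridWeight P hq, Real.dist_eq]
    exact abs_dist_sub_le _ _ _
  · have h := dist_le_pi_dist (meanDist P n (gridWeight n p)) (meanDist P n (gridWeight n q))
      ⟨q, Nat.lt_succ_of_le hq⟩
    rw [meanDist_gridWeight P hp, meanDist_gridWeight P hq, Real.dist_eq] at h
    rw [dist_self, sub_zero, abs_of_nonneg dist_nonneg] at h
    exact h

/-- The weights of a probability distribution. -/
noncomputable def PD.weight {n : ℕ} (m : PD (n + 1)) (b : ℕ) : ℝ :=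
  if h : b < n + 1 then m.1 ⟨b, h⟩ else 0

theorem meanDist_weight {n : ℕ} (m : PD (n + 1)) (i : Fin (n + 1)) :
    meanDist P n m.weight i = ∑ b, m.1 b * dist (P.point b) (P.point i) := by
  unfold meanDist
  rw [Finset.sum_range]
  exact Finset.sum_congr rfl fun b _ => by rw [PD.weight, dif_pos b.2]

theorem gridDist_weight_le {n : ℕ} (m : PD (n + 1)) (p : Fin (n + 1)) {R : ℝ}
    (h : ∀ b, 0 < m.1 b → dist (P.point b) (P.point p) ≤ R) :
    gridDist P n m.weight (gridWeight n p) ≤ R := by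
  have hm : ∀ b, m.1 b * dist (P.point b) (P.point p) ≤ m.1 b * R := fun b => by
    rcases (m.2.1 b).eq_or_lt with h0 | h0
    · simp [← h0]
    · exact mul_le_mul_of_nonneg_left (h b h0) h0.le
  have hR : ∑ b, m.1 b * dist (P.point b) (P.point p) ≤ R := by
    refine (Finset.sum_le_sum fun b _ => hm b).trans ?_
    rw [← Finset.sum_mul, m.2.2, one_mul]
  have h0 : 0 ≤ R := le_trans (Finset.sum_nonneg fun b _ => mul_nonneg (m.2.1 b) dist_nonneg) hR
  refine (dist_pi_le_iff h0).2 fun i => ?_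
  rw [meanDist_weight, meanDist_gridWeight P (Nat.lt_succ_iff.1 p.2), Real.dist_eq]
  have : dist (P.point p) (P.point i) = ∑ b, m.1 b * dist (P.point p) (P.point i) := by
    rw [← Finset.sum_mul, m.2.2, one_mul]
  rw [this, ← Finset.sum_sub_distrib]
  refine (Finset.abs_sum_le_sum_abs _ _).trans (le_trans (Finset.sum_le_sum fun b _ => ?_) hR)
  rw [← mul_sub, abs_mul, abs_of_nonneg (m.2.1 b)]
  exact mul_le_mul_of_nonneg_left (abs_dist_sub_le _ _ _) (m.2.1 b)

/-- A sequence of points of the presentation, given by their indices `u p`: it starts with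
the points `0, …, n`, and the distances between the points `u p` and `u q`, for `q < p` and
`n < p`, are those prescribed by the pseudometric `gridDist`, enlarged by `tol n q`, up to an
error of `tol n p`. -/
def IsGrid (n : ℕ) (u : ℕ → ℕ) (N : ℕ) : Prop :=
  ∀ p < N, (p ≤ n → u p = p) ∧ (n < p → ∀ q < p,
    |dist (P.point (u p)) (P.point (u q)) -
      (gridDist P n (gridWeight n p) (gridWeight n q) + tol n q)| < tol n p)

variable {P}

/-- The distances prescribed for the next point satisfy the triangle inequalities; the choice
of tolerances makes this work although the earlier distances are not exact. -/
theorem IsGrid.exists_dist_eq (hX : FinitelySaturated X) {n : ℕ} {u : ℕ → ℕ} {N : ℕ}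
    (h : IsGrid P n u N) : ∃ y, ∀ q < N, dist y (P.point (u q)) =
      gridDist P n (gridWeight n N) (gridWeight n q) + tol n q := by
  let f : ℕ → ℝ := fun q => gridDist P n (gridWeight n N) (gridWeight n q) + tol n q
  have hf : ∀ q, 0 < f q := fun q => add_pos_of_nonneg_of_pos dist_nonneg (tol_pos n q)
  have hlt : ∀ q q', q < q' → q' < N → f q ≤ f q' + dist (P.point (u q)) (P.point (u q')) ∧
      f q' ≤ f q + dist (P.point (u q)) (P.point (u q')) ∧
      dist (P.point (u q)) (P.point (u q')) ≤ f q + f q' := by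
    intro q q' hqq' hq'
    have t1 : gridDist P n (gridWeight n N) (gridWeight n q) ≤
        gridDist P n (gridWeight n N) (gridWeight n q') +
          gridDist P n (gridWeight n q') (gridWeight n q) := dist_triangle _ _ _
    have t2 : gridDist P n (gridWeight n N) (gridWeight n q') ≤
        gridDist P n (gridWeight n N) (gridWeight n q) +
          gridDist P n (gridWeight n q') (gridWeight n q) := by
      simpa only [gridDist, dist_comm] using dist_triangle_right (meanDist P n (gridWeight n N))
        (meanDist P n (gridWeight n q')) (meanDist P n (gridWeight n q))
    have t3 : gridDist P n (gridWeight n q') (gridWeight n q) ≤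
        gridDist P n (gridWeight n N) (gridWeight n q') +
          gridDist P n (gridWeight n N) (gridWeight n q) := dist_triangle_left _ _ _
    have c1 := tol_pos n q'
    have c2 := tol_le_tol n hqq'.le
    simp only [f]
    rcases le_or_gt q' n with hn | hn
    · rw [(h q' hq').1 hn, (h q (hqq'.trans hq')).1 (hqq'.le.trans hn),
        dist_comm (P.point q), ← gridDist_gridWeight P hn (hqq'.le.trans hn)]
      have c3 : tol n q = tol n q' := by
        unfold tol
        rw [max_eq_left hn, max_eq_left (hqq'.le.trans hn)]
      refine ⟨?_, ?_, ?_⟩ <;> linarith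
    · have := abs_lt.1 ((h q' hq').2 hn q hqq')
      rw [dist_comm (P.point (u q))]
      refine ⟨?_, ?_, ?_⟩ <;> linarith [this.1, this.2]
  suffices h : ∃ y, ∀ q : Fin N, dist y (P.point (u q)) = f q by
    obtain ⟨y, hy⟩ := h
    exact ⟨y, fun q hq => hy ⟨q, hq⟩⟩
  refine hX.exists_dist_eq (fun q : Fin N => P.point (u q)) (fun q => f q)
    (fun q => hf q) (fun q q' => ?_) (fun q q' => ?_)
  · rcases lt_trichotomy (q : ℕ) q' with hq | hq | hq
    · exact (hlt q q' hq q'.2).1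
    · simp [hq]
    · rw [dist_comm]
      exact (hlt q' q hq q.2).2.1
  · rcases lt_trichotomy (q : ℕ) q' with hq | hq | hq
    · exact (hlt q q' hq q'.2).2.2
    · have := hf q'
      simp only [hq, dist_self]
      linarith
    · rw [dist_comm, add_comm]
      exact (hlt q' q hq q.2).2.2

/-- An approximation of `meanDist P n (gridWeight n p) i`, in units of `2 ^ (-K)`. -/
def natMean (D : ℕ → ℕ → ℕ → ℕ) (n K p i : ℕ) : ℕ :=
  roundDiv (∑ b ∈ Finset.range (n + 1), gridNum n p b *
    D b i (K + ∑ b ∈ Finset.range (n + 1), gridNum n p b))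
    (2 ^ (gridExp n p + ∑ b ∈ Finset.range (n + 1), gridNum n p b))

/-- An approximation of `gridDist P n (gridWeight n p) (gridWeight n q)`, in units of
`2 ^ (-K)`. -/
def natGridDist (D : ℕ → ℕ → ℕ → ℕ) (n K p q : ℕ) : ℕ :=
  (Finset.range (n + 1)).sup fun i => absDiff (natMean D n K p i) (natMean D n K q i)

/-- A test, positive if `v` may be taken as the next index of a grid starting with `l`. Up to
rounding errors, the distances of the point `v` have to be correct with precision
`tol n l.length / 2`. -/
def gridTest (D : ℕ → ℕ → ℕ → ℕ) (n : ℕ) (l : List ℕ) (v : ℕ) : ℕ :=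
  if l.length - n = 0 then (if v = l.length then 1 else 0) else
    ∏ q ∈ Finset.range l.length, (17 - absDiff (D v (l.getD q 0) (l.length + 5))
      (natGridDist D n (l.length + 5) l.length q + 2 ^ (l.length + 5 - max n q)))

theorem computable_gridTest {D : ℕ → ℕ → ℕ → ℕ}
    (hD : Computable fun p : ℕ × ℕ × ℕ => D p.1 p.2.1 p.2.2) :
    Computable fun p : ℕ × List ℕ × ℕ => gridTest D p.1 p.2.1 p.2.2 := by
  have h1 : Computable fun p : ℕ × ℕ × ℕ => gridNum p.1 p.2.1 p.2.2 := by
    unfold gridNum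
    fun_prop
  have h2 : Computable fun p : ℕ × ℕ => gridExp p.1 p.2 := by
    unfold gridExp
    fun_prop
  have h3 : Computable fun p : ℕ × ℕ × ℕ × ℕ => natMean D p.1 p.2.1 p.2.2.1 p.2.2.2 := by
    unfold natMean
    fun_prop
  have h4 : Computable fun p : ℕ × ℕ × ℕ × ℕ => natGridDist D p.1 p.2.1 p.2.2.1 p.2.2.2 := by
    unfold natGridDist absDiff
    fun_prop
  unfold gridTest absDiff
  fun_prop

variable {D : ℕ → ℕ → ℕ → ℕ}

theorem abs_natMean_sub_le
    (hD : ∀ i j k, |(D i j k : ℝ) - 2 ^ k * dist (P.point i) (P.point j)| ≤ 1) (n K p : ℕ)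
    (i : Fin (n + 1)) :
    |(natMean D n K p i : ℝ) - 2 ^ K * meanDist P n (gridWeight n p) i| ≤ 2 := by
  unfold natMean
  set s := ∑ b ∈ Finset.range (n + 1), gridNum n p b with hs
  set A := ∑ b ∈ Finset.range (n + 1), gridNum n p b * D b i (K + s)
  have h1 := abs_roundDiv_sub_le A (2 ^ (gridExp n p + s)) (by positivity)
  have hA : |(A : ℝ) - 2 ^ (K + s) * ∑ b ∈ Finset.range (n + 1),
      (gridNum n p b : ℝ) * dist (P.point b) (P.point i)| ≤ s := by
    rw [Finset.mul_sum, hs, Nat.cast_sum, Nat.cast_sum, ← Finset.sum_sub_distrib]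
    refine (Finset.abs_sum_le_sum_abs _ _).trans (Finset.sum_le_sum fun b _ => ?_)
    rw [Nat.cast_mul, mul_left_comm, ← mul_sub, abs_mul, Nat.abs_cast]
    exact mul_le_of_le_one_right (Nat.cast_nonneg _) (hD _ _ _)
  have hm : 2 ^ K * meanDist P n (gridWeight n p) i = (2 ^ (K + s) * ∑ b ∈ Finset.range (n + 1),
      (gridNum n p b : ℝ) * dist (P.point b) (P.point i)) / 2 ^ (gridExp n p + s) := by
    have h0 : meanDist P n (gridWeight n p) i = (∑ b ∈ Finset.range (n + 1),
        (gridNum n p b : ℝ) * dist (P.point b) (P.point i)) / 2 ^ gridExp n p := by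
      rw [Finset.sum_div]
      exact Finset.sum_congr rfl fun b _ => by rw [gridWeight, div_mul_eq_mul_div]
    rw [h0, pow_add, pow_add]
    field_simp
  have h2 : |(A : ℝ) / 2 ^ (gridExp n p + s) - 2 ^ K * meanDist P n (gridWeight n p) i| ≤ 1 := by
    rw [hm, ← sub_div, abs_div, abs_of_pos (by positivity : (0 : ℝ) < 2 ^ (gridExp n p + s))]
    refine (div_le_one (by positivity)).2 (hA.trans ?_)
    have h3 : (s : ℝ) ≤ 2 ^ s := by exact_mod_cast Nat.lt_two_pow_self.le
    refine h3.trans (pow_le_pow_right₀ (by norm_num) (Nat.le_add_left _ _))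
  push_cast at h1
  calc _ ≤ _ + _ := abs_sub_le _ ((A : ℝ) / 2 ^ (gridExp n p + s)) _
    _ ≤ 2 := by linarith

theorem abs_natGridDist_sub_le
    (hD : ∀ i j k, |(D i j k : ℝ) - 2 ^ k * dist (P.point i) (P.point j)| ≤ 1) (n K p q : ℕ) :
    |(natGridDist D n K p q : ℝ) - 2 ^ K * gridDist P n (gridWeight n p) (gridWeight n q)| ≤ 4 := by
  have hp : (0 : ℝ) < 2 ^ K := by positivity
  have h : ∀ i : Fin (n + 1), |(absDiff (natMean D n K p i) (natMean D n K q i) : ℝ) -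
      2 ^ K * dist (meanDist P n (gridWeight n p) i) (meanDist P n (gridWeight n q) i)| ≤ 4 := by
    intro i
    have e1 := abs_natMean_sub_le hD n K p i
    have e2 := abs_natMean_sub_le hD n K q i
    rw [natCast_absDiff, Real.dist_eq, ← abs_of_pos hp, ← abs_mul, mul_sub]
    refine (abs_abs_sub_abs_le_abs_sub _ _).trans ?_
    rw [sub_sub_sub_comm]
    exact (abs_sub _ _).trans (by linarith)
  obtain ⟨i, hi, hsup⟩ := Finset.exists_mem_eq_sup (Finset.range (n + 1)) ⟨0, by simp⟩
    fun i => absDiff (natMean D n K p i) (natMean D n K q i)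
  have hsup : natGridDist D n K p q = absDiff (natMean D n K p i) (natMean D n K q i) := hsup
  rw [abs_le]
  constructor
  · have h0 : gridDist P n (gridWeight n p) (gridWeight n q) ≤
        ((natGridDist D n K p q : ℝ) + 4) / 2 ^ K := by
      refine (dist_pi_le_iff (by positivity)).2 fun j => ?_
      rw [le_div_iff₀ hp]
      have h1 := (abs_le.1 (h j)).1
      have h2 : (absDiff (natMean D n K p j) (natMean D n K q j) : ℝ) ≤ natGridDist D n K p q := by
        exact_mod_cast Finset.le_sup (f := fun i => absDiff (natMean D n K p i) (natMean D n K q i))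
          (Finset.mem_range.2 j.2)
      linarith
    rw [le_div_iff₀ hp] at h0
    linarith
  · have h1 := (abs_le.1 (h ⟨i, Finset.mem_range.1 hi⟩)).2
    have h2 : dist (meanDist P n (gridWeight n p) ⟨i, Finset.mem_range.1 hi⟩)
        (meanDist P n (gridWeight n q) ⟨i, Finset.mem_range.1 hi⟩) ≤
        gridDist P n (gridWeight n p) (gridWeight n q) := dist_le_pi_dist _ _ _
    have h3 := mul_le_mul_of_nonneg_left h2 hp.le
    rw [hsup]
    simp only at h1
    linarith

theorem two_pow_mul_tol {n q K : ℕ} (h : max n q ≤ K) : (2 : ℝ) ^ K * tol n q =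
    ((2 ^ (K - max n q) : ℕ) : ℝ) := by
  unfold tol
  conv_lhs => rw [← Nat.sub_add_cancel h, pow_add, mul_assoc, ← mul_pow]
  norm_num

theorem IsGrid.exists_gridTest (hX : FinitelySaturated X)
    (hD : ∀ i j k, |(D i j k : ℝ) - 2 ^ k * dist (P.point i) (P.point j)| ≤ 1) {n : ℕ} {l : List ℕ}
    (h : IsGrid P n (fun q => l.getD q 0) l.length) : ∃ v, gridTest D n l v ≠ 0 := by
  unfold gridTest
  split_ifs with hn
  · exact ⟨l.length, by simp⟩
  · obtain ⟨y, hy⟩ := h.exists_dist_eq hX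
    obtain ⟨v, hv⟩ := P.dense.exists_dist_lt y (inv_two_pow_pos (l.length + 5))
    refine ⟨v, Finset.prod_ne_zero_iff.2 fun q hq => ?_⟩
    have hq := Finset.mem_range.1 hq
    set K := l.length + 5
    have hp : (0 : ℝ) < 2 ^ K := by positivity
    have e1 := hD v (l.getD q 0) K
    have e2 := abs_natGridDist_sub_le hD n K l.length q
    have e3 : |2 ^ K * dist (P.point v) (P.point (l.getD q 0)) -
        2 ^ K * dist y (P.point (l.getD q 0))| ≤ 1 := by
      rw [← mul_sub, abs_mul, abs_of_pos hp]
      have := (abs_dist_sub_le (P.point v) y (P.point (l.getD q 0))).trans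
        ((dist_comm _ _).trans_le hv.le)
      calc _ ≤ 2 ^ K * (2⁻¹ : ℝ) ^ K := mul_le_mul_of_nonneg_left this hp.le
        _ = 1 := by rw [← mul_pow]; norm_num
    rw [hy q hq, mul_add, two_pow_mul_tol (by omega)] at e3
    have e4 : (absDiff (D v (l.getD q 0) K)
        (natGridDist D n K l.length q + 2 ^ (K - max n q)) : ℝ) ≤ 6 := by
      rw [natCast_absDiff, Nat.cast_add, abs_le]
      rw [abs_le] at e1 e2 e3
      constructor <;> linarith [e1.1, e1.2, e2.1, e2.2, e3.1, e3.2]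
    have e5 : absDiff (D v (l.getD q 0) K)
        (natGridDist D n K l.length q + 2 ^ (K - max n q)) ≤ 6 := by exact_mod_cast e4
    omega

theorem IsGrid.append
    (hD : ∀ i j k, |(D i j k : ℝ) - 2 ^ k * dist (P.point i) (P.point j)| ≤ 1) {n v : ℕ}
    {l : List ℕ} (h : IsGrid P n (fun q => l.getD q 0) l.length) (hv : gridTest D n l v ≠ 0) :
    IsGrid P n (fun q => (l ++ [v]).getD q 0) (l ++ [v]).length := by
  have hl : ∀ q < l.length, (l ++ [v]).getD q 0 = l.getD q 0 := fun q hq => by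
    simp [List.getD, List.getElem?_append_left hq]
  have hlv : (l ++ [v]).getD l.length 0 = v := by simp [List.getD]
  intro p hp
  rw [List.length_append, List.length_singleton, Nat.lt_succ_iff] at hp
  rcases hp.lt_or_eq with hp | rfl
  · simp only [hl p hp]
    refine ⟨(h p hp).1, fun hn q hq => ?_⟩
    rw [hl q (hq.trans hp)]
    exact (h p hp).2 hn q hq
  · simp only [hlv]
    unfold gridTest at hv
    refine ⟨fun hn => ?_, fun hn q hq => ?_⟩
    · rw [if_pos (Nat.sub_eq_zero_of_le hn)] at hv
      by_contra hne
      exact hv (if_neg hne)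
    · rw [if_neg (by omega)] at hv
      have h1 := Finset.prod_ne_zero_iff.1 hv q (Finset.mem_range.2 hq)
      rw [hl q hq]
      set K := l.length + 5 with hK
      have hp : (0 : ℝ) < 2 ^ K := by positivity
      have e1 := hD v (l.getD q 0) K
      have e2 := abs_natGridDist_sub_le hD n K l.length q
      have e4 : (absDiff (D v (l.getD q 0) K)
          (natGridDist D n K l.length q + 2 ^ (K - max n q)) : ℝ) ≤ 16 := by
        exact_mod_cast (by omega : absDiff (D v (l.getD q 0) K)
          (natGridDist D n K l.length q + 2 ^ (K - max n q)) ≤ 16)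
      have e5 : (2 : ℝ) ^ K * tol n l.length = 32 := by
        rw [two_pow_mul_tol (by omega), hK, max_eq_right hn.le, Nat.add_sub_cancel_left]
        norm_num
      have e6 := two_pow_mul_tol (n := n) (q := q) (K := K) (by omega)
      rw [← mul_lt_mul_iff_right₀ hp, e5]
      rw [natCast_absDiff, Nat.cast_add, ← e6] at e4
      rw [← abs_of_pos hp, ← abs_mul, mul_sub, mul_add, abs_lt]
      rw [abs_le] at e1 e2 e4
      constructor <;> linarith [e1.1, e1.2, e2.1, e2.2, e4.1, e4.2]

theorem exists_computable_isGrid (P : EffectivePresentation X) (hX : FinitelySaturated X) :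
    ∃ u : ℕ → ℕ → ℕ, (Computable fun p : ℕ × ℕ => u p.1 p.2) ∧ ∀ n N, IsGrid P n (u n) N := by
  obtain ⟨D, hDc, hD⟩ := P.exists_natDist
  obtain ⟨u, hu, h⟩ := exists_computable_search (gridTest D) (computable_gridTest hDc)
    (fun n l => IsGrid P n (fun q => l.getD q 0) l.length)
    (fun n p hp => absurd hp (Nat.not_lt_zero _)) (fun n l hl => hl.exists_gridTest hX hD)
    (fun n l v hl hv => hl.append hD hv)
  refine ⟨u, hu, fun n N p hp => ?_⟩
  have hN := (h n N).1
  simp only [length_initSeg] at hN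
  have hp' := hN p hp
  simp only [getD_initSeg _ hp] at hp'
  refine ⟨hp'.1, fun hn q hq => ?_⟩
  have := hp'.2 hn q hq
  rwa [getD_initSeg _ (hq.trans hp)] at this

theorem IsGrid.dist_le {n : ℕ} {u : ℕ → ℕ} (h : ∀ N, IsGrid P n u N) (p q : ℕ) :
    dist (P.point (u p)) (P.point (u q)) ≤
      gridDist P n (gridWeight n p) (gridWeight n q) + tol n p + tol n q := by
  wlog hqp : q ≤ p generalizing p q
  · have := this q p (le_of_not_ge hqp)
    have hdist := dist_comm (P.point (u p)) (P.point (u q))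
    have hgrid : gridDist P n (gridWeight n p) (gridWeight n q) =
      gridDist P n (gridWeight n q) (gridWeight n p) := dist_comm _ _
    linarith
  have hp := tol_pos n p
  have hq := tol_pos n q
  rcases hqp.eq_or_lt with rfl | hlt
  · simp only [gridDist, dist_self]
    linarith
  · obtain ⟨h1, h2⟩ := h (p + 1) p (Nat.lt_succ_self p)
    rcases le_or_gt p n with hn | hn
    · rw [h1 hn, ((h (p + 1) q (by omega)).1 (hqp.trans hn)),
        gridDist_gridWeight P hn (hqp.trans hn)]
      linarith
    · have := (abs_lt.1 (h2 hn q hlt)).2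
      linarith

/-- A bound for the sums of the distances of a point `i ≤ n` to the points `0, …, n`. -/
def distBound (D : ℕ → ℕ → ℕ → ℕ) (n : ℕ) : ℕ :=
  ∑ i ∈ Finset.range (n + 1), ∑ b ∈ Finset.range (n + 1), (D b i 0 + 1)

theorem gridDist_gridCode_le {D : ℕ → ℕ → ℕ → ℕ}
    (hD : ∀ i j k, |(D i j k : ℝ) - 2 ^ k * dist (P.point i) (P.point j)| ≤ 1) {n t : ℕ}
    (ht : n < t) {m : PD (n + 1)} {Z : ℕ → ℕ}
    (hZ : ∀ b : Fin (n + 1), |(Z b : ℝ) - 2 ^ t * m.1 b| ≤ 1) :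
    gridDist P n m.weight (gridWeight n (gridCode n t Z)) ≤ distBound D n * 2⁻¹ ^ t := by
  refine (dist_pi_le_iff (by positivity)).2 fun i => ?_
  have h1 : meanDist P n (gridWeight n (gridCode n t Z)) i =
      ∑ b : Fin (n + 1), (Z b : ℝ) / 2 ^ t * dist (P.point b) (P.point i) := by
    unfold meanDist
    rw [Finset.sum_range]
    exact Finset.sum_congr rfl fun b _ => by
      rw [gridWeight_gridCode ht Z (Nat.lt_succ_iff.1 b.2)]
  have h2 : (∑ b ∈ Finset.range (n + 1), (D b i 0 + 1) : ℕ) ≤ distBound D n :=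
    Finset.single_le_sum (f := fun i => ∑ b ∈ Finset.range (n + 1), (D b i 0 + 1))
      (fun _ _ => Nat.zero_le _) (Finset.mem_range.2 i.2)
  have h3 : ((∑ b ∈ Finset.range (n + 1), (D b i 0 + 1) : ℕ) : ℝ) ≤ distBound D n := by
    exact_mod_cast h2
  rw [h1, meanDist_weight, dist_comm, Real.dist_eq, ← Finset.sum_sub_distrib]
  refine (Finset.abs_sum_le_sum_abs _ _).trans ?_
  refine le_trans ?_ (mul_le_mul_of_nonneg_right h3 (inv_two_pow_pos t).le)
  rw [Nat.cast_sum, Finset.sum_range, Finset.sum_mul]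
  refine Finset.sum_le_sum fun b _ => ?_
  rw [← sub_mul, abs_mul, abs_of_nonneg dist_nonneg, mul_comm]
  refine mul_le_mul ?_ (abs_div_two_pow_sub_le (hZ b)) (abs_nonneg _) (Nat.cast_nonneg _)
  have := (abs_le.1 (hD b i 0)).1
  push_cast
  linarith

/-- A point whose distance to all points of the grid is bounded by the distance in the pseudometric
`gridDist`; it is the limit of the points of the grid at indices `gridCode n t Z`, where the
multiples `Z b` of `2 ^ (-t)` approximate the probabilities `m b`. -/
theorem exists_hull [CompleteSpace X] {D : ℕ → ℕ → ℕ → ℕ}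
    (hD : ∀ i j k, |(D i j k : ℝ) - 2 ^ k * dist (P.point i) (P.point j)| ≤ 1) {n : ℕ} {u : ℕ → ℕ}
    (h : ∀ N, IsGrid P n u N) (m : PD (n + 1)) : ∃ y, ∀ p,
      dist y (P.point (u p)) ≤ gridDist P n m.weight (gridWeight n p) + tol n p := by
  let Z : ℕ → ℕ → ℕ := fun t b => ⌊2 ^ t * m.weight b⌋₊
  have hZ : ∀ t (b : Fin (n + 1)), |(Z t b : ℝ) - 2 ^ t * m.1 b| ≤ 1 := by
    intro t b
    have hw : m.weight b = m.1 b := dif_pos b.2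
    have h0 : 0 ≤ 2 ^ t * m.1 b := mul_nonneg (by positivity) (m.2.1 b)
    have h1 := Nat.floor_le h0
    have h2 := Nat.lt_floor_add_one (2 ^ t * m.1 b)
    simp only [Z, hw]
    rw [abs_le]
    constructor <;> linarith
  let p : ℕ → ℕ := fun t => gridCode n (n + 1 + t) (Z (n + 1 + t))
  let B : ℕ → ℝ := fun t => (distBound D n + 1) * 2⁻¹ ^ t
  have hpow : Tendsto (fun n => (2⁻¹ : ℝ) ^ n) atTop (𝓝 0) :=
    tendsto_pow_atTop_nhds_zero_of_lt_one (by norm_num) (by norm_num)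
  have hB : Tendsto B atTop (𝓝 0) := by
    have := hpow.const_mul (distBound D n + 1 : ℝ)
    rwa [mul_zero] at this
  have hBanti : ∀ s t, s ≤ t → B t ≤ B s := fun s t hst =>
    mul_le_mul_of_nonneg_left (pow_le_pow_of_le_one (by norm_num) (by norm_num) hst) (by positivity)
  have hp : ∀ t, gridDist P n m.weight (gridWeight n (p t)) + tol n (p t) ≤ B t := by
    intro t
    have h1 := gridDist_gridCode_le hD (by omega : n < n + 1 + t) (hZ (n + 1 + t))
    have h2 : tol n (p t) ≤ 2⁻¹ ^ (n + 1 + t) := pow_le_pow_of_le_one (by norm_num) (by norm_num)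
      ((le_gridCode n (n + 1 + t) (Z (n + 1 + t))).trans (le_max_right _ _))
    have h3 : (2⁻¹ : ℝ) ^ (n + 1 + t) ≤ 2⁻¹ ^ t :=
      pow_le_pow_of_le_one (by norm_num) (by norm_num) (Nat.le_add_left _ _)
    have h4 := mul_le_mul_of_nonneg_left h3 (by positivity : (0 : ℝ) ≤ distBound D n + 1)
    simp only [B, p] at h2 ⊢
    linarith
  have hle : ∀ t q, dist (P.point (u (p t))) (P.point (u q)) ≤
      B t + (gridDist P n m.weight (gridWeight n q) + tol n q) := by
    intro t q
    have h1 := IsGrid.dist_le h (p t) q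
    have h2 : gridDist P n (gridWeight n (p t)) (gridWeight n q) ≤
        gridDist P n m.weight (gridWeight n (p t)) + gridDist P n m.weight (gridWeight n q) :=
      dist_triangle_left _ _ _
    have h3 := hp t
    linarith
  have hcau : CauchySeq fun t => P.point (u (p t)) := by
    refine cauchySeq_of_le_tendsto_0 (fun t => B t + B t) (fun s t N hs ht => ?_)
      (by simpa using hB.add hB)
    exact (hle s (p t)).trans (add_le_add (hBanti _ _ hs) ((hp t).trans (hBanti _ _ ht)))
  obtain ⟨y, hy⟩ := cauchySeq_tendsto_of_complete hcau
  refine ⟨y, fun q => ?_⟩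
  have h1 : Tendsto (fun t => B t + (gridDist P n m.weight (gridWeight n q) + tol n q)) atTop
      (𝓝 (0 + (gridDist P n m.weight (gridWeight n q) + tol n q))) := hB.add_const _
  rw [zero_add] at h1
  exact le_of_tendsto_of_tendsto' (hy.dist tendsto_const_nhds) h1 fun t => hle t q

theorem IsUrysohn.nonempty_selector {X : Type u} [MetricSpace X] (hX : IsUrysohn X)
    (P : EffectivePresentation X) : Nonempty (Selector (RepSpace.ofMetric X P)) := by
  obtain ⟨hcomplete, -, hsat⟩ := hX
  obtain ⟨D, hDc, hD⟩ := P.exists_natDist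
  obtain ⟨u, huc, hu⟩ := exists_computable_isGrid P hsat
  choose hull hhull using fun n (m : PD (n + 1)) => exists_hull hD (hu n) m
  let T : ℕ → ℕ → ℕ := fun n i => n + 1 + (i + (distBound D n + 1))
  have hT : Computable fun p : ℕ × ℕ => T p.1 p.2 := by
    simp only [T, distBound]
    fun_prop
  have key : ∀ n i (δ : ℕ → ℕ) (m : PD (n + 1)), PD.BinNames δ m →
      gridDist P n m.weight (gridWeight n (gridCode n (T n i) fun b => δ (Nat.pair b (T n i)))) +
        tol n (gridCode n (T n i) fun b => δ (Nat.pair b (T n i))) ≤ 2⁻¹ ^ i := by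
    intro n i δ m hδ
    have h1 := gridDist_gridCode_le hD (by simp only [T]; omega : n < T n i)
      (Z := fun b => δ (Nat.pair b (T n i))) fun b => hδ b (T n i)
    have h2 : tol n (gridCode n (T n i) fun b => δ (Nat.pair b (T n i))) ≤ 2⁻¹ ^ T n i :=
      pow_le_pow_of_le_one (by norm_num) (by norm_num)
        ((le_gridCode n _ _).trans (le_max_right _ _))
    have h3 : (2⁻¹ : ℝ) ^ T n i ≤ 2⁻¹ ^ (i + (distBound D n + 1)) :=
      pow_le_pow_of_le_one (by norm_num) (by norm_num) (Nat.le_add_left _ _)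
    have h4 := natCast_mul_inv_two_pow_le (distBound D n + 1)
    have h5 : ((distBound D n + 1 : ℕ) : ℝ) * 2⁻¹ ^ T n i ≤ 2⁻¹ ^ i := by
      refine (mul_le_mul_of_nonneg_left h3 (Nat.cast_nonneg _)).trans ?_
      rw [pow_add, mul_left_comm]
      exact mul_le_of_le_one_right (inv_two_pow_pos i).le h4
    push_cast at h5
    linarith
  have hdist : ∀ n m m', dist (hull n m) (hull n m') ≤
      gridDist P n m.weight (m' : PD (n + 1)).weight := by
    intro n m m'
    -- compare with points of the grid whose weights approximate `m`
    refine le_of_forall_pos_le_add fun ε hε => ?_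
    obtain ⟨i, hi⟩ := exists_pow_lt_of_lt_one (half_pos hε) (by norm_num : (2⁻¹ : ℝ) < 1)
    have hδ : PD.BinNames (fun j => ⌊2 ^ j.unpair.2 * m.weight j.unpair.1⌋₊) m := by
      intro b k
      have hw : m.weight b = m.1 b := dif_pos b.2
      have h0 : 0 ≤ 2 ^ k * m.1 b := mul_nonneg (by positivity) (m.2.1 b)
      have h1 := Nat.floor_le h0
      have h2 := Nat.lt_floor_add_one (2 ^ k * m.1 b)
      simp only [Nat.unpair_pair, hw]
      rw [abs_le]
      constructor <;> linarith
    have h1 := key n i _ m hδ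
    set p := gridCode n (T n i) fun b => (fun j : ℕ => ⌊2 ^ j.unpair.2 * m.weight j.unpair.1⌋₊)
      (Nat.pair b (T n i))
    have h2 := hhull n m p
    have h3 := hhull n m' p
    have h4 : gridDist P n m'.weight (gridWeight n p) ≤
        gridDist P n m.weight m'.weight + gridDist P n m.weight (gridWeight n p) :=
      dist_triangle_left _ _ _
    have h5 := dist_triangle_right (hull n m) (hull n m') (P.point (u n p))
    linarith
  refine nonempty_selector_of_hull P hull (fun n => ?_) (fun n m y R h => ?_)
    (fun n l => readOff 1 (fun i => (n + T n i + 1) ^ 2)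
      (fun i X => u n (gridCode n (T n i) fun b => X 0 (Nat.pair b (T n i)))) (fun _ => l) l.length)
    ?_ ?_
  · have hmean : Continuous fun m : PD (n + 1) => meanDist P n m.weight := by
      refine continuous_pi fun i => ?_
      simp only [meanDist_weight]
      exact continuous_finsetSum _ fun b _ => (PD.continuous_apply b).mul continuous_const
    refine continuous_iff_continuousAt.2 fun m => tendsto_iff_dist_tendsto_zero.2 ?_
    exact squeeze_zero (fun _ => dist_nonneg) (fun m' => hdist n m' m)
      (tendsto_iff_dist_tendsto_zero.1 (hmean.tendsto m))
  · obtain ⟨p, hp⟩ : ∃ p, 0 < m.1 p := by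
      by_contra! hcon
      have h0 : ∑ i, m.1 i = 0 := Finset.sum_eq_zero fun i _ => le_antisymm (hcon i) (m.2.1 i)
      rw [m.2.2] at h0
      exact one_ne_zero h0
    have h1 := hhull n m p
    rw [(hu n _ p (Nat.lt_succ_self p)).1 (Nat.lt_succ_iff.1 p.2)] at h1
    have h2 := gridDist_weight_le P m p (R := 2 * R) fun b hb =>
      (dist_triangle_right _ _ y).trans (by linarith [h b hb, h p hp])
    have h3 : tol n p = 2⁻¹ ^ n := by rw [tol, max_eq_left (Nat.lt_succ_iff.1 p.2)]
    have h4 := dist_triangle (hull n m) (P.point p) y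
    have h5 := h p hp
    linarith
  · refine Computable.readOff (α := ℕ × List ℕ) (K := fun _ => 1)
      (w := fun p i => (p.1 + T p.1 i + 1) ^ 2)
      (F := fun p i X => u p.1 (gridCode p.1 (T p.1 i) fun b => X 0 (Nat.pair b (T p.1 i))))
      (L := fun p _ => p.2) (b := fun p => p.2.length) (by fun_prop) (by fun_prop) (by fun_prop) ?_
      (by fun_prop)
    unfold gridCode
    fun_prop
  · intro n δ m L hδ hL
    refine ⟨_, Approx.readOff (L := fun m _ => L m) (δ := fun _ => δ)
      (w := fun i => (n + T n i + 1) ^ 2)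
      (F := fun i X => u n (gridCode n (T n i) fun b => X 0 (Nat.pair b (T n i))))
      (fun _ _ => hL) (fun i X Y h => ?_) hL.tendsto_length, fun i => ?_⟩
    · unfold gridCode
      rw [initSeg_congr fun b hb => ?_]
      refine h 0 Nat.one_pos _ ((Nat.pair_lt_max_add_one_sq _ _).trans_le
        (Nat.pow_le_pow_left ?_ 2))
      have : max b (T n i) ≤ b + T n i := max_le (Nat.le_add_right _ _) (Nat.le_add_left _ _)
      omega
    · rw [dist_comm]
      exact (hhull n m _).trans (key n i δ m hδ)

end Urysohn

/-! ### Katětov functions and finite saturation -/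

section Katetov

/-- The greatest extension of a Katětov function from a finite family of points to the whole
pseudometric space; the value at `a` is the minimum of `f i + e (x i) a`. -/
theorem exists_katetov_extension {α ι : Type*} [Finite ι] [Nonempty ι] (e : α → α → ℝ)
    (e_self : ∀ a, e a a = 0) (e_comm : ∀ a b, e a b = e b a)
    (e_triangle : ∀ a b c, e a c ≤ e a b + e b c) (x : ι → α) (f : ι → ℝ)
    (h1 : ∀ i j, f i ≤ f j + e (x i) (x j)) (h2 : ∀ i j, e (x i) (x j) ≤ f i + f j) :
    ∃ g : α → ℝ, (∀ i, g (x i) = f i) ∧ (∀ a b, g a ≤ g b + e a b) ∧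
      ∀ a b, e a b ≤ g a + g b := by
  choose l hl using fun a => Finite.exists_min fun i => f i + e (x i) a
  refine ⟨fun a => f (l a) + e (x (l a)) a, fun i => le_antisymm ?_ ?_, fun a b => ?_,
    fun a b => ?_⟩
  · have := hl (x i) i
    rwa [e_self, add_zero] at this
  · have := h1 i (l (x i))
    rwa [e_comm] at this
  · have := hl a (l b)
    have := e_triangle (x (l b)) b a
    have := e_comm a b
    dsimp only at *
    linarith
  · have := h2 (l a) (l b)
    have := e_triangle a (x (l a)) b
    have := e_triangle (x (l a)) (x (l b)) b
    have := e_comm a (x (l a))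
    dsimp only at *
    linarith

variable {X : Type u} [MetricSpace X]

/-- In a complete space, the approximate solvability of one-point extension problems implies their
solvability: an approximate solution `y` is improved by a point that approximately solves the
problem extended by the condition that the distance to `y` is the error of `y`. -/
theorem exists_dist_eq_of_approx [CompleteSpace X] [Nonempty X]
    (h : ∀ (ι : Type) [Finite ι] [Nonempty ι] (x : ι → X) (f : ι → ℝ),
      (∀ i j, f i ≤ f j + dist (x i) (x j)) → (∀ i j, dist (x i) (x j) ≤ f i + f j) →
      ∀ ε > 0, ∃ y, ∀ i, |f i - dist (x i) y| ≤ ε)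
    {ι : Type} [Finite ι] (x : ι → X) (f : ι → ℝ)
    (h1 : ∀ i j, f i ≤ f j + dist (x i) (x j)) (h2 : ∀ i j, dist (x i) (x j) ≤ f i + f j) :
    ∃ y, ∀ i, dist (x i) y = f i := by
  cases isEmpty_or_nonempty ι
  · exact ⟨Classical.arbitrary X, fun i => isEmptyElim i⟩
  have step : ∀ (n : ℕ) (y : {y // ∀ i, |f i - dist (x i) y| ≤ 2⁻¹ ^ n}),
      ∃ y' : {y // ∀ i, |f i - dist (x i) y| ≤ 2⁻¹ ^ (n + 1)},
        dist (y : X) y' ≤ 2 * 2⁻¹ ^ n := by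
    rintro n ⟨y, hy⟩
    obtain ⟨l, hl⟩ := Finite.exists_max fun i => |f i - dist (x i) y|
    set e := |f l - dist (x l) y| with he
    have he1 : ∀ i, f i ≤ e + dist (x i) y := fun i => by linarith [(abs_le.1 (hl i)).2]
    have he2 : ∀ i, dist (x i) y ≤ f i + e := fun i => by linarith [(abs_le.1 (hl i)).1]
    have he3 : ∀ i, e ≤ f i + dist (x i) y := fun i => by
      refine abs_le.2 ⟨?_, ?_⟩
      · linarith [h2 l i, dist_triangle (x l) (x i) y]
      · linarith [h1 l i, dist_triangle_right (x l) (x i) y]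
    have he0 : 0 ≤ e := abs_nonneg _
    obtain ⟨y', hy'⟩ := h (Option ι) (fun o => o.elim y x) (fun o => o.elim e f)
      (by
        rintro (_ | i) (_ | j)
        · simp
        · simpa [dist_comm] using he3 j
        · simpa using he1 i
        · simpa using h1 i j)
      (by
        rintro (_ | i) (_ | j)
        · simpa using he0
        · simpa [dist_comm, add_comm] using he2 j
        · simpa using he2 i
        · simpa using h2 i j)
      (2⁻¹ ^ (n + 1)) (inv_two_pow_pos _)
    refine ⟨⟨y', fun i => hy' (some i)⟩, ?_⟩
    have h3 := (abs_le.1 (hy' none)).1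
    have h4 : (2⁻¹ : ℝ) ^ (n + 1) ≤ 2⁻¹ ^ n :=
      pow_le_pow_of_le_one (by norm_num) (by norm_num) (Nat.le_succ n)
    have h5 : e ≤ 2⁻¹ ^ n := hy l
    simp only [Option.elim_none] at h3
    change dist y y' ≤ _
    linarith
  choose next hnext using step
  obtain ⟨y₀, hy₀⟩ := h ι x f h1 h2 (2⁻¹ ^ 0) (inv_two_pow_pos _)
  let s : ∀ n, {y // ∀ i, |f i - dist (x i) y| ≤ 2⁻¹ ^ n} :=
    fun n => Nat.rec ⟨y₀, hy₀⟩ (fun n y => next n y) n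
  have hs : ∀ n, dist (s n).1 (s (n + 1)).1 ≤ 2 * 2⁻¹ ^ n := fun n => hnext n (s n)
  have hcau : CauchySeq fun n => (s n).1 :=
    cauchySeq_of_le_geometric 2⁻¹ 2 (by norm_num) hs
  obtain ⟨y, hy⟩ := cauchySeq_tendsto_of_complete hcau
  refine ⟨y, fun i => ?_⟩
  have h3 : Tendsto (fun n => f i - dist (x i) (s n).1) atTop (𝓝 0) :=
    squeeze_zero_norm (a := fun n => 2⁻¹ ^ n) (fun n => (s n).2 i)
      (tendsto_pow_atTop_nhds_zero_of_lt_one (by norm_num) (by norm_num))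
  have h4 : Tendsto (fun n => f i - dist (x i) (s n).1) atTop (𝓝 (f i - dist (x i) y)) :=
    (tendsto_const_nhds.dist hy).const_sub _
  linarith [tendsto_nhds_unique h3 h4]

theorem finitelySaturated_of_exists_dist_eq [Nonempty X]
    (h : ∀ (ι : Type) [Finite ι] (x : ι → X) (f : ι → ℝ),
      (∀ i j, f i ≤ f j + dist (x i) (x j)) → (∀ i j, dist (x i) (x j) ≤ f i + f j) →
      ∃ y, ∀ i, dist (x i) y = f i) : FinitelySaturated X := by
  intro L _ _ K φ hφ
  classical
  have key : ∀ T : Set L, ∃ ψ : L → X, (∀ a ∈ K ∪ T, ∀ b ∈ K ∪ T, dist (ψ a) (ψ b) = dist a b) ∧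
      ∀ a : K, ψ a = φ a := by
    intro T
    induction T, T.toFinite using Set.Finite.induction_on with
    | empty =>
      refine ⟨fun a => if ha : a ∈ K then φ ⟨a, ha⟩ else Classical.arbitrary X,
        fun a ha b hb => ?_, fun a => dif_pos a.2⟩
      rw [Set.union_empty] at ha hb
      simp only [ha, hb, dif_pos]
      exact hφ.dist_eq _ _
    | @insert c T _ _ ih =>
      obtain ⟨ψ, hψ, hψ'⟩ := ih
      by_cases hc : c ∈ K ∪ T
      · refine ⟨ψ, ?_, hψ'⟩
        rwa [Set.union_insert, Set.insert_eq_of_mem hc]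
      obtain ⟨y, hy⟩ := h ↥(K ∪ T) (fun a => ψ a) (fun a => dist (a : L) c)
        (fun a b => by
          rw [hψ a a.2 b b.2]
          linarith [dist_triangle (a : L) b c])
        (fun a b => by
          rw [hψ a a.2 b b.2]
          exact dist_triangle_right _ _ _)
      have hne : ∀ a ∈ K ∪ T, a ≠ c := fun a ha hac => hc (hac ▸ ha)
      refine ⟨Function.update ψ c y, ?_, fun a => ?_⟩
      · rw [Set.union_insert]
        rintro a (rfl | ha) b (rfl | hb)
        · simp
        · rw [Function.update_self, Function.update_of_ne (hne b hb), dist_comm, hy ⟨b, hb⟩,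
            dist_comm]
        · rw [Function.update_self, Function.update_of_ne (hne a ha), hy ⟨a, ha⟩]
        · rw [Function.update_of_ne (hne a ha), Function.update_of_ne (hne b hb), hψ a ha b hb]
      · rw [Function.update_of_ne (hne a (Or.inl a.2)), hψ' a]
  obtain ⟨ψ, hψ, hψ'⟩ := key Set.univ
  exact ⟨ψ, Isometry.of_dist_eq fun a b => hψ a (by simp) b (by simp), hψ'⟩

end Katetov

/-! ### An effectively presented Urysohn space -/

section Existence

/-- The distance of `i` and `l` in multiples of `2 ^ (-k)`, for `i, l ≤ k`, in the pseudometric on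
`ℕ` where `w j` codes the list of the distances of `j` to `0, …, j - 1`, in multiples
of `2 ^ (-j)`. -/
def scaledDist (w : ℕ → ℕ) (k i l : ℕ) : ℕ :=
  if i = l then 0 else (listOfCode (w (max i l))).getD (min i l) 0 * 2 ^ (k - max i l)

/-- This number is zero if and only if `f` is a Katětov function on `{0, …, n - 1}` with the
distance function `scaledDist w k`. -/
def katetovDefect (w : ℕ → ℕ) (k n : ℕ) (f : ℕ → ℕ) : ℕ :=
  ∑ i ∈ Finset.range n, ∑ l ∈ Finset.range n,
    ((f i - (f l + scaledDist w k i l)) + (scaledDist w k i l - (f i + f l)))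

theorem katetovDefect_eq_zero_iff {w : ℕ → ℕ} {k n : ℕ} {f : ℕ → ℕ} :
    katetovDefect w k n f = 0 ↔ ∀ i < n, ∀ l < n,
      f i ≤ f l + scaledDist w k i l ∧ scaledDist w k i l ≤ f i + f l := by
  simp [katetovDefect, Finset.sum_eq_zero_iff, Nat.sub_eq_zero_iff_le]

theorem scaledDist_congr {w w' : ℕ → ℕ} {k i l : ℕ} (h : w (max i l) = w' (max i l)) :
    scaledDist w k i l = scaledDist w' k i l := by
  rw [scaledDist, scaledDist, h]

theorem katetovDefect_congr {w w' : ℕ → ℕ} {k n : ℕ} {f f' : ℕ → ℕ} (h : ∀ i < n, w i = w' i)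
    (hf : ∀ i < n, f i = f' i) : katetovDefect w k n f = katetovDefect w' k n f' := by
  refine Finset.sum_congr rfl fun i hi => Finset.sum_congr rfl fun l hl => ?_
  rw [Finset.mem_range] at hi hl
  rw [scaledDist_congr (h _ (max_lt hi hl)), hf i hi, hf l hl]

/-- The distance function on `ℕ` with the values `scaledDist w k i l / 2 ^ k`. -/
noncomputable def rowDist (w : ℕ → ℕ) (i l : ℕ) : ℝ :=
  scaledDist w (max i l) i l / 2 ^ max i l

theorem natCast_scaledDist {w : ℕ → ℕ} {k i l : ℕ} (h : max i l ≤ k) :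
    (scaledDist w k i l : ℝ) = 2 ^ k * rowDist w i l := by
  rw [rowDist, scaledDist, scaledDist, Nat.sub_self]
  split_ifs
  · simp
  · obtain ⟨t, rfl⟩ := Nat.exists_eq_add_of_le h
    rw [Nat.add_sub_cancel_left]
    push_cast
    rw [pow_add]
    field_simp

theorem rowDist_self (w : ℕ → ℕ) (i : ℕ) : rowDist w i i = 0 := by simp [rowDist, scaledDist]

theorem rowDist_comm (w : ℕ → ℕ) (i l : ℕ) : rowDist w i l = rowDist w l i := by
  simp only [rowDist, scaledDist, max_comm i l, min_comm i l, eq_comm (a := i)]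

theorem rowDist_eq {w : ℕ → ℕ} {i j : ℕ} (h : i < j) :
    rowDist w j i = (listOfCode (w j)).getD i 0 / 2 ^ j := by
  simp [rowDist, scaledDist, h.ne', max_eq_left h.le, min_eq_right h.le]

/-- The row with number `j` is a Katětov function on `{0, …, j - 1}`. -/
def IsKatetovRow (w : ℕ → ℕ) (j : ℕ) : Prop :=
  katetovDefect w j j (fun i => (listOfCode (w j)).getD i 0) = 0

theorem isKatetovRow_iff {w : ℕ → ℕ} {j : ℕ} : IsKatetovRow w j ↔ ∀ i < j, ∀ l < j,
    rowDist w j i ≤ rowDist w j l + rowDist w i l ∧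
      rowDist w i l ≤ rowDist w j i + rowDist w j l := by
  rw [IsKatetovRow, katetovDefect_eq_zero_iff]
  refine forall₂_congr fun i hi => forall₂_congr fun l hl => ?_
  have h2 : (0 : ℝ) < 2 ^ j := by positivity
  rw [← Nat.cast_le (α := ℝ), ← Nat.cast_le (α := ℝ), Nat.cast_add, Nat.cast_add,
    natCast_scaledDist (max_le hi.le hl.le), rowDist_eq hi, rowDist_eq hl]
  rw [← add_div, div_add' _ _ _ h2.ne', div_le_div_iff_of_pos_right h2, le_div_iff₀ h2, mul_comm]

theorem rowDist_triangle {w : ℕ → ℕ} {n : ℕ} (h : ∀ j < n, IsKatetovRow w j) {i l m : ℕ}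
    (hi : i < n) (hl : l < n) (hm : m < n) : rowDist w i m ≤ rowDist w i l + rowDist w l m := by
  have key : ∀ j < n, ∀ i < j, ∀ l < j, rowDist w j i ≤ rowDist w j l + rowDist w i l ∧
      rowDist w i l ≤ rowDist w j i + rowDist w j l := fun j hj => isKatetovRow_iff.1 (h j hj)
  have hn : ∀ j < n, ∀ i < j, 0 ≤ rowDist w j i := fun j hj i hi => by
    have := (key j hj i hi i hi).2
    rw [rowDist_self] at this
    linarith
  have hnn : ∀ i < n, ∀ l < n, 0 ≤ rowDist w i l := fun i hi l hl => by
    rcases lt_trichotomy i l with h | rfl | h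
    · rw [rowDist_comm]
      exact hn l hl i h
    · rw [rowDist_self]
    · exact hn i hi l h
  rcases eq_or_ne i l with rfl | hil
  · rw [rowDist_self, zero_add]
  rcases eq_or_ne l m with rfl | hlm
  · rw [rowDist_self, add_zero]
  rcases eq_or_ne i m with rfl | him
  · rw [rowDist_self]
    exact add_nonneg (hnn _ hi _ hl) (hnn _ hl _ hm)
  -- the largest of the three numbers has a Katětov row containing the other two
  have hcomm := rowDist_comm w
  rcases lt_or_gt_of_ne hil with hil | hil <;> rcases lt_or_gt_of_ne hlm with hlm | hlm <;>
    rcases lt_or_gt_of_ne him with him | him <;> try omega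
  · linarith [(key m hm i him l hlm).1, hcomm i m, hcomm l m]
  · linarith [(key l hl i hil m hlm).2, hcomm i l]
  · linarith [(key l hl i hil m hlm).2, hcomm i l]
  · linarith [(key m hm i him l hlm).1, hcomm i m, hcomm l m]
  · linarith [(key i hi m him l hil).1, hcomm l m]
  · linarith [(key i hi m him l hil).1, hcomm l m]

/-- A Katětov function on `{0, …, k - 1}` with values in the multiples of `2 ^ (-k)` extends to
`{0, …, j - 1}`, where the values are multiples of `2 ^ (-j)`. -/
theorem exists_katetovDefect_eq_zero {w : ℕ → ℕ} {k j : ℕ} (hk : 0 < k) (hkj : k ≤ j)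
    (h : ∀ i < j, IsKatetovRow w i) {v : ℕ → ℕ} (hv : katetovDefect w k k v = 0) :
    ∃ r : ℕ → ℕ, katetovDefect w j j r = 0 ∧ ∀ i < k, r i = v i * 2 ^ (j - k) := by
  rw [katetovDefect_eq_zero_iff] at hv
  obtain ⟨t, rfl⟩ := Nat.exists_eq_add_of_le hkj
  have : Nonempty (Fin k) := ⟨⟨0, hk⟩⟩
  have hscale : ∀ i < k + t, ∀ l < k + t,
      (2 : ℝ) ^ (k + t) * rowDist w i l = scaledDist w (k + t) i l := fun i hi l hl =>
    (natCast_scaledDist (max_le hi.le hl.le)).symm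
  have hscale' : ∀ i < k, ∀ l < k,
      (2 : ℝ) ^ (k + t) * rowDist w i l = scaledDist w k i l * 2 ^ t := fun i hi l hl => by
    rw [natCast_scaledDist (max_le hi.le hl.le), pow_add]
    ring
  obtain ⟨g, hg, hg1, hg2⟩ := exists_katetov_extension
    (fun a b : Fin (k + t) => 2 ^ (k + t) * rowDist w a b)
    (fun a => by simp only [rowDist_self, mul_zero]) (fun a b => by simp only [rowDist_comm w a b])
    (fun a b c => by
      rw [← mul_add]
      exact mul_le_mul_of_nonneg_left (rowDist_triangle h a.2 b.2 c.2) (by positivity))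
    (fun i : Fin k => Fin.castLE hkj i) (fun i => ((v i * 2 ^ t : ℕ) : ℝ))
    (fun i l => by
      simp only [Fin.val_castLE]
      rw [hscale' i i.2 l l.2]
      have := Nat.mul_le_mul_right (2 ^ t) (hv i i.2 l l.2).1
      rw [add_mul] at this
      exact_mod_cast this)
    (fun i l => by
      simp only [Fin.val_castLE]
      rw [hscale' i i.2 l l.2]
      have := Nat.mul_le_mul_right (2 ^ t) (hv i i.2 l l.2).2
      rw [add_mul] at this
      exact_mod_cast this)
  refine ⟨fun i => if hi : i < k + t then ⌈g ⟨i, hi⟩⌉₊ else 0, katetovDefect_eq_zero_iff.2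
    fun i hi l hl => ?_, fun i hi => ?_⟩
  · simp only [dif_pos hi, dif_pos hl]
    have h1 := hg1 ⟨i, hi⟩ ⟨l, hl⟩
    have h2 := hg2 ⟨i, hi⟩ ⟨l, hl⟩
    simp only [hscale i hi l hl] at h1 h2
    have h3 := Nat.le_ceil (g ⟨i, hi⟩)
    have h4 := Nat.le_ceil (g ⟨l, hl⟩)
    constructor
    · refine Nat.ceil_le.2 ?_
      push_cast
      linarith
    · rw [← Nat.cast_le (α := ℝ)]
      push_cast
      linarith
  · have h1 := hg ⟨i, hi⟩
    simp only [Fin.castLE_mk] at h1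
    beta_reduce
    rw [dif_pos (hi.trans_le hkj), h1, Nat.ceil_natCast, Nat.add_sub_cancel_left]

/-- The problem with the number `j` is to find a point with distances `requiredDist j i` to the
points `i < k` in multiples of `2 ^ (-k)`, where `k` is the first component of `j`. -/
def requiredDist (j i : ℕ) : ℕ := (listOfCode j.unpair.2).getD i 0

/-- The test whether `v` is an admissible row with number `j`, given the preceding rows. It has to
be a Katětov function and, if this is possible, to solve the problem with the number `j`. -/
def rowTest (w : ℕ → ℕ) (j v : ℕ) : ℕ :=
  if katetovDefect w j j (fun i => (listOfCode v).getD i 0) = 0 then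
    if katetovDefect w j.unpair.1 j.unpair.1 (requiredDist j) = 0 then
      if ∑ i ∈ Finset.range j.unpair.1,
        absDiff ((listOfCode v).getD i 0) (requiredDist j i * 2 ^ (j - j.unpair.1)) = 0 then 1
      else 0
    else 1
  else 0

/-- There is a computable sequence of rows that defines a pseudometric on `ℕ` in which all
one-point extension problems are solved approximately. -/
theorem exists_computable_rows : ∃ w : ℕ → ℕ, Computable w ∧ (∀ j, IsKatetovRow w j) ∧
    ∀ j, katetovDefect w j.unpair.1 j.unpair.1 (requiredDist j) = 0 →
      ∀ i < j.unpair.1, rowDist w j i = requiredDist j i / 2 ^ j.unpair.1 := by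
  let c : Unit → List ℕ → ℕ → ℕ := fun _ l v => rowTest (fun i => l.getD i 0) l.length v
  let G : Unit → List ℕ → Prop := fun _ l => ∀ j < l.length, IsKatetovRow (fun i => l.getD i 0) j
  have hc : Computable fun p : Unit × List ℕ × ℕ => c p.1 p.2.1 p.2.2 := by
    dsimp only [c]
    unfold rowTest katetovDefect scaledDist requiredDist absDiff
    fun_prop
  have h0 : ∀ a, G a [] := by
    intro _ j hj
    exact absurd hj (by simp)
  have hex : ∀ a l, G a l → ∃ v, c a l v ≠ 0 := by
    intro _ l hl
    dsimp only [c]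
    obtain ⟨r, hr, hr'⟩ : ∃ r : ℕ → ℕ, katetovDefect (fun i => l.getD i 0) l.length l.length r = 0 ∧
        (katetovDefect (fun i => l.getD i 0) l.length.unpair.1 l.length.unpair.1
          (requiredDist l.length) = 0 → ∀ i < l.length.unpair.1,
            r i = requiredDist l.length i * 2 ^ (l.length - l.length.unpair.1)) := by
      rcases Nat.eq_zero_or_pos l.length with h0 | h0
      · rw [h0]
        exact ⟨fun _ => 0, rfl, fun _ i hi => absurd hi (by simp)⟩
      by_cases hcase : 0 < l.length.unpair.1 ∧ katetovDefect (fun i => l.getD i 0)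
        l.length.unpair.1 l.length.unpair.1 (requiredDist l.length) = 0
      · obtain ⟨r, hr, hr'⟩ := exists_katetovDefect_eq_zero hcase.1 (Nat.unpair_left_le _) hl
          hcase.2
        exact ⟨r, hr, fun _ => hr'⟩
      · -- a second copy of the point `0`
        obtain ⟨r, hr, -⟩ := exists_katetovDefect_eq_zero (v := fun _ => 0) Nat.one_pos h0 hl
          (by simp [katetovDefect, scaledDist])
        exact ⟨r, hr, fun h i hi => absurd ⟨by omega, h⟩ hcase⟩
    refine ⟨Encodable.encode (initSeg r l.length), ?_⟩
    have hget : ∀ i < l.length, (initSeg r l.length).getD i 0 = r i := fun i hi =>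
      getD_initSeg _ hi 0
    rw [rowTest, listOfCode_encode, katetovDefect_congr (fun _ _ => rfl) hget, if_pos hr]
    split_ifs with h1 h2
    · exact one_ne_zero
    · refine absurd (Finset.sum_eq_zero fun i hi => ?_) h2
      rw [Finset.mem_range] at hi
      rw [hget i (hi.trans_le (Nat.unpair_left_le _)), hr' h1 i hi]
      simp [absDiff]
    · exact one_ne_zero
  have hstep : ∀ a l v, G a l → c a l v ≠ 0 → G a (l ++ [v]) := by
    intro _ l v hl hv j hj
    dsimp only [c] at hv
    have hlt : ∀ i < l.length, (l ++ [v]).getD i 0 = l.getD i 0 := fun i hi =>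
      List.getD_append _ _ _ _ hi
    rw [List.length_append, List.length_singleton, Nat.lt_succ_iff] at hj
    rcases hj.lt_or_eq with hj | rfl
    · have := hl j hj
      rw [IsKatetovRow] at this ⊢
      rw [hlt j hj, katetovDefect_congr (fun i hi => hlt i (hi.trans hj)) fun _ _ => rfl]
      exact this
    · rw [rowTest] at hv
      split_ifs at hv with h2 <;> first | exact absurd rfl hv | skip
      all_goals
        rw [IsKatetovRow, katetovDefect_congr hlt fun _ _ => rfl]
        simpa [List.getD_append_right] using h2
  obtain ⟨u, hu, h⟩ := exists_computable_search c hc G h0 hex hstep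
  have hw : ∀ j, ∀ i < j, (initSeg (u ()) j).getD i 0 = u () i := fun j i hi => getD_initSeg _ hi 0
  have hunp : ∀ j : ℕ, j.unpair.1 ≤ j := Nat.unpair_left_le
  refine ⟨u (), by simpa using hu.comp ((Computable.const ()).pair Computable.id), fun j => ?_,
    fun j hj i hi => ?_⟩
  · have h1 : rowTest _ _ _ ≠ 0 := (h () j).2
    rw [length_initSeg, rowTest] at h1
    split_ifs at h1 with h2 <;> first | exact absurd rfl h1 | skip
    all_goals exact (katetovDefect_congr (fun i hi => (hw j i hi).symm) fun _ _ => rfl).trans h2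
  · have h1 : rowTest _ _ _ ≠ 0 := (h () j).2
    rw [length_initSeg, rowTest, katetovDefect_congr (k := j.unpair.1)
      (fun i hi => hw j i (hi.trans_le (hunp j))) (fun _ _ => rfl), if_pos hj] at h1
    split_ifs at h1 with h2 h3 <;> first | exact absurd rfl h1 | skip
    have h4 := Finset.sum_eq_zero_iff.1 h3 i (Finset.mem_range.2 hi)
    have h5 := natCast_absDiff ((listOfCode (u () j)).getD i 0)
      (requiredDist j i * 2 ^ (j - j.unpair.1))
    rw [h4, Nat.cast_zero, eq_comm, abs_eq_zero, sub_eq_zero] at h5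
    rw [rowDist_eq (hi.trans_le (hunp j)), h5]
    push_cast
    have h6 : (2 : ℝ) ^ j = 2 ^ (j - j.unpair.1) * 2 ^ j.unpair.1 := by
      rw [← pow_add, Nat.sub_add_cancel (hunp j)]
    rw [h6]
    field_simp

/-- A space with a dense sequence whose distances are given by `rowDist w`, with `w` as in
`exists_computable_rows`. -/
theorem isUrysohn_of_rowDist {U : Type} [MetricSpace U] [CompleteSpace U] {p : ℕ → U}
    (hp : DenseRange p) {w : ℕ → ℕ} (hdist : ∀ i l, dist (p i) (p l) = rowDist w i l)
    (hw : ∀ j, katetovDefect w j.unpair.1 j.unpair.1 (requiredDist j) = 0 →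
      ∀ i < j.unpair.1, rowDist w j i = requiredDist j i / 2 ^ j.unpair.1) : IsUrysohn U := by
  have : Nonempty U := ⟨p 0⟩
  refine ⟨inferInstance, ⟨Set.range p, Set.countable_range p, hp⟩,
    finitelySaturated_of_exists_dist_eq fun ι _ x f h1 h2 =>
      exists_dist_eq_of_approx (fun ι _ _ x f h1 h2 ε hε => ?_) x f h1 h2⟩
  obtain ⟨g, hg, hg1, hg2⟩ := exists_katetov_extension dist dist_self dist_comm dist_triangle x f
    h1 h2
  have hg0 : ∀ a, 0 ≤ g a := fun a => by
    have := hg2 a a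
    rw [dist_self] at this
    linarith
  have hε3 : 0 < ε / 3 := by positivity
  choose n hn using fun i => Metric.denseRange_iff.1 hp (x i) (ε / 3) hε3
  obtain ⟨t, ht⟩ := exists_pow_lt_of_lt_one hε3 (by norm_num : (2⁻¹ : ℝ) < 1)
  obtain ⟨s, hs⟩ : ∃ s, ∀ i, n i ≤ s := by
    obtain ⟨i, hi⟩ := Finite.exists_max n
    exact ⟨_, hi⟩
  let k := s + t + 1
  have h2k : (0 : ℝ) < 2 ^ k := by positivity
  have hk : (2⁻¹ : ℝ) ^ k < ε / 3 :=
    (pow_le_pow_of_le_one (by norm_num) (by norm_num) (by omega)).trans_lt ht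
  -- distances rounded up to multiples of `2 ^ (-k)` still satisfy the triangle inequalities
  let v : ℕ → ℕ := fun i => ⌈2 ^ k * g (p i)⌉₊
  let j := Nat.pair k (Encodable.encode (initSeg v k))
  have hj : j.unpair.1 = k := by simp [j]
  have hv : ∀ i < k, requiredDist j i = v i := fun i hi => by
    simp only [requiredDist, j, Nat.unpair_pair, listOfCode_encode, getD_initSeg _ hi]
  have hkat : katetovDefect w j.unpair.1 j.unpair.1 (requiredDist j) = 0 := by
    rw [hj, katetovDefect_congr (fun _ _ => rfl) hv, katetovDefect_eq_zero_iff]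
    intro i hi l hl
    have h3 := natCast_scaledDist (w := w) (max_le hi.le hl.le)
    rw [← hdist] at h3
    have h4 := mul_le_mul_of_nonneg_left (hg1 (p i) (p l)) h2k.le
    have h5 := mul_le_mul_of_nonneg_left (hg2 (p i) (p l)) h2k.le
    rw [mul_add] at h4 h5
    have h6 := Nat.le_ceil (2 ^ k * g (p i))
    have h7 := Nat.le_ceil (2 ^ k * g (p l))
    constructor
    · refine Nat.ceil_le.2 ?_
      push_cast
      linarith
    · rw [← Nat.cast_le (α := ℝ)]
      push_cast
      linarith
  refine ⟨p j, fun i => ?_⟩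
  have hik : n i < k := by have := hs i; omega
  have h3 := hw j hkat (n i) (by rwa [hj])
  rw [hj, hv _ hik, ← hdist] at h3
  have h4 : g (p (n i)) ≤ dist (p j) (p (n i)) := by
    rw [h3, le_div_iff₀ h2k, mul_comm]
    exact Nat.le_ceil _
  have h5 : dist (p j) (p (n i)) ≤ g (p (n i)) + 2⁻¹ ^ k := by
    rw [h3, div_le_iff₀ h2k, add_mul, ← mul_pow, inv_mul_cancel₀ two_ne_zero, one_pow, mul_comm]
    exact (Nat.ceil_lt_add_one (mul_nonneg h2k.le (hg0 _))).le
  have h6 := hn i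
  have h7 := hg1 (p (n i)) (x i)
  have h8 := hg1 (x i) (p (n i))
  rw [hg i] at h7 h8
  have h9 := dist_comm (x i) (p (n i))
  have h10 := dist_triangle (x i) (p (n i)) (p j)
  have h11 := dist_triangle_left (p (n i)) (p j) (x i)
  have h12 := dist_comm (p j) (p (n i))
  rw [abs_le]
  constructor <;> linarith

/-- The completion of a pseudometric space of the numbers, given by an abstract pseudometric
space `α` with an enumeration, in order that `ℕ` does not carry two metrics. -/
theorem exists_isUrysohn_of_rowDist {α : Type} [PseudoMetricSpace α] {q : ℕ → α}
    (hq : Function.Surjective q) {w : ℕ → ℕ} (hwc : Computable w)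
    (hdist : ∀ i l, dist (q i) (q l) = rowDist w i l)
    (hw : ∀ j, katetovDefect w j.unpair.1 j.unpair.1 (requiredDist j) = 0 →
      ∀ i < j.unpair.1, rowDist w j i = requiredDist j i / 2 ^ j.unpair.1) :
    ∃ (U : Type) (_ : MetricSpace U), IsUrysohn U ∧ Nonempty (EffectivePresentation U) := by
  have hdist' : ∀ i l, dist (q i : UniformSpace.Completion α) (q l) = rowDist w i l := fun i l => by
    rw [UniformSpace.Completion.dist_eq, hdist]
  have hp : DenseRange fun i => (q i : UniformSpace.Completion α) :=
    UniformSpace.Completion.denseRange_coe.comp hq.denseRange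
      (UniformSpace.Completion.continuous_coe α)
  refine ⟨UniformSpace.Completion α, inferInstance, isUrysohn_of_rowDist hp hdist' hw,
    ⟨⟨_, hp, fun z _ => dyadicCode (scaledDist w (max z.1 z.2) z.1 z.2) (max z.1 z.2), ?_,
      fun i l n => ?_⟩⟩⟩
  · unfold Computable₂ scaledDist
    fun_prop
  · rw [hdist', ratNum_dyadicCode, ← rowDist, sub_self, abs_zero]
    exact (inv_two_pow_pos n).le

theorem exists_isUrysohn :
    ∃ (U : Type) (_ : MetricSpace U), IsUrysohn U ∧ Nonempty (EffectivePresentation U) := by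
  obtain ⟨w, hwc, hkat, hw⟩ := exists_computable_rows
  refine @exists_isUrysohn_of_rowDist ℕ
    { dist := rowDist w
      dist_self := rowDist_self w
      dist_comm := rowDist_comm w
      dist_triangle := fun i l m => rowDist_triangle (n := i + l + m + 1) (fun j _ => hkat j)
        (by omega) (by omega) (by omega) } id Function.surjective_id w hwc (fun _ _ => rfl) hw

end Existence

/-! ### The selections at all types -/

theorem Ty.nonempty_selector {k : ℕ} (X : Fin k → Type u) [∀ i, MetricSpace (X i)]
    (P : ∀ i, EffectivePresentation (X i)) (h : ∀ i, IsEffectiveBanach (P i) ∨ IsUrysohn (X i))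
    (σ : Ty k) : Nonempty (Selector (σ.interp X P)) := by
  induction σ with
  | var i => exact (h i).elim (fun h => h.nonempty_selector) fun h => h.nonempty_selector (P i)
  | arrow σ τ hσ hτ =>
    obtain ⟨S⟩ := hσ
    obtain ⟨T⟩ := hτ
    exact ⟨S.arrow T⟩

theorem mainTheorem4 :
    (∃ (U : Type) (_ : MetricSpace U), IsUrysohn U ∧ Nonempty (EffectivePresentation U)) ∧
    ∀ (k : ℕ) (X : Fin k → Type u) [∀ i, MetricSpace (X i)]
      (P : ∀ i, EffectivePresentation (X i)),
      (∀ i, IsEffectiveBanach (P i) ∨ IsUrysohn (X i)) →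
      ∀ σ : Ty k,
        ∃ (N : ℕ → ℕ) (ν : ∀ n, Fin (N n) → (σ.interp X P).carrier)
          (μ : ∀ n, (σ.interp X P).carrier → PD (N n)),
          Computable N ∧
          IsEffectiveFiniteMaps (σ.interp X P) ν ∧
          IsEffectiveMapsToPD (σ.interp X P) μ ∧
          IsProbabilisticSelection (σ.interp X P).carrier N ν μ := by
  refine ⟨exists_isUrysohn, fun k X _ P h σ => ?_⟩
  obtain ⟨S⟩ := Ty.nonempty_selector X P h σ
  exact S.exists_effective_selection
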